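/- For a finite nonempty graph $G$ let $r(G)=\alpha(G)/|V(G)|$ be its independence ratio, let $G^k$ be its $k$-fold categorical (tensor) power, in which two $k$-tuples of vertices are adjacent if and only if they are adjacent in $G$ in every coordinate, and let $\Theta^T(G)=\lim_{k\to\infty} r(G^k)$ be its tensor capacity. An interval graph is the intersection graph of a finite family of nonempty intervals of the real line. (1) There is an $O(n^3)$ algorithm that computes the tensor capacity of interval graphs. Precisely: there are a program $P$ for a unit-cost random access machine (with constants, copying, addition, truncated subtraction, multiplication, indirect loads and stores, conditionals and loops) and a constant $C$ such that, for every $n\ge 1$ and every interval graph $G$ on $n$ vertices, given by $n$ and its adjacency matrix, $P$ halts after at most $C n^3$ steps, never produces a number larger than $C n^C$ (so that words of $O(\log n)$ bits suffice), and outputs natural numbers $p$ and $q\neq 0$ such that the limit $\Theta^T(G)$ exists and equals $p/q$. (2) Let $(J_v)_{v\in V}$ be a finite family of nonempty intervals of the real line with intersection graph $G$. For a set $I$ of vertices let $N(I)=\bigcup_{u\in I}N(u)$, where $N(u)$ is the set of neighbours of $u$. For $x\in V$ and $k\ge 1$ let $i(x,k)$ be the minimum of $|N(I)|$ over all independent sets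 $I$ of cardinality $k$ that contain $x$ and in which $J_y$ lies entirely to the left of $J_x$ for every $y\in I\setminus\{x\}$ (with $i(x,k)=\infty$ if there is no such $I$). Then $i(x,1)=|N(x)|$, and for all $k\ge 2$ $$i(x,k)=\min_y\{\,i(y,k-1)+|N(x)\setminus N(y)|\,\},$$ where $y$ ranges over the vertices such that $J_y$ lies entirely to the left of $J_x$ (and the minimum over the empty set is $\infty$). -/

import Mathlib

open Filter Topology

/-! ### Tensor powers, independence ratio, tensor capacity -/

/-- The `k`-fold categorical (tensor) power `G × ⋯ × G`: two `k`-tuples are adjacent when they are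
adjacent in every coordinate. For `k ≥ 1` the requirement `f ≠ g` is automatic; it only removes the
loop at the unique vertex of the zeroth power, which plays no role in the limit `k → ∞`. -/
def tensorPow {V : Type*} (G : SimpleGraph V) (k : ℕ) : SimpleGraph (Fin k → V) where
  Adj f g := f ≠ g ∧ ∀ i, G.Adj (f i) (g i)
  symm := ⟨fun _ _ h => ⟨h.1.symm, fun i => (h.2 i).symm⟩⟩
  loopless := ⟨fun _ h => h.1 rfl⟩

/-- The independence ratio `r(G) = α(G) / |V(G)|`. -/
noncomputable def indepRatio {V : Type*} (G : SimpleGraph V) : ℝ :=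
  (G.indepNum : ℝ) / (Nat.card V : ℝ)

/-- `θ` is the tensor capacity of `G`: the limit of `r(G^k)` exists and equals `θ`. -/
def IsTensorCapacity {V : Type*} (G : SimpleGraph V) (θ : ℝ) : Prop :=
  Tendsto (fun k : ℕ => indepRatio (tensorPow G k)) atTop (𝓝 θ)

/-! ### Interval graphs -/

/-- Every `J v` is a nonempty interval of the real line (open, closed, half-open, bounded or
not). -/
def IsIntervalFamily {V : Type*} (J : V → Set ℝ) : Prop :=
  ∀ v, (J v).Nonempty ∧ (J v).OrdConnected

/-- The intersection graph of a family of sets of real numbers. -/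
def intersectionGraph {V : Type*} (J : V → Set ℝ) : SimpleGraph V where
  Adj u v := u ≠ v ∧ (J u ∩ J v).Nonempty
  symm := ⟨fun u v h => ⟨h.1.symm, by rw [Set.inter_comm]; exact h.2⟩⟩
  loopless := ⟨fun _ h => h.1 rfl⟩

/-- `G` is an interval graph: the intersection graph of some family of intervals. -/
def IsIntervalGraph {V : Type*} (G : SimpleGraph V) : Prop :=
  ∃ J : V → Set ℝ, IsIntervalFamily J ∧ G = intersectionGraph J

/-- The interval of `y` lies entirely to the left of the interval of `x`. -/
def LiesLeft {V : Type*} (J : V → Set ℝ) (y x : V) : Prop :=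
  ∀ a ∈ J y, ∀ b ∈ J x, a < b

/-- The neighbourhood `N(I) = ⋃_{u ∈ I} N(u)` of a set of vertices. -/
def nbhd {V : Type*} (G : SimpleGraph V) (I : Set V) : Set V :=
  {v | ∃ u ∈ I, G.Adj u v}

/-- The independent sets of cardinality `k` in which `x` is the rightmost interval. -/
def rightmostIndep {V : Type*} (J : V → Set ℝ) (x : V) (k : ℕ) : Set (Finset V) :=
  {I | (intersectionGraph J).IsIndepSet (I : Set V) ∧ I.card = k ∧ x ∈ I ∧
    ∀ y ∈ I, y ≠ x → LiesLeft J y x}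

/-- `i(x, k)`, the minimum of `|N(I)|` over the independent sets `I` of cardinality `k` whose
rightmost interval is `x` (and `∞` if there are none). -/
noncomputable def minNbhd {V : Type*} (J : V → Set ℝ) (x : V) (k : ℕ) : ℕ∞ :=
  ⨅ I ∈ rightmostIndep J x k, (nbhd (intersectionGraph J) (I : Set V)).encard

/-! ### Random access machines with words of bounded size

Programs are built from the usual unit-cost instructions of a random access machine with
structured control flow (sequencing, conditionals, loops). -/

/-- A configuration: registers and random access memory, each cell holding a natural number. -/
structure RAMState where
  reg : ℕ → ℕ
  mem : ℕ → ℕ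

/-- Replace the content of register `d` by `v`. -/
def RAMState.setReg (s : RAMState) (d v : ℕ) : RAMState :=
  { s with reg := Function.update s.reg d v }

/-- Replace the content of memory cell `a` by `v`. -/
def RAMState.setMem (s : RAMState) (a v : ℕ) : RAMState :=
  { s with mem := Function.update s.mem a v }

/-- RAM programs; `a b c d` below are names of registers, `v` is a literal constant.
* `const d v`: `d := v`;
* `copy d a`: `d := a`;
* `add d a b`, `sub d a b`, `mul d a b`: `d := a + b`, `d := max (a - b) 0`, `d := a * b`;
* `load d a`: `d :=` the content of the memory cell whose address is in `a`;
* `store a b`: write `b` to the memory cell whose address is in `a`;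
* `seq p q`: run `p`, then `q`;
* `ite c p q`: run `p` if `c ≠ 0`, otherwise `q`;
* `loop c p`: while `c ≠ 0`, run `p`. -/
inductive RAMProg where
  | const (d v : ℕ)
  | copy (d a : ℕ)
  | add (d a b : ℕ)
  | sub (d a b : ℕ)
  | mul (d a b : ℕ)
  | load (d a : ℕ)
  | store (a b : ℕ)
  | seq (p q : RAMProg)
  | ite (c : ℕ) (p q : RAMProg)
  | loop (c : ℕ) (p : RAMProg)

/-- `RAMExec W p s t s'`: started in `s`, the program `p` halts in `s'` after exactly `t` steps,
and no number larger than the word bound `W` is ever produced. Each elementary instruction and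
each test of a conditional or of a loop is one step. An instruction whose result would exceed `W`
cannot be executed, so then there is no execution at all. -/
inductive RAMExec (W : ℕ) : RAMProg → RAMState → ℕ → RAMState → Prop
  | const (s : RAMState) (d v : ℕ) (h : v ≤ W) :
      RAMExec W (.const d v) s 1 (s.setReg d v)
  | copy (s : RAMState) (d a : ℕ) :
      RAMExec W (.copy d a) s 1 (s.setReg d (s.reg a))
  | add (s : RAMState) (d a b : ℕ) (h : s.reg a + s.reg b ≤ W) :
      RAMExec W (.add d a b) s 1 (s.setReg d (s.reg a + s.reg b))
  | sub (s : RAMState) (d a b : ℕ) :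
      RAMExec W (.sub d a b) s 1 (s.setReg d (s.reg a - s.reg b))
  | mul (s : RAMState) (d a b : ℕ) (h : s.reg a * s.reg b ≤ W) :
      RAMExec W (.mul d a b) s 1 (s.setReg d (s.reg a * s.reg b))
  | load (s : RAMState) (d a : ℕ) :
      RAMExec W (.load d a) s 1 (s.setReg d (s.mem (s.reg a)))
  | store (s : RAMState) (a b : ℕ) :
      RAMExec W (.store a b) s 1 (s.setMem (s.reg a) (s.reg b))
  | seq {p q : RAMProg} {s s' s'' : RAMState} {t t' : ℕ}
      (hp : RAMExec W p s t s') (hq : RAMExec W q s' t' s'') :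
      RAMExec W (.seq p q) s (t + t') s''
  | iteTrue {c : ℕ} {p : RAMProg} (q : RAMProg) {s s' : RAMState} {t : ℕ}
      (hc : s.reg c ≠ 0) (hp : RAMExec W p s t s') :
      RAMExec W (.ite c p q) s (t + 1) s'
  | iteFalse {c : ℕ} (p : RAMProg) {q : RAMProg} {s s' : RAMState} {t : ℕ}
      (hc : s.reg c = 0) (hq : RAMExec W q s t s') :
      RAMExec W (.ite c p q) s (t + 1) s'
  | loopDone {c : ℕ} (p : RAMProg) {s : RAMState} (hc : s.reg c = 0) :
      RAMExec W (.loop c p) s 1 s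
  | loopStep {c : ℕ} {p : RAMProg} {s s' s'' : RAMState} {t t' : ℕ}
      (hc : s.reg c ≠ 0) (hp : RAMExec W p s t s') (hl : RAMExec W (.loop c p) s' t' s'') :
      RAMExec W (.loop c p) s (t + t' + 1) s''

open Classical in
/-- The initial configuration for the input graph `G` on `{0, …, n - 1}`: register `0` holds `n`,
memory cell `i * n + j` holds the entry of the adjacency matrix at `(i, j)` for `i, j < n`, and all
other cells and registers hold `0`. -/
noncomputable def graphInput {n : ℕ} (G : SimpleGraph (Fin n)) : RAMState where
  reg r := if r = 0 then n else 0
  mem a := if ∃ i j : Fin n, G.Adj i j ∧ a = (i : ℕ) * n + (j : ℕ) then 1 else 0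

/-! The tensor capacity has a closed form. Let `I` minimise `|N(I)| / |I|` over the nonempty
independent sets. If `|N(I)| < |I|` the capacity is `1`, otherwise it is `|I| / (|I| + |N(I)|)`
(`isTensorCapacity_of_optimal`). The upper bound rests on `Expanding.tensor`: if every independent
set expands by a ratio `m / p ≥ 1`, the same holds in tensor products, hence in all powers, and
there an independent set is disjoint from its neighbourhood. The lower bounds are explicit: tuples
whose first coordinate in `I ∪ N(I)` lies in `I`, and, if `|N(I)| < |I|`, tuples with more
coordinates in `I` than in `N(I)`, which are almost all tuples.

It remains to find the least `|N(I)|` for each cardinality. If `x` is the rightmost and `y` the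
second rightmost member of `I`, a neighbour of `x` that also meets an earlier member has to meet
`y`. So adding `x` adds exactly `|N(x) \ N(y)|` new neighbours (`IndepMax.insert`). This is the
recurrence: a table of `n ^ 2` entries, each a minimum over at most `n` terms. The argument uses
only a strict partial order whose comparable pairs are the nonadjacent ones (`IsCoOrient`), not the
intervals.

Such an order is computed from the adjacency matrix by forcing. Choose `z < v` for an uncompared
pair, add all consequences of transitivity, and repeat, taking the vertices `z` by decreasing
degree. No choice needs to be revised (`IsStage.exists_orient`). Indeed, the connected components of
the graph of uncompared pairs are modules, so an order can be altered inside such a component `C` at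
will. Let `z` have the largest degree in `C`, and let `K` be the connected component of `z` in the
subgraph of `G` induced on `C`. Moving `K` in front of the rest of `C` puts `z` before `C \ K`.
Inside `K`, the comparisons of `z` with its nonneighbours all force one another
(`CoClosed.oriented_of_reach`); this is where the degree and the absence of induced four-cycles
enter. So inside `K` there is one choice only, and reversing `K` makes it correct.

Every ordered pair enters a queue once and is matched with `n` vertices, so the orientation costs
`O(n ^ 3)` steps, as do the differences `|N(x) \ N(y)|` and the table. A program logic with a step
counter turns these loops into an execution with explicit bounds. -/

/-! ### Independent sets and neighbourhoods of relations -/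

section Expansion

open Classical

/-- No two members of `I` are related. -/
def RelIndep {α : Type*} (R : α → α → Prop) (I : Finset α) : Prop :=
  ∀ u ∈ I, ∀ v ∈ I, ¬R u v

/-- The elements related to some member of `I`. -/
noncomputable def relNbhd {α : Type*} [Fintype α] (R : α → α → Prop) (I : Finset α) : Finset α :=
  Finset.univ.filter fun v => ∃ u ∈ I, R u v

theorem mem_relNbhd {α : Type*} [Fintype α] {R : α → α → Prop} {I : Finset α} {v : α} :
    v ∈ relNbhd R I ↔ ∃ u ∈ I, R u v := by
  simp [relNbhd]

/-- Every independent set `I` satisfies `|N(I)| / |I| ≥ m / p`. -/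
def Expanding {α : Type*} [Fintype α] (p m : ℕ) (R : α → α → Prop) : Prop :=
  ∀ I : Finset α, RelIndep R I → m * I.card ≤ p * (relNbhd R I).card

/-- The tensor product of two relations. -/
def tensorRel {α β : Type*} (R : α → α → Prop) (S : β → β → Prop) : α × β → α × β → Prop :=
  fun a b => R a.1 b.1 ∧ S a.2 b.2

/-- Split `B` into the part `B1` that has neighbours in `B` and the rest `B0`. Then `B0 ∪ T` is
independent and expands by `m / p`, which is at least `1`. No point of `B1` is a neighbour of `B0 ∪
T`, and `B1` lies in `N(B)`, so `B1` contributes its own size to the neighbourhood on top of that.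
-/
theorem Expanding.card_relNbhd_union {α : Type*} [Fintype α] {p m : ℕ} {R : α → α → Prop}
    (hs : ∀ u v, R u v → R v u) (h : Expanding p m R) (hpm : p ≤ m) {B T : Finset α}
    (hT : RelIndep R T) (hBT : ∀ b ∈ B, ∀ t ∈ T, ¬R b t) (hd : Disjoint B T) :
    p * B.card + m * T.card ≤ p * (relNbhd R (B ∪ T)).card := by
  set B1 := B.filter fun b => b ∈ relNbhd R B with hB1
  set B0 := B.filter fun b => b ∉ relNbhd R B with hB0
  have hcard : B1.card + B0.card = B.card := Finset.card_filter_add_card_filter_not _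
  have hind : RelIndep R (B0 ∪ T) := by
    intro u hu v hv huv
    simp only [Finset.mem_union, hB0, Finset.mem_filter, mem_relNbhd] at hu hv
    rcases hu with ⟨hu, hu'⟩ | hu <;> rcases hv with ⟨hv, hv'⟩ | hv
    · exact hv' ⟨u, hu, huv⟩
    · exact hBT u hu v hv huv
    · exact hBT v hv u hu (hs _ _ huv)
    · exact hT u hu v hv huv
  have hd0 : Disjoint B0 T := hd.mono_left (Finset.filter_subset _ _)
  have h0 := h _ hind
  rw [Finset.card_union_of_disjoint hd0] at h0
  have hd1 : Disjoint B1 (relNbhd R (B0 ∪ T)) := by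
    rw [Finset.disjoint_left]
    intro b hb hb'
    simp only [hB1, hB0, Finset.mem_filter, mem_relNbhd, Finset.mem_union] at hb hb'
    obtain ⟨u, hu | hu, hub⟩ := hb'
    · exact hu.2 ⟨b, hb.1, hs _ _ hub⟩
    · exact hBT b hb.1 u hu (hs _ _ hub)
  have hsub : B1 ∪ relNbhd R (B0 ∪ T) ⊆ relNbhd R (B ∪ T) := by
    intro b hb
    simp only [hB1, hB0, Finset.mem_filter, mem_relNbhd, Finset.mem_union] at hb ⊢
    rcases hb with ⟨_, u, hu, hub⟩ | ⟨u, hu, hub⟩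
    · exact ⟨u, Or.inl hu, hub⟩
    · exact ⟨u, hu.imp (fun h => h.1) id, hub⟩
  have h1 := Finset.card_le_card hsub
  rw [Finset.card_union_of_disjoint hd1] at h1
  calc p * B.card + m * T.card ≤ p * B1.card + m * (B0.card + T.card) := by
        rw [← hcard]; nlinarith [Nat.mul_le_mul_right B0.card hpm]
    _ ≤ p * B1.card + p * (relNbhd R (B0 ∪ T)).card := by omega
    _ = p * (B1.card + (relNbhd R (B0 ∪ T)).card) := by ring
    _ ≤ _ := Nat.mul_le_mul_left _ h1

theorem card_eq_sum_card_fst_fiber {α β : Type*} [Fintype α] [Fintype β] (X : Finset (α × β)) :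
    X.card = ∑ a, (Finset.univ.filter fun b => (a, b) ∈ X).card := by
  have : X.card = ∑ x : α × β, if x ∈ X then 1 else 0 := by simp
  rw [this, Fintype.sum_prod_type]
  exact Finset.sum_congr rfl fun _ _ => (Finset.card_filter _ _).symm

theorem card_eq_sum_card_snd_fiber {α β : Type*} [Fintype α] [Fintype β] (X : Finset (α × β)) :
    X.card = ∑ b, (Finset.univ.filter fun a => (a, b) ∈ X).card := by
  have : X.card = ∑ x : α × β, if x ∈ X then 1 else 0 := by simp
  rw [this, Fintype.sum_prod_type_right]
  exact Finset.sum_congr rfl fun _ _ => (Finset.card_filter _ _).symm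

/-- The two coordinates are treated one after the other. The points of `X` with no `R`-neighbour in
`X` at the same second coordinate form `X1`; for each fixed second coordinate they are independent,
so moving the first coordinate along `R` expands them to `M`. The remaining points `X2` are not
moved. Then the second coordinate is moved along `S`, where `M` must not shrink and `X2` must
expand: this is `Expanding.card_relNbhd_union`. -/
theorem Expanding.tensor {α β : Type*} [Fintype α] [Fintype β] {p m : ℕ} {R : α → α → Prop}
    {S : β → β → Prop} (hR : ∀ u v, R u v → R v u) (hS : ∀ u v, S u v → S v u)
    (eR : Expanding p m R) (eS : Expanding p m S) (hpm : p ≤ m) :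
    Expanding p m (tensorRel R S) := by
  intro X hX
  have hX' : ∀ {a a' b b'}, (a, b) ∈ X → (a', b') ∈ X → R a a' → S b b' → False :=
    fun h h' hr hs => hX _ h _ h' ⟨hr, hs⟩
  set X2 := X.filter fun q => ∃ a, R a q.1 ∧ (a, q.2) ∈ X with hX2
  set X1 := X.filter fun q => ¬∃ a, R a q.1 ∧ (a, q.2) ∈ X with hX1
  set M := (Finset.univ : Finset (α × β)).filter fun q => ∃ a, R a q.1 ∧ (a, q.2) ∈ X1 with hM
  have hcard : X2.card + X1.card = X.card := Finset.card_filter_add_card_filter_not _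
  have hX1M : m * X1.card ≤ p * M.card := by
    rw [card_eq_sum_card_snd_fiber X1, card_eq_sum_card_snd_fiber M, Finset.mul_sum,
      Finset.mul_sum]
    refine Finset.sum_le_sum fun b _ => ?_
    have hM' : (Finset.univ.filter fun a => (a, b) ∈ M) =
        relNbhd R (Finset.univ.filter fun a => (a, b) ∈ X1) := by
      ext a
      simp only [Finset.mem_filter, Finset.mem_univ, true_and, mem_relNbhd, hM]
      exact exists_congr fun _ => and_comm
    rw [hM']
    apply eR
    intro u hu v hv huv
    simp only [Finset.mem_filter, Finset.mem_univ, true_and, hX1] at hu hv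
    exact hv.2 ⟨u, huv, hu.1⟩
  -- Over a fixed `a`, the fibre of `M` plays the part of `B` and that of `X2` the part of `T`. Each
  -- of their points has a point of `X` with the same second coordinate and an `R`-adjacent first
  -- one, so its `S`-neighbours over `a` are neighbours of `X`.
  have hrest : p * M.card + m * X2.card ≤ p * (relNbhd (tensorRel R S) X).card := by
    rw [card_eq_sum_card_fst_fiber X2, card_eq_sum_card_fst_fiber M,
      card_eq_sum_card_fst_fiber (relNbhd (tensorRel R S) X), Finset.mul_sum, Finset.mul_sum,
      Finset.mul_sum, ← Finset.sum_add_distrib]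
    refine Finset.sum_le_sum fun a _ => ?_
    refine (eS.card_relNbhd_union hS hpm (B := Finset.univ.filter fun b => (a, b) ∈ M)
      (T := Finset.univ.filter fun b => (a, b) ∈ X2) ?_ ?_ ?_).trans
      (Nat.mul_le_mul_left _ (Finset.card_le_card ?_))
    · intro u hu v hv huv
      simp only [Finset.mem_filter, Finset.mem_univ, true_and, hX2] at hu hv
      obtain ⟨_, a', ha', h'⟩ := hu
      exact hX' h' hv.1 ha' huv
    · intro u hu v hv huv
      simp only [Finset.mem_filter, Finset.mem_univ, true_and, hX2, hX1, hM] at hu hv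
      obtain ⟨a', ha', h', _⟩ := hu
      exact hX' h' hv.1 ha' huv
    · rw [Finset.disjoint_left]
      intro b hb hb'
      simp only [Finset.mem_filter, Finset.mem_univ, true_and, hX2, hX1, hM] at hb hb'
      obtain ⟨a', ha', h', h''⟩ := hb
      exact h'' ⟨a, hR _ _ ha', hb'.1⟩
    · intro b hb
      simp only [Finset.mem_filter, Finset.mem_univ, true_and, hX2, hX1, hM, mem_relNbhd,
        Finset.mem_union] at hb ⊢
      obtain ⟨b', ⟨a', ha', h', _⟩ | ⟨_, a', ha', h'⟩, hb'⟩ := hb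
      · exact ⟨(a', b'), h', ha', hb'⟩
      · exact ⟨(a', b'), h', ha', hb'⟩
  rw [← hcard, Nat.mul_add]
  omega

theorem Expanding.of_equiv {α β : Type*} [Fintype α] [Fintype β] {p m : ℕ} {R : α → α → Prop}
    {S : β → β → Prop} (e : α ≃ β) (he : ∀ u v, R u v ↔ S (e u) (e v)) (hS : Expanding p m S) :
    Expanding p m R := by
  intro I hI
  have h := hS (I.map e.toEmbedding) (by
    intro u hu v hv huv
    obtain ⟨a, ha, rfl⟩ := Finset.mem_map.1 hu
    obtain ⟨b, hb, rfl⟩ := Finset.mem_map.1 hv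
    exact hI a ha b hb ((he _ _).2 huv))
  have hN : relNbhd S (I.map e.toEmbedding) = (relNbhd R I).map e.toEmbedding := by
    ext v
    simp only [mem_relNbhd, Finset.mem_map_equiv, he, Equiv.apply_symm_apply]
    constructor
    · rintro ⟨u, hu, huv⟩
      exact ⟨_, hu, by simpa using huv⟩
    · rintro ⟨u, hu, huv⟩
      exact ⟨e u, by simpa using hu, huv⟩
  rwa [hN, Finset.card_map, Finset.card_map] at h

/-- Coordinatewise relatedness of tuples. -/
def powRel {α : Type*} (R : α → α → Prop) (k : ℕ) : (Fin k → α) → (Fin k → α) → Prop :=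
  fun f g => ∀ i, R (f i) (g i)

theorem Expanding.pow {α : Type*} [Fintype α] {p m : ℕ} {R : α → α → Prop}
    (hR : ∀ u v, R u v → R v u) (eR : Expanding p m R) (hpm : p ≤ m) (k : ℕ) :
    Expanding p m (powRel R k) := by
  induction k with
  -- With no coordinates the relation holds between the empty tuple and itself, so only the empty
  -- set is independent.
  | zero =>
    intro I hI
    have : I = ∅ := by
      rw [Finset.eq_empty_iff_forall_notMem]
      intro f hf
      exact hI f hf f hf fun i => i.elim0
    simp [this]
  | succ k ih =>
    refine Expanding.of_equiv (S := tensorRel R (powRel R k)) (Fin.consEquiv fun _ => α).symm ?_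
      (eR.tensor hR (fun u v h i => hR _ _ (h i)) ih hpm)
    intro u v
    simp [powRel, tensorRel, Fin.forall_fin_succ, Fin.consEquiv, Fin.tail]

end Expansion

/-! ### The tensor capacity -/

section Capacity

open Classical

theorem tensorPow_adj_iff {V : Type*} (G : SimpleGraph V) {k : ℕ} (hk : k ≠ 0) (f g : Fin k → V) :
    (tensorPow G k).Adj f g ↔ powRel G.Adj k f g := by
  refine ⟨fun h => h.2, fun h => ⟨?_, h⟩⟩
  rintro rfl
  exact (h ⟨0, Nat.pos_of_ne_zero hk⟩).ne rfl

theorem isIndepSet_tensorPow_iff {V : Type*} (G : SimpleGraph V) {k : ℕ} (hk : k ≠ 0)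
    (X : Finset (Fin k → V)) :
    (tensorPow G k).IsIndepSet (X : Set (Fin k → V)) ↔ RelIndep (powRel G.Adj k) X := by
  constructor
  · intro h u hu v hv huv
    rw [← tensorPow_adj_iff G hk] at huv
    exact h hu hv huv.ne huv
  · intro h u hu v hv _ huv
    rw [tensorPow_adj_iff G hk] at huv
    exact h u hu v hv huv

/-- A largest independent set `X` of the power is disjoint from `N(X)`, and `m |X| ≤ p |N(X)|`;
together they fill at most the whole vertex set. -/
theorem indepRatio_tensorPow_le {V : Type*} [Fintype V]
    (G : SimpleGraph V) {p m : ℕ} (hp : 0 < p) (hpm : p ≤ m)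
    (h : Expanding p m G.Adj) {k : ℕ} (hk : k ≠ 0) :
    indepRatio (tensorPow G k) ≤ (p : ℝ) / (p + m) := by
  obtain ⟨X, hX⟩ := (tensorPow G k).exists_isNIndepSet_indepNum
  have hi := (isIndepSet_tensorPow_iff G hk X).1 hX.1
  have h1 := (h.pow (fun _ _ => G.symm.symm _ _) hpm k) X hi
  have hd : Disjoint X (relNbhd (powRel G.Adj k) X) := by
    rw [Finset.disjoint_left]
    intro v hv hv'
    obtain ⟨u, hu, huv⟩ := mem_relNbhd.1 hv'
    exact hi u hu v hv huv
  have h2 := Finset.card_le_univ (X ∪ relNbhd (powRel G.Adj k) X)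
  rw [Finset.card_union_of_disjoint hd, hX.2] at h2
  rw [hX.2] at h1
  have h3 : (p + m) * (tensorPow G k).indepNum ≤ p * Fintype.card (Fin k → V) := by
    nlinarith [Nat.mul_le_mul_left p h2]
  unfold indepRatio
  rw [Nat.card_eq_fintype_card]
  have hpm' : (0 : ℝ) < p + m := by positivity
  apply div_le_of_le_mul₀ (by positivity) (by positivity)
  rw [div_mul_eq_mul_div, le_div_iff₀ hpm']
  have h4 : ((p : ℝ) + m) * (tensorPow G k).indepNum ≤ p * Fintype.card (Fin k → V) := by
    exact_mod_cast h3
  linarith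

theorem card_le_indepRatio_tensorPow {V : Type*} [Fintype V]
    (G : SimpleGraph V) {k : ℕ} (hk : k ≠ 0)
    {X : Finset (Fin k → V)} (hX : RelIndep (powRel G.Adj k) X) :
    (X.card : ℝ) / Fintype.card (Fin k → V) ≤ indepRatio (tensorPow G k) := by
  unfold indepRatio
  rw [Nat.card_eq_fintype_card]
  gcongr
  exact ((isIndepSet_tensorPow_iff G hk X).2 hX).card_le_indepNum

theorem indepRatio_tensorPow_le_one {V : Type*} [Fintype V] (G : SimpleGraph V) (k : ℕ) :
    indepRatio (tensorPow G k) ≤ 1 := by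
  obtain ⟨X, hX⟩ := (tensorPow G k).exists_isNIndepSet_indepNum
  unfold indepRatio
  rw [Nat.card_eq_fintype_card, ← hX.2]
  exact div_le_one_of_le₀ (by exact_mod_cast Finset.card_le_univ X) (by positivity)

/-- Tuples whose first coordinate in `I ∪ N(I)` belongs to `I`. -/
theorem exists_relIndep_pow {V : Type*} [Fintype V] [Nonempty V] (G : SimpleGraph V) {I : Finset V}
    (hI : RelIndep G.Adj I) (hne : I.Nonempty) (k : ℕ) :
    ∃ X : Finset (Fin k → V), RelIndep (powRel G.Adj k) X ∧
      (I.card : ℝ) / (I.card + (relNbhd G.Adj I).card) *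
        (1 - (1 - (I.card + (relNbhd G.Adj I).card : ℝ) / Fintype.card V) ^ k) ≤
      (X.card : ℝ) / Fintype.card (Fin k → V) := by
  have hn : (0 : ℝ) < Fintype.card V := by exact_mod_cast Fintype.card_pos
  have hs : (0 : ℝ) < I.card := by exact_mod_cast hne.card_pos
  set s : ℝ := ((I.card : ℕ) : ℝ)
  set q : ℝ := (((relNbhd G.Adj I).card : ℕ) : ℝ) with hq
  have hq0 : 0 ≤ q := by positivity
  have hdis : Disjoint I (relNbhd G.Adj I) := by
    rw [Finset.disjoint_left]
    intro v hv hv'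
    obtain ⟨u, hu, huv⟩ := mem_relNbhd.1 hv'
    exact hI u hu v hv huv
  induction k with
  | zero => exact ⟨∅, by simp [RelIndep], by simp⟩
  | succ k ih =>
    obtain ⟨X, hX, hcard⟩ := ih
    set O : Finset V := (I ∪ relNbhd G.Adj I)ᶜ with hO
    -- The first coordinate decides if it lies in `I` or `N(I)`; if it lies in neither, the decision
    -- is left to the remaining coordinates.
    set Y : Finset (V × (Fin k → V)) := I ×ˢ Finset.univ ∪ O ×ˢ X with hY
    refine ⟨Y.map (Fin.consEquiv fun _ => V).toEmbedding, ?_, ?_⟩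
    · intro f hf g hg hfg
      simp only [Finset.mem_map_equiv, hY, Finset.mem_union, Finset.mem_product, hO,
        Finset.mem_compl, Finset.mem_univ, and_true] at hf hg
      simp only [Fin.consEquiv, Equiv.coe_fn_symm_mk] at hf hg
      have h0 := hfg 0
      rcases hf with hf | hf <;> rcases hg with hg | hg
      · exact hI _ hf _ hg h0
      · exact hg.1 (Or.inr (mem_relNbhd.2 ⟨_, hf, h0⟩))
      · exact hf.1 (Or.inr (mem_relNbhd.2 ⟨_, hg, h0.symm⟩))
      · exact hX _ hf.2 _ hg.2 fun i => hfg i.succ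
    · have hYc : Y.card = I.card * Fintype.card (Fin k → V) + O.card * X.card := by
        rw [hY, Finset.card_union_of_disjoint, Finset.card_product, Finset.card_product,
          Finset.card_univ]
        rw [Finset.disjoint_left]
        rintro ⟨a, f⟩ h1 h2
        simp only [Finset.mem_product, hO, Finset.mem_compl, Finset.mem_union] at h1 h2
        exact h2.1 (Or.inl h1.1)
      have hOc : (O.card : ℝ) = Fintype.card V - (s + q) := by
        rw [hO, Finset.card_compl, Nat.cast_sub (Finset.card_le_univ _),
          Finset.card_union_of_disjoint hdis]
        push_cast
        rfl
      have hO0 : (0 : ℝ) ≤ Fintype.card V - (s + q) := by rw [← hOc]; positivity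
      rw [Finset.card_map, hYc]
      have hN : (0 : ℝ) < Fintype.card (Fin k → V) := by exact_mod_cast Fintype.card_pos
      have hNs : (Fintype.card (Fin (k + 1) → V) : ℝ) =
          Fintype.card V * Fintype.card (Fin k → V) := by
        simp [pow_succ, mul_comm]
      push_cast
      rw [hNs, hOc]
      set n : ℝ := ((Fintype.card V : ℕ) : ℝ)
      set N : ℝ := ((Fintype.card (Fin k → V) : ℕ) : ℝ)
      have e : (s * N + (n - (s + q)) * X.card) / (n * N) =
          s / n + (1 - (s + q) / n) * (X.card / N) := by
        field_simp
      have h1 : 0 ≤ 1 - (s + q) / n := by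
        rw [sub_nonneg, div_le_one hn]; linarith
      change _ ≤ (s * N + _) / _
      rw [e]
      -- The densities satisfy `d (k + 1) = s / n + (1 - (s + q) / n) * d k`, and the claimed bound
      -- solves this recursion exactly.
      calc _ = s / n + (1 - (s + q) / n) * (s / (s + q) * (1 - (1 - (s + q) / n) ^ k)) := by
            rw [pow_succ]
            field_simp
            ring
        _ ≤ _ := by gcongr

/-- Tuples with more coordinates in `I` than in `N(I)`. -/
theorem exists_relIndep_pow_of_card_lt {V : Type*} [Fintype V] [Nonempty V]
    (G : SimpleGraph V) {I : Finset V}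
    (hI : RelIndep G.Adj I) (hlt : (relNbhd G.Adj I).card < I.card) :
    ∃ ρ : ℝ, 0 ≤ ρ ∧ ρ < 1 ∧ ∀ k : ℕ, ∃ X : Finset (Fin k → V), RelIndep (powRel G.Adj k) X ∧
      1 - ρ ^ k ≤ (X.card : ℝ) / Fintype.card (Fin k → V) := by
  have hn : (0 : ℝ) < Fintype.card V := by exact_mod_cast Fintype.card_pos
  set N := relNbhd G.Adj I with hN
  have hdis : Disjoint I N := by
    rw [Finset.disjoint_left]
    intro v hv hv'
    obtain ⟨u, hu, huv⟩ := mem_relNbhd.1 hv'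
    exact hI u hu v hv huv
  -- An exponential moment bound. The base `x > 1` is close enough to `1` that `|N| * x < |N| + 1 ≤
  -- |I|`, which makes the mean of the weight `w` less than `1`.
  set x : ℝ := 1 + 1 / (N.card + 1) with hx
  have hx1 : 1 < x := by rw [hx]; simp; positivity
  have hx0 : 0 < x := by linarith
  set w : V → ℝ := fun v => if v ∈ I then x⁻¹ else if v ∈ N then x else 1 with hw
  have hw0 : ∀ v, 0 < w v := by
    intro v; simp only [hw]; split_ifs <;> positivity
  have hsum : ∑ v, w v < Fintype.card V := by
    have h1 : ∀ v, w v - 1 = (if v ∈ I then x⁻¹ - 1 else 0) + (if v ∈ N then x - 1 else 0) := by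
      intro v
      simp only [hw]
      by_cases h : v ∈ I
      · have : v ∉ N := Finset.disjoint_left.1 hdis h
        simp [h, this]
      · by_cases h' : v ∈ N <;> simp [h, h']
    have h2 : ∑ v, w v - Fintype.card V = I.card * (x⁻¹ - 1) + N.card * (x - 1) := by
      have : ∑ v, w v - Fintype.card V = ∑ v, (w v - 1) := by simp
      rw [this, Finset.sum_congr rfl fun v _ => h1 v, Finset.sum_add_distrib]
      simp [Finset.sum_ite_mem]
      ring
    have h3 : (N.card : ℝ) + 1 ≤ I.card := by exact_mod_cast hlt
    have h4 : (I.card : ℝ) * (x⁻¹ - 1) + N.card * (x - 1) < 0 := by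
      have hNx : N.card * x < I.card := by
        have : (N.card : ℝ) * x < N.card + 1 := by
          rw [hx, mul_add, mul_one, mul_one_div]
          have : (N.card : ℝ) / (N.card + 1) < 1 := by
            rw [div_lt_one (by positivity)]; linarith
          linarith
        linarith
      have : (I.card : ℝ) * (x⁻¹ - 1) + N.card * (x - 1) = (x - 1) * (N.card * x - I.card) / x := by
        field_simp
        ring
      rw [this]
      apply div_neg_of_neg_of_pos _ hx0
      exact mul_neg_of_pos_of_neg (by linarith) (by linarith)
    linarith
  refine ⟨(∑ v, w v) / Fintype.card V, ?_, (div_lt_one hn).2 hsum, ?_⟩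
  · exact div_nonneg (Finset.sum_nonneg fun v _ => (hw0 v).le) hn.le
  intro k
  set cI : (Fin k → V) → ℕ := fun f => (Finset.univ.filter fun i => f i ∈ I).card with hcI
  set cN : (Fin k → V) → ℕ := fun f => (Finset.univ.filter fun i => f i ∈ N).card with hcN
  refine ⟨Finset.univ.filter fun f => cN f < cI f, ?_, ?_⟩
  · intro f hf g hg hfg
    simp only [Finset.mem_filter, Finset.mem_univ, true_and] at hf hg
    have h1 : cI f ≤ cN g := by
      apply Finset.card_le_card
      intro i hi
      simp only [Finset.mem_filter, Finset.mem_univ, true_and] at hi ⊢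
      exact mem_relNbhd.2 ⟨_, hi, hfg i⟩
    have h2 : cI g ≤ cN f := by
      apply Finset.card_le_card
      intro i hi
      simp only [Finset.mem_filter, Finset.mem_univ, true_and] at hi ⊢
      exact mem_relNbhd.2 ⟨_, hi, (hfg i).symm⟩
    omega
  -- A tuple outside the set has weight at least `1`, while all weights together sum to `(∑ v, w v)
  -- ^ k`. This bounds the number of tuples that are left out.
  · have hprod : ∀ f : Fin k → V, cI f ≤ cN f → 1 ≤ ∏ i, w (f i) := by
      intro f hf
      have h1 : ∏ i, w (f i) = (x⁻¹) ^ cI f * x ^ cN f := by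
        have : ∀ i, w (f i) = (if f i ∈ I then x⁻¹ else 1) * (if f i ∈ N then x else 1) := by
          intro i
          simp only [hw]
          by_cases h : f i ∈ I
          · have : f i ∉ N := Finset.disjoint_left.1 hdis h
            simp [h, this]
          · simp [h]
        rw [Finset.prod_congr rfl fun i _ => this i, Finset.prod_mul_distrib, Finset.prod_ite,
          Finset.prod_ite]
        simp [hcI, hcN]
      rw [h1, inv_pow, inv_mul_eq_div, one_le_div (by positivity)]
      exact pow_le_pow_right₀ hx1.le hf
    have hpow : (∑ v, w v) ^ k = ∑ f : Fin k → V, ∏ i, w (f i) := by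
      have := Finset.prod_univ_sum (fun _ : Fin k => (Finset.univ : Finset V)) fun _ v => w v
      simpa using this
    have hbad : ((Finset.univ.filter fun f => ¬cN f < cI f).card : ℝ) ≤ (∑ v, w v) ^ k := by
      rw [hpow, Finset.card_eq_sum_ones, Nat.cast_sum]
      calc _ ≤ ∑ f ∈ Finset.univ.filter fun f => ¬cN f < cI f, ∏ i, w (f i) := by
            refine Finset.sum_le_sum fun f hf => ?_
            simp only [Finset.mem_filter, Finset.mem_univ, true_and, not_lt] at hf
            simpa using hprod f hf
        _ ≤ _ := Finset.sum_le_sum_of_subset_of_nonneg (Finset.filter_subset _ _)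
            fun f _ _ => Finset.prod_nonneg fun i _ => (hw0 _).le
    have hadd : ((Finset.univ.filter fun f : Fin k → V => cN f < cI f).card : ℝ) +
        ((Finset.univ.filter fun f => ¬cN f < cI f).card : ℝ) = Fintype.card (Fin k → V) := by
      rw [← Nat.cast_add, Finset.card_filter_add_card_filter_not, Finset.card_univ]
    have hk0 : (0 : ℝ) < Fintype.card (Fin k → V) := by exact_mod_cast Fintype.card_pos
    have hk1 : (Fintype.card (Fin k → V) : ℝ) = (Fintype.card V : ℝ) ^ k := by simp
    rw [le_div_iff₀ hk0, div_pow, ← hk1, sub_mul, div_mul_cancel₀ _ hk0.ne']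
    linarith

/-- The tensor capacity is the largest `|I| / (|I| + |N(I)|)` if that is at most `1 / 2`, and `1`
otherwise. -/
theorem isTensorCapacity_of_optimal {V : Type*} [Fintype V] [Nonempty V]
    (G : SimpleGraph V) {I : Finset V}
    (hI : RelIndep G.Adj I) (hne : I.Nonempty)
    (hopt : Expanding I.card (relNbhd G.Adj I).card G.Adj) :
    IsTensorCapacity G (if (relNbhd G.Adj I).card < I.card then 1 else
      (I.card : ℝ) / (I.card + (relNbhd G.Adj I).card)) := by
  have hn : (0 : ℝ) < Fintype.card V := by exact_mod_cast Fintype.card_pos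
  have hne0 : ∀ᶠ k : ℕ in atTop, k ≠ 0 := eventually_ne_atTop 0
  unfold IsTensorCapacity
  split_ifs with hlt
  · obtain ⟨ρ, h0, h1, h⟩ := exists_relIndep_pow_of_card_lt G hI hlt
    have hlim : Tendsto (fun k : ℕ => 1 - ρ ^ k) atTop (𝓝 1) := by
      simpa using (tendsto_pow_atTop_nhds_zero_of_lt_one h0 h1).const_sub 1
    refine tendsto_of_tendsto_of_tendsto_of_le_of_le' hlim tendsto_const_nhds ?_
      (Eventually.of_forall fun k => indepRatio_tensorPow_le_one G k)
    filter_upwards [hne0] with k hk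
    obtain ⟨X, hX, hc⟩ := h k
    exact hc.trans (card_le_indepRatio_tensorPow G hk hX)
  · set s : ℝ := ((I.card : ℕ) : ℝ) with hs
    set q : ℝ := (((relNbhd G.Adj I).card : ℕ) : ℝ) with hq
    have hs0 : 0 < s := by rw [hs]; exact_mod_cast hne.card_pos
    have hq0 : 0 ≤ q := by positivity
    have hdis : Disjoint I (relNbhd G.Adj I) := by
      rw [Finset.disjoint_left]
      intro v hv hv'
      obtain ⟨u, hu, huv⟩ := mem_relNbhd.1 hv'
      exact hI u hu v hv huv
    have hle : s + q ≤ Fintype.card V := by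
      have := Finset.card_le_univ (I ∪ relNbhd G.Adj I)
      rw [Finset.card_union_of_disjoint hdis] at this
      rw [hs, hq]
      exact_mod_cast this
    have hlim : Tendsto (fun k : ℕ => s / (s + q) * (1 - (1 - (s + q) / Fintype.card V) ^ k))
        atTop (𝓝 (s / (s + q))) := by
      have := (tendsto_pow_atTop_nhds_zero_of_lt_one (r := 1 - (s + q) / Fintype.card V)
        (by rw [sub_nonneg, div_le_one hn]; exact hle)
        (by have : 0 < (s + q) / Fintype.card V := by positivity
            linarith)).const_sub 1
      simpa using this.const_mul (s / (s + q))
    refine tendsto_of_tendsto_of_tendsto_of_le_of_le' hlim tendsto_const_nhds ?_ ?_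
    · filter_upwards [hne0] with k hk
      obtain ⟨X, hX, hc⟩ := exists_relIndep_pow G hI hne k
      exact hc.trans (card_le_indepRatio_tensorPow G hk hX)
    · filter_upwards [hne0] with k hk
      exact indepRatio_tensorPow_le G hne.card_pos (not_lt.1 hlt) hopt hk

end Capacity

/-! ### Transitive orientations of the complement and the recurrence -/

section Recurrence

open Classical

/-- `T` is a strict partial order in which two distinct vertices are comparable exactly if they
are not adjacent. -/
structure IsCoOrient {V : Type*} (G : SimpleGraph V) (T : V → V → Prop) : Prop where
  trans : ∀ {a b c}, T a b → T b c → T a c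
  asymm : ∀ {a b}, T a b → ¬T b a
  not_adj : ∀ {a b}, T a b → ¬G.Adj a b
  total : ∀ {a b}, a ≠ b → ¬G.Adj a b → T a b ∨ T b a

theorem IsCoOrient.ne {V : Type*} {G : SimpleGraph V} {T : V → V → Prop} (hT : IsCoOrient G T)
    {a b : V} (h : T a b) : a ≠ b := by
  rintro rfl
  exact hT.asymm h h

/-- `I` is an independent set with `T`-largest element `x`. -/
def IndepMax {V : Type*} (G : SimpleGraph V) (T : V → V → Prop) (x : V) (I : Finset V) : Prop :=
  RelIndep G.Adj I ∧ x ∈ I ∧ ∀ y ∈ I, y ≠ x → T y x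

variable {V : Type*} [Fintype V]

/-- The cardinality of `N(x) \ N(y)`. -/
noncomputable def diffCard (G : SimpleGraph V) (x y : V) : ℕ :=
  (relNbhd G.Adj {x} \ relNbhd G.Adj {y}).card

theorem exists_indepMax {G : SimpleGraph V} {T : V → V → Prop} (hT : IsCoOrient G T)
    {I : Finset V} (hI : RelIndep G.Adj I) (hne : I.Nonempty) : ∃ x, IndepMax G T x I := by
  have : IsTrans V fun a b => T b a := ⟨fun _ _ _ h h' => hT.trans h' h⟩
  have : Std.Irrefl fun a b : V => T b a := ⟨fun _ h => hT.asymm h h⟩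
  have hwf : WellFounded fun a b : V => T b a := Finite.wellFounded_of_trans_of_irrefl _
  obtain ⟨x, hx, hmin⟩ := hwf.has_min (I : Set V) hne
  refine ⟨x, hI, hx, fun y hy hyx => ?_⟩
  rcases hT.total hyx (hI y hy x hx) with h | h
  · exact h
  · exact absurd h (hmin y hy)

/-- Suppose `v` is adjacent to `x` and to some `z ∈ I` below `y`, but not to `y`. Then `v` is
comparable to `y`: if `y < v` then `z < v`, and if `v < y` then `v < x`, so one of the two
adjacencies fails. Hence the neighbours of `x` outside `N(y)` are all new. -/
theorem IndepMax.insert {G : SimpleGraph V} {T : V → V → Prop} (hT : IsCoOrient G T)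
    {I : Finset V} {x y : V} (hI : IndepMax G T y I) (hyx : T y x) :
    IndepMax G T x (insert x I) ∧ (insert x I).card = I.card + 1 ∧
      (relNbhd G.Adj (insert x I)).card = (relNbhd G.Adj I).card + diffCard G x y := by
  obtain ⟨hind, hy, hmax⟩ := hI
  have hlt : ∀ z ∈ I, T z x := fun z hz => by
    by_cases h : z = y
    · exact h ▸ hyx
    · exact hT.trans (hmax z hz h) hyx
  have hx : x ∉ I := fun h => hT.ne (hlt x h) rfl
  refine ⟨⟨?_, Finset.mem_insert_self _ _, fun z hz hzx => ?_⟩, Finset.card_insert_of_notMem hx,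
    ?_⟩
  · intro u hu v hv
    rcases Finset.mem_insert.1 hu with hu' | hu' <;>
      rcases Finset.mem_insert.1 hv with hv' | hv'
    · rw [hu', hv']
      exact G.loopless.irrefl _
    · rw [hu']
      exact fun h => hT.not_adj (hlt v hv') h.symm
    · rw [hv']
      exact hT.not_adj (hlt u hu')
    · exact hind u hu' v hv'
  · exact hlt z ((Finset.mem_insert.1 hz).resolve_left hzx)
  · have hd : Disjoint (relNbhd G.Adj I) (relNbhd G.Adj {x} \ relNbhd G.Adj {y}) := by
      rw [Finset.disjoint_left]
      intro v hv hv'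
      simp only [Finset.mem_sdiff, mem_relNbhd, Finset.mem_singleton, exists_eq_left] at hv hv'
      obtain ⟨z, hz, hzv⟩ := hv
      by_cases hzy : z = y
      · exact hv'.2 (hzy ▸ hzv)
      have hvy : y ≠ v := fun h => hT.not_adj hyx (h ▸ hv'.1.symm)
      rcases hT.total hvy hv'.2 with h | h
      · exact hT.not_adj (hT.trans (hmax z hz hzy) h) hzv
      · exact hT.not_adj (hT.trans h hyx) hv'.1.symm
    rw [diffCard, ← Finset.card_union_of_disjoint hd]
    congr 1
    ext v
    simp only [Finset.mem_sdiff, mem_relNbhd, Finset.mem_singleton, exists_eq_left,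
      Finset.mem_union, Finset.mem_insert, exists_eq_or_imp]
    constructor
    · rintro (h | h)
      · by_cases h' : G.Adj y v
        · exact Or.inl ⟨y, hy, h'⟩
        · exact Or.inr ⟨h, h'⟩
      · exact Or.inl h
    · rintro (h | h)
      · exact Or.inr h
      · exact Or.inl h.1

/-- The converse of `IndepMax.insert`: `y` is the largest element that remains when `x` is removed.
-/
theorem IndepMax.exists_erase {G : SimpleGraph V} {T : V → V → Prop} (hT : IsCoOrient G T)
    {I : Finset V} {x : V} (hI : IndepMax G T x I) (hcard : 2 ≤ I.card) :
    ∃ y J, T y x ∧ IndepMax G T y J ∧ J.card + 1 = I.card ∧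
      (relNbhd G.Adj I).card = (relNbhd G.Adj J).card + diffCard G x y := by
  obtain ⟨hind, hx, hmax⟩ := hI
  have hc := Finset.card_erase_add_one hx
  have hne : (I.erase x).Nonempty := by
    rw [← Finset.card_pos]; omega
  obtain ⟨y, hy⟩ := exists_indepMax hT (I := I.erase x)
    (fun u hu v hv => hind u (Finset.mem_of_mem_erase hu) v (Finset.mem_of_mem_erase hv)) hne
  have hyx : T y x := hmax y (Finset.mem_of_mem_erase hy.2.1) (Finset.ne_of_mem_erase hy.2.1)
  refine ⟨y, _, hyx, hy, hc, ?_⟩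
  have := (hy.insert hT hyx).2.2
  rwa [Finset.insert_erase hx] at this

/-- The only point with content is totality. If neither interval lies left of the other, there are
two pairs of points in opposite order, and convexity produces a common point. -/
theorem isCoOrient_liesLeft {V : Type*} {J : V → Set ℝ} (hJ : IsIntervalFamily J) :
    IsCoOrient (intersectionGraph J) (LiesLeft J) where
  trans {a b c} hab hbc x hx z hz := by
    obtain ⟨y, hy⟩ := (hJ b).1
    exact (hab x hx y hy).trans (hbc y hy z hz)
  asymm {a b} hab hba := by
    obtain ⟨x, hx⟩ := (hJ a).1
    obtain ⟨y, hy⟩ := (hJ b).1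
    exact lt_asymm (hab x hx y hy) (hba y hy x hx)
  not_adj {a b} hab h := by
    obtain ⟨x, hx, hx'⟩ := h.2
    exact lt_irrefl _ (hab x hx x hx')
  total {a b} hne hadj := by
    have hdis : ∀ x ∈ J a, x ∉ J b := fun x hx hx' => hadj ⟨hne, x, hx, hx'⟩
    by_contra hcon
    simp only [LiesLeft, not_or, not_forall, not_lt] at hcon
    obtain ⟨⟨x, hx, y, hy, hyx⟩, ⟨u, hu, v, hv, hvu⟩⟩ := hcon
    have hs : (J a).OrdConnected := (hJ a).2
    have ht : (J b).OrdConnected := (hJ b).2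
    rcases le_total x u with h | h
    · exact hdis x hx (ht.out hy hu ⟨hyx, h⟩)
    · rcases le_total v y with h' | h'
      · exact hdis y (hs.out hv hx ⟨h', hyx⟩) hy
      · rcases le_total v x with h'' | h''
        · exact hdis v hv (ht.out hy hu ⟨h', hvu⟩)
        · exact hdis x hx (ht.out hy hu ⟨hyx, h''.trans hvu⟩)

theorem coe_relNbhd (G : SimpleGraph V) (I : Finset V) :
    (relNbhd G.Adj I : Set V) = nbhd G (I : Set V) := by
  ext v
  simp [mem_relNbhd, nbhd]

theorem encard_nbhd (G : SimpleGraph V) (I : Finset V) :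
    (nbhd G (I : Set V)).encard = (relNbhd G.Adj I).card := by
  rw [← coe_relNbhd, Set.encard_coe_eq_coe_finsetCard]

theorem encard_nbhd_sdiff (G : SimpleGraph V) (x y : V) :
    (nbhd G {x} \ nbhd G {y}).encard = diffCard G x y := by
  rw [diffCard, ← Finset.coe_singleton, ← Finset.coe_singleton, ← coe_relNbhd, ← coe_relNbhd,
    ← Finset.coe_sdiff, Set.encard_coe_eq_coe_finsetCard]

theorem mem_rightmostIndep {V : Type*} {J : V → Set ℝ} {x : V} {k : ℕ} {I : Finset V} :
    I ∈ rightmostIndep J x k ↔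
      IndepMax (intersectionGraph J) (LiesLeft J) x I ∧ I.card = k := by
  simp only [rightmostIndep, Set.mem_ofPred_eq, IndepMax]
  have : (intersectionGraph J).IsIndepSet (I : Set V) ↔ RelIndep (intersectionGraph J).Adj I :=
    ⟨fun h u hu v hv huv => h hu hv huv.ne huv, fun h u hu v hv _ => h u hu v hv⟩
  rw [this]
  tauto

theorem minNbhd_one {V : Type*} (J : V → Set ℝ) (x : V) :
    minNbhd J x 1 = (nbhd (intersectionGraph J) {x}).encard := by
  have h : rightmostIndep J x 1 = {{x}} := by
    ext I
    rw [mem_rightmostIndep, Finset.card_eq_one, Set.mem_singleton_iff]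
    constructor
    · rintro ⟨⟨_, hx, _⟩, a, rfl⟩
      rw [Finset.mem_singleton.1 hx]
    · rintro rfl
      refine ⟨⟨?_, by simp, by simp⟩, x, rfl⟩
      simp [RelIndep]
  rw [minNbhd, h, iInf_singleton, Finset.coe_singleton]

theorem minNbhd_eq_iInf {J : V → Set ℝ} (hJ : IsIntervalFamily J) (x : V) {k : ℕ} (hk : 2 ≤ k) :
    minNbhd J x k = ⨅ y ∈ {y : V | LiesLeft J y x}, (minNbhd J y (k - 1) +
      (nbhd (intersectionGraph J) {x} \ nbhd (intersectionGraph J) {y}).encard) := by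
  have hT := isCoOrient_liesLeft hJ
  apply le_antisymm
  · refine le_iInf₂ fun y hy => ?_
    -- Over a nonempty family the infimum in `ℕ∞` is attained, and the minimiser extends by `x`.
    -- Over the empty family it is `⊤`.
    by_cases hne : Nonempty (rightmostIndep J y (k - 1))
    · obtain ⟨⟨I, hI⟩, hmin⟩ := ciInf_mem fun I : rightmostIndep J y (k - 1) =>
        (nbhd (intersectionGraph J) (I.1 : Set V)).encard
      have hmin' : minNbhd J y (k - 1) = (nbhd (intersectionGraph J) (I : Set V)).encard := by
        rw [minNbhd, iInf_subtype', ← hmin]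
      rw [mem_rightmostIndep] at hI
      obtain ⟨h1, h2, h3⟩ := hI.1.insert hT hy
      rw [hmin', encard_nbhd, encard_nbhd_sdiff, ← Nat.cast_add, ← h3, ← encard_nbhd]
      exact iInf₂_le (insert x I) (mem_rightmostIndep.2 ⟨h1, by omega⟩)
    · have : minNbhd J y (k - 1) = ⊤ := by
        rw [minNbhd, iInf_subtype']
        have := not_nonempty_iff.1 hne
        exact iInf_of_empty _
      rw [this, top_add]
      exact le_top
  · refine le_iInf₂ fun I hI => ?_
    rw [mem_rightmostIndep] at hI
    obtain ⟨y, I', hyx, hI', hc, hN⟩ := hI.1.exists_erase hT (by omega)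
    refine iInf₂_le_of_le y hyx ?_
    rw [encard_nbhd, encard_nbhd_sdiff, hN, Nat.cast_add, ← encard_nbhd]
    gcongr
    exact iInf₂_le I' (mem_rightmostIndep.2 ⟨hI', by omega⟩)

end Recurrence

/-! ### Computing a transitive orientation of the complement of an interval graph -/

section Orientation

open Classical

/-- Every cycle of length four has a chord. -/
def FourCycleChordal {V : Type*} (G : SimpleGraph V) : Prop :=
  ∀ a b c d, G.Adj a c → G.Adj c b → G.Adj b d → G.Adj d a → a ≠ b → c ≠ d →
    G.Adj a b ∨ G.Adj c d

/-- Closure of a relation on the nonadjacent pairs under the consequences of transitivity: if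
`a < b`, and `b < w` or `b` is adjacent to `w`, then `a < w` unless `a` is adjacent to `w`,
and dually. -/
structure CoClosed {V : Type*} (G : SimpleGraph V) (F : V → V → Prop) : Prop where
  right : ∀ {a b w}, F a b → G.Adj b w → ¬G.Adj a w → F a w
  left : ∀ {a b w}, F a b → G.Adj w a → ¬G.Adj w b → F w b
  trans : ∀ {a b w}, F a b → F b w → ¬G.Adj a w → F a w

/-- The least `CoClosed` relation containing `R`. -/
inductive CoClosure {V : Type*} (G : SimpleGraph V) (R : V → V → Prop) : V → V → Prop
  | base {a b} : R a b → CoClosure G R a b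
  | right {a b w} : CoClosure G R a b → G.Adj b w → ¬G.Adj a w → CoClosure G R a w
  | left {a b w} : CoClosure G R a b → G.Adj w a → ¬G.Adj w b → CoClosure G R w b
  | trans {a b w} : CoClosure G R a b → CoClosure G R b w → ¬G.Adj a w → CoClosure G R a w

variable {V : Type*} {G : SimpleGraph V} {F T : V → V → Prop}

theorem coClosed_coClosure (R : V → V → Prop) : CoClosed G (CoClosure G R) :=
  ⟨.right, .left, .trans⟩

theorem CoClosure.le_of_coClosed {R : V → V → Prop} (hF : CoClosed G F)
    (h : ∀ a b, R a b → F a b) {a b : V} (hab : CoClosure G R a b) : F a b := by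
  induction hab with
  | base h' => exact h _ _ h'
  | right _ h1 h2 ih => exact hF.right ih h1 h2
  | left _ h1 h2 ih => exact hF.left ih h1 h2
  | trans _ _ h2 ih1 ih2 => exact hF.trans ih1 ih2 h2

theorem CoClosed.flip (hF : CoClosed G F) : CoClosed G fun a b => F b a where
  right h h1 h2 := hF.left h h1.symm fun h' => h2 h'.symm
  left h h1 h2 := hF.right h h1.symm fun h' => h2 h'.symm
  trans h h1 h2 := hF.trans h1 h fun h' => h2 h'.symm

theorem IsCoOrient.flip (hT : IsCoOrient G T) : IsCoOrient G fun a b => T b a where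
  trans h h' := hT.trans h' h
  asymm h := hT.asymm h
  not_adj h h' := hT.not_adj h h'.symm
  total h h' := (hT.total h h').symm

/-- The opposite comparison would, by transitivity, compare two adjacent vertices. So every rule of
the closure is forced in any full orientation. -/
theorem IsCoOrient.coClosed (hT : IsCoOrient G T) : CoClosed G T where
  right {a b w} h h1 h2 := by
    have hne : a ≠ w := by
      rintro rfl
      exact hT.not_adj h h1.symm
    exact (hT.total hne h2).resolve_right fun h3 => hT.not_adj (hT.trans h3 h) h1.symm
  left {a b w} h h1 h2 := by
    have hne : w ≠ b := by
      rintro rfl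
      exact hT.not_adj h h1.symm
    exact (hT.total hne h2).resolve_right fun h3 => hT.not_adj (hT.trans h h3) h1.symm
  trans h h1 _ := hT.trans h h1

/-- The order contains no two disjoint chains without relations between them: if both conclusions
fail, all four cross pairs are incomparable, hence edges, and `a, c, b, d` is a four-cycle without
chords. -/
theorem FourCycleChordal.two_add_two (hG : FourCycleChordal G) (hT : IsCoOrient G T) {a b c d : V}
    (hab : T a b) (hcd : T c d) : T a d ∨ T c b := by
  by_contra hcon
  obtain ⟨had, hcb⟩ := not_or.1 hcon
  have key : ∀ {x y : V}, x ≠ y → ¬T x y → ¬T y x → G.Adj x y := fun hne h h' => by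
    by_contra hadj
    exact (hT.total hne hadj).elim h h'
  have h1 : G.Adj a d := key (by rintro rfl; exact hcb (hT.trans hcd hab)) had
    fun h => hcb (hT.trans (hT.trans hcd h) hab)
  have h2 : G.Adj c b := key (by rintro rfl; exact had (hT.trans hab hcd)) hcb
    fun h => had (hT.trans (hT.trans hab h) hcd)
  have h3 : G.Adj a c := key (by rintro rfl; exact had hcd) (fun h => had (hT.trans h hcd))
    fun h => hcb (hT.trans h hab)
  have h4 : G.Adj b d := key (by rintro rfl; exact had hab) (fun h => had (hT.trans hab h))
    fun h => hcb (hT.trans hcd h)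
  rcases hG a b c d h3 h2 h4 h1.symm (hT.ne hab) (hT.ne hcd) with h | h
  · exact hT.not_adj hab h
  · exact hT.not_adj hcd h

/-- Two diagonals that are not edges are two pairs of separated intervals. Of the two left
intervals, one also lies left of the other pair's right interval, which contradicts a side of the
cycle. -/
theorem fourCycleChordal_of_isIntervalGraph (hG : IsIntervalGraph G) : FourCycleChordal G := by
  obtain ⟨J, hJ, rfl⟩ := hG
  have hT := isCoOrient_liesLeft hJ
  have key : ∀ a b c d, LiesLeft J a b → LiesLeft J c d → LiesLeft J a d ∨ LiesLeft J c b := by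
    intro a b c d hab hcd
    by_contra hcon
    simp only [LiesLeft, not_or, not_forall, not_lt] at hcon
    obtain ⟨⟨x, hx, y, hy, hyx⟩, ⟨u, hu, v, hv, hvu⟩⟩ := hcon
    have := hab x hx v hv
    have := hcd u hu y hy
    linarith
  intro a b c d h1 h2 h3 h4 hab hcd
  by_contra hcon
  obtain ⟨hab', hcd'⟩ := not_or.1 hcon
  rcases hT.total hab hab' with h | h <;> rcases hT.total hcd hcd' with h' | h' <;>
    rcases key _ _ _ _ h h' with h5 | h5
  · exact hT.not_adj h5 h4.symm
  · exact hT.not_adj h5 h2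
  · exact hT.not_adj h5 h1
  · exact hT.not_adj h5 h3.symm
  · exact hT.not_adj h5 h3
  · exact hT.not_adj h5 h1.symm
  · exact hT.not_adj h5 h2.symm
  · exact hT.not_adj h5 h4

/-- The degree of a vertex. -/
noncomputable def vdeg [Fintype V] (G : SimpleGraph V) (v : V) : ℕ := (relNbhd G.Adj {v}).card

/-- Otherwise `N(y)` contains `N(z) \ {y}` together with `z` and `v`, so `y` has larger degree than
`z`. This is the only use of degrees: a neighbour of `z` that sees more than `z` on one side must
miss some neighbour of `z`. -/
theorem exists_adj_not_adj_of_vdeg_le [Fintype V] {y z v : V} (hyz : G.Adj y z) (hyv : G.Adj y v)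
    (hvz : v ≠ z) (hvz' : ¬G.Adj v z) (hdeg : vdeg G y ≤ vdeg G z) :
    ∃ u, G.Adj z u ∧ y ≠ u ∧ ¬G.Adj y u := by
  by_contra hcon
  push Not at hcon
  have hsub : insert z (insert v ((relNbhd G.Adj {z}).erase y)) ⊆ relNbhd G.Adj {y} := by
    intro u hu
    simp only [Finset.mem_insert, Finset.mem_erase, mem_relNbhd, Finset.mem_singleton,
      exists_eq_left] at hu ⊢
    rcases hu with rfl | rfl | ⟨h, h'⟩
    · exact hyz
    · exact hyv
    · exact hcon u h' h.symm
  have h1 := Finset.card_le_card hsub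
  have hy : y ∈ relNbhd G.Adj {z} := by simpa [mem_relNbhd] using hyz.symm
  rw [Finset.card_insert_of_notMem, Finset.card_insert_of_notMem] at h1
  · have := Finset.card_erase_add_one hy
    unfold vdeg at hdeg
    omega
  · simpa [mem_relNbhd] using fun _ h => hvz' h.symm
  · simp [mem_relNbhd, hvz.symm]

/-- A neighbour `y` of `z` of no larger degree cannot reach beyond `z` on both sides. Some `u` is
adjacent to `z` but not to `y`; if `y < u`, compare this chain with `z < v'`, and if `u < y`,
compare it with `v < z`. -/
theorem not_adj_of_between [Fintype V] (hG : FourCycleChordal G) (hT : IsCoOrient G T)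
    {y z v v' : V} (hyz : G.Adj y z) (hdeg : vdeg G y ≤ vdeg G z) (hvz : T v z) (hzv : T z v')
    (hyv : G.Adj y v) : ¬G.Adj y v' := by
  intro hyv'
  obtain ⟨u, hzu, hyu, hyu'⟩ :=
    exists_adj_not_adj_of_vdeg_le hyz hyv (hT.ne hvz) (hT.not_adj hvz) hdeg
  rcases hT.total hyu hyu' with h | h
  · rcases hG.two_add_two hT h hzv with h' | h'
    · exact hT.not_adj h' hyv'
    · exact hT.not_adj h' hzu
  · rcases hG.two_add_two hT h hvz with h' | h'
    · exact hT.not_adj h' hzu.symm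
    · exact hT.not_adj h' hyv.symm

/-- The forcing passes through a neighbour `u` of `z` that lies beyond `y`: from `v < z` follow `v <
u`, `y < u`, `v' < u` and `v' < z` in turn, each step replacing one end by an adjacent vertex. -/
theorem CoClosed.of_common_nbr [Fintype V] (hF : CoClosed G F) (hG : FourCycleChordal G)
    (hT : IsCoOrient G T) {y z v v' : V} (hyz : G.Adj y z) (hdeg : vdeg G y ≤ vdeg G z)
    (hvz : T v z) (hvz' : T v' z) (hyv : G.Adj y v) (hyv' : G.Adj y v') (h : F v z) : F v' z := by
  obtain ⟨u, hzu, hyu, hyu'⟩ :=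
    exists_adj_not_adj_of_vdeg_le hyz hyv (hT.ne hvz) (hT.not_adj hvz) hdeg
  have hTyu : T y u := by
    refine (hT.total hyu hyu').resolve_right fun h1 => ?_
    rcases hG.two_add_two hT h1 hvz with h' | h'
    · exact hT.not_adj h' hzu.symm
    · exact hT.not_adj h' hyv.symm
  have hlt : ∀ w, T w z → G.Adj y w → T w u := fun w hw hyw => by
    rcases hG.two_add_two hT hTyu hw with h' | h'
    · exact absurd hyz (hT.not_adj h')
    · exact h'
  have h1 : F v u := hF.right h hzu (hT.not_adj (hlt v hvz hyv))
  have h2 : F y u := hF.left h1 hyv hyu'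
  have h3 : F v' u := hF.left h2 hyv'.symm (hT.not_adj (hlt v' hvz' hyv'))
  exact hF.right h3 hzu.symm (hT.not_adj hvz')

/-- The true order `T` only serves to tell which chain of forcings exists. If `v` and `v'` lie on
the same side of `z` and are not adjacent, the connecting vertex of the farther one is also adjacent
to the nearer one, and `CoClosed.of_common_nbr` applies. On opposite sides, `v < z` forces `v < y'`,
`v < v'`, `y < v'` and `z < v'` in turn. -/
theorem CoClosed.oriented_of_lt [Fintype V] (hF : CoClosed G F) (hG : FourCycleChordal G)
    (hT : IsCoOrient G T) {y y' z v v' : V} (hyz : G.Adj y z) (hyz' : G.Adj y' z)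
    (hdeg : vdeg G y ≤ vdeg G z) (hdeg' : vdeg G y' ≤ vdeg G z) (hyv : G.Adj y v)
    (hyv' : G.Adj y' v') (hvz : T v z) (hvne' : v' ≠ z) (hvadj' : ¬G.Adj v' z) (h : F v z) :
    F z v' ∨ F v' z := by
  rcases hT.total hvne' hvadj' with hvz' | hvz'
  · right
    by_cases hvv : v = v'
    · exact hvv ▸ h
    by_cases hadj : G.Adj v v'
    · exact hF.left h hadj.symm hvadj'
    rcases hT.total hvv hadj with hlt | hlt
    · refine hF.of_common_nbr hG hT hyz hdeg hvz hvz' hyv ?_ h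
      by_contra hcon
      have hne : v' ≠ y := fun h' => hT.not_adj hlt (h' ▸ hyv.symm)
      rcases hT.total hne fun h' => hcon h'.symm with h' | h'
      · exact hT.not_adj (hT.trans hlt h') hyv.symm
      · exact hT.not_adj (hT.trans h' hvz') hyz
    · refine hF.of_common_nbr hG hT hyz' hdeg' hvz hvz' ?_ hyv' h
      by_contra hcon
      have hne : v ≠ y' := fun h' => hT.not_adj hlt (h' ▸ hyv'.symm)
      rcases hT.total hne fun h' => hcon h'.symm with h' | h'
      · exact hT.not_adj (hT.trans hlt h') hyv'.symm
      · exact hT.not_adj (hT.trans h' hvz) hyz'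
  · left
    have h1 : ¬G.Adj y v' := not_adj_of_between hG hT hyz hdeg hvz hvz' hyv
    have h2 : ¬G.Adj v y' := fun h' =>
      not_adj_of_between hG hT hyz' hdeg' hvz hvz' h'.symm hyv'
    have h3 : F v y' := hF.right h hyz'.symm h2
    have h4 : F v v' := hF.right h3 hyv' (hT.not_adj (hT.trans hvz hvz'))
    have h5 : F y v' := hF.left h4 hyv h1
    exact hF.left h5 hyz.symm (hT.not_adj hvz')

theorem CoClosed.oriented_of_adj [Fintype V] (hF : CoClosed G F) (hG : FourCycleChordal G)
    (hT : IsCoOrient G T) (hFT : ∀ a b, F a b → T a b) {y y' z v v' : V} (hyz : G.Adj y z)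
    (hyz' : G.Adj y' z) (hdeg : vdeg G y ≤ vdeg G z) (hdeg' : vdeg G y' ≤ vdeg G z)
    (hyv : G.Adj y v) (hyv' : G.Adj y' v') (hvne' : v' ≠ z) (hvadj' : ¬G.Adj v' z)
    (h : F z v ∨ F v z) : F z v' ∨ F v' z := by
  rcases h with h | h
  · exact (hF.flip.oriented_of_lt hG hT.flip hyz hyz' hdeg hdeg' hyv hyv' (hFT _ _ h) hvne' hvadj'
      h).symm
  · exact hF.oriented_of_lt hG hT hyz hyz' hdeg hdeg' hyv hyv' (hFT _ _ h) hvne' hvadj' h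

/-- Adjacency inside a set of vertices. -/
def AdjIn (G : SimpleGraph V) (C : Set V) (a b : V) : Prop :=
  G.Adj a b ∧ a ∈ C ∧ b ∈ C

/-- Follow the path from `v` until the next vertex `y` is adjacent to `z`. Consecutive vertices that
are both nonadjacent to `z` are adjacent to each other, so a comparison of one with `z` forces that
of the other. -/
theorem CoClosed.exists_nbr_of_reach (hF : CoClosed G F) {C : Set V} {z v : V}
    (hv : Relation.ReflTransGen (AdjIn G C) v z) (hne : v ≠ z) (hadj : ¬G.Adj v z) :
    ∃ w y, y ∈ C ∧ G.Adj y z ∧ G.Adj y w ∧ w ≠ z ∧ ¬G.Adj w z ∧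
      (F z w ∨ F w z ↔ F z v ∨ F v z) := by
  induction hv using Relation.ReflTransGen.head_induction_on with
  | refl => exact absurd rfl hne
  | @head a b hab hbz ih =>
    by_cases hb : b = z
    · exact absurd (hb ▸ hab.1) hadj
    by_cases hbz' : G.Adj b z
    · exact ⟨a, b, hab.2.2, hbz', hab.1.symm, hne, hadj, Iff.rfl⟩
    · obtain ⟨w, y, h1, h2, h3, h4, h5, h6⟩ := ih hb hbz'
      refine ⟨w, y, h1, h2, h3, h4, h5, h6.trans ⟨?_, ?_⟩⟩
      · rintro (h | h)
        · exact Or.inl (hF.right h hab.1.symm fun h' => hadj h'.symm)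
        · exact Or.inr (hF.left h hab.1 hadj)
      · rintro (h | h)
        · exact Or.inl (hF.right h hab.1 fun h' => hbz' h'.symm)
        · exact Or.inr (hF.left h hab.1.symm hbz')

/-- All comparisons of `z` with nonneighbours in its component of `C` stand or fall together. Both
paths are shortened to vertices at distance two from `z`. -/
theorem CoClosed.oriented_of_reach [Fintype V] (hF : CoClosed G F) (hG : FourCycleChordal G)
    (hT : IsCoOrient G T) (hFT : ∀ a b, F a b → T a b) {C : Set V} {z v v' : V}
    (hdeg : ∀ y ∈ C, vdeg G y ≤ vdeg G z) (hv : Relation.ReflTransGen (AdjIn G C) v z)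
    (hne : v ≠ z) (hadj : ¬G.Adj v z) (hv' : Relation.ReflTransGen (AdjIn G C) v' z)
    (hne' : v' ≠ z) (hadj' : ¬G.Adj v' z) (h : F z v ∨ F v z) : F z v' ∨ F v' z := by
  obtain ⟨w, y, h1, h2, h3, h4, h5, h6⟩ := hF.exists_nbr_of_reach hv hne hadj
  obtain ⟨w', y', h1', h2', h3', h4', h5', h6'⟩ := hF.exists_nbr_of_reach hv' hne' hadj'
  exact h6'.1 (hF.oriented_of_adj hG hT hFT h2 h2' (hdeg y h1) (hdeg y' h1') h3 h3' h4' h5'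
    (h6.2 h))

/-- Distinct nonadjacent vertices that `F` does not compare. -/
def Unoriented (G : SimpleGraph V) (F : V → V → Prop) (a b : V) : Prop :=
  a ≠ b ∧ ¬G.Adj a b ∧ ¬F a b ∧ ¬F b a

theorem Unoriented.symm {a b : V} (h : Unoriented G F a b) : Unoriented G F b a :=
  ⟨h.1.symm, fun h' => h.2.1 h'.symm, h.2.2.2, h.2.2.1⟩

theorem reflTransGen_symm {α : Type*} {r : α → α → Prop} (hr : ∀ a b, r a b → r b a) {a b : α}
    (h : Relation.ReflTransGen r a b) : Relation.ReflTransGen r b a := by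
  induction h with
  | refl => exact .refl
  | tail _ h ih => exact ih.head (hr _ _ h)

theorem unoriented_reach_symm {a b : V} (h : Relation.ReflTransGen (Unoriented G F) a b) :
    Relation.ReflTransGen (Unoriented G F) b a :=
  reflTransGen_symm (fun _ _ h => h.symm) h

theorem CoClosed.uniform_of_unoriented (hF : CoClosed G F) {c c' w : V}
    (hc : Unoriented G F c c') (hw : w ≠ c') (hw' : ¬Unoriented G F w c') :
    (G.Adj w c → G.Adj w c') := by
  intro h
  by_contra hcon
  have : F w c' ∨ F c' w := by
    by_contra h'
    exact hw' ⟨hw, hcon, fun h1 => h' (Or.inl h1), fun h1 => h' (Or.inr h1)⟩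
  rcases this with h1 | h1
  · exact hc.2.2.1 (hF.left h1 h.symm hc.2.1)
  · exact hc.2.2.2 (hF.right h1 h hc.symm.2.1)

/-- The components of the uncompared pairs are modules, for adjacency and for `F`. If an outside
vertex `w` distinguished the ends of an uncompared pair, then, `w` being adjacent to or compared
with each of them, a closure rule would compare the pair. -/
theorem CoClosed.uniform_of_reach (hF : CoClosed G F) (hFadj : ∀ a b, F a b → ¬G.Adj a b)
    {c c' w : V} (hc : Relation.ReflTransGen (Unoriented G F) c c')
    (hw : ¬Relation.ReflTransGen (Unoriented G F) c w) :
    (G.Adj w c ↔ G.Adj w c') ∧ (F w c → F w c') ∧ (F c w → F c' w) := by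
  induction hc with
  | refl => exact ⟨Iff.rfl, id, id⟩
  | @tail b d hcb hbd ih =>
    have hwb : w ≠ b := by rintro rfl; exact hw hcb
    have hwd : w ≠ d := by rintro rfl; exact hw (hcb.tail hbd)
    have hub : ¬Unoriented G F w b := fun h => hw (hcb.tail h.symm)
    have hud : ¬Unoriented G F w d := fun h => hw ((hcb.tail hbd).tail h.symm)
    have hadj : G.Adj w b ↔ G.Adj w d :=
      ⟨hF.uniform_of_unoriented hbd hwd hud, hF.uniform_of_unoriented hbd.symm hwb hub⟩
    have key : ¬G.Adj w b → F w d ∨ F d w := fun h => by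
      by_contra h'
      exact hud ⟨hwd, fun h1 => h (hadj.2 h1), fun h1 => h' (Or.inl h1), fun h1 => h' (Or.inr h1)⟩
    refine ⟨ih.1.trans hadj, fun h => ?_, fun h => ?_⟩
    · have h1 := ih.2.1 h
      refine (key (hFadj _ _ h1)).resolve_right fun h2 => ?_
      exact hbd.2.2.2 (hF.trans h2 h1 hbd.symm.2.1)
    · have h1 := ih.2.2 h
      refine (key fun h' => hFadj _ _ h1 h'.symm).resolve_left fun h2 => ?_
      exact hbd.2.2.1 (hF.trans h1 h2 hbd.2.1)

/-- A partial orientation that extends to a full one and compares no two vertices that are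
connected by uncompared pairs. -/
structure IsStage (G : SimpleGraph V) (F : V → V → Prop) : Prop where
  closed : CoClosed G F
  exists_le : ∃ T, IsCoOrient G T ∧ ∀ a b, F a b → T a b
  sep : ∀ a b, Relation.ReflTransGen (Unoriented G F) a b → ¬F a b

/-- The orientation `T`, changed inside `C` by moving `K` to the front, and by reversing it on `K`
if `r` holds. -/
def rearrange (T : V → V → Prop) (C K : Set V) (r : Prop) (a b : V) : Prop :=
  if a ∈ C ∧ b ∈ C then
    (a ∈ K ∧ b ∈ K ∧ (r ∧ T b a ∨ ¬r ∧ T a b)) ∨ (a ∈ K ∧ b ∉ K) ∨ (a ∉ K ∧ b ∉ K ∧ T a b)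
  else T a b

/-- The outside of `C` does not distinguish the vertices of `C`, so a chain that enters or leaves
`C` survives any change inside. Within `C` the new relation is an ordered sum of two orders, and no
edge joins the two summands. -/
theorem IsCoOrient.rearrange (hT : IsCoOrient G T) {C K : Set V} (r : Prop)
    (hCl : ∀ w, w ∉ C → ∀ c ∈ C, ∀ c' ∈ C, T w c → T w c')
    (hCr : ∀ w, w ∉ C → ∀ c ∈ C, ∀ c' ∈ C, T c w → T c' w)
    (hK : ∀ a ∈ K, ∀ b ∈ C, b ∉ K → ¬G.Adj a b) : IsCoOrient G (rearrange T C K r) where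
  trans {a b c} hab hbc := by
    have ht := @hT.trans
    have ha := @hT.asymm
    unfold _root_.rearrange at *
    by_cases h1 : a ∈ C <;> by_cases h2 : b ∈ C <;> by_cases h3 : c ∈ C <;>
      simp only [h1, h2, h3, and_self, and_true, and_false, if_true, if_false]
        at hab hbc ⊢
    · by_cases k1 : a ∈ K <;> by_cases k2 : b ∈ K <;> by_cases k3 : c ∈ K <;> by_cases hr : r <;>
        simp_all
      · exact ht hbc hab
      · exact ht hab hbc
      · exact ht hab hbc
      · exact ht hab hbc
    · exact hCr c h3 b h2 a h1 hbc
    · exact absurd (hCr b h2 a h1 c h3 hab) (ha hbc)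
    · exact ht hab hbc
    · exact hCl a h1 b h2 c h3 hab
    · exact ht hab hbc
    · exact ht hab hbc
    · exact ht hab hbc
  asymm {a b} hab hba := by
    have ha := @hT.asymm
    unfold _root_.rearrange at *
    by_cases h1 : a ∈ C <;> by_cases h2 : b ∈ C <;> by_cases k1 : a ∈ K <;> by_cases k2 : b ∈ K <;>
      by_cases hr : r <;> simp_all
  not_adj {a b} hab := by
    have hn := @hT.not_adj
    unfold _root_.rearrange at *
    split_ifs at hab with h
    · rcases hab with ⟨_, _, ⟨_, h'⟩ | ⟨_, h'⟩⟩ | ⟨h1, h2⟩ | ⟨_, _, h'⟩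
      · exact fun h1 => hn h' h1.symm
      · exact hn h'
      · exact hK a h1 b h.2 h2
      · exact hn h'
    · exact hn hab
  total {a b} hne hadj := by
    have ht := @hT.total _ _ hne hadj
    unfold _root_.rearrange at *
    by_cases h1 : a ∈ C <;> by_cases h2 : b ∈ C <;> by_cases k1 : a ∈ K <;> by_cases k2 : b ∈ K <;>
      by_cases hr : r <;> simp_all
    all_goals tauto

/-- While the vertex `z` is processed, some full orientation `T` agrees with the decision to make
`z` smaller than the next vertex. -/
theorem IsStage.exists_orient [Fintype V] [LinearOrder V] {F₀ : V → V → Prop}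
    (hF₀ : IsStage G F₀) (hG : FourCycleChordal G) {z : V}
    (hdeg : ∀ x, Relation.ReflTransGen (Unoriented G F₀) z x → vdeg G x ≤ vdeg G z) :
    ∃ T, IsCoOrient G T ∧ (∀ a b, F₀ a b → T a b) ∧
      ∀ F, CoClosed G F → (∀ a b, F₀ a b → F a b) → (∀ a b, F a b → T a b) →
        ∀ v, Unoriented G F z v → (∀ v', v < v' → ¬Unoriented G F z v') → T z v := by
  obtain ⟨T, hT, hle⟩ := hF₀.exists_le
  set C : Set V := {x | Relation.ReflTransGen (Unoriented G F₀) z x} with hC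
  set K : Set V := {x | Relation.ReflTransGen (AdjIn G C) z x} with hK
  have hzC : z ∈ C := Relation.ReflTransGen.refl
  have hzK : z ∈ K := Relation.ReflTransGen.refl
  have hconn : ∀ c ∈ C, ∀ c' ∈ C, Relation.ReflTransGen (Unoriented G F₀) c c' :=
    fun c hc c' hc' => (unoriented_reach_symm hc).trans hc'
  have hout : ∀ w, w ∉ C → ∀ c ∈ C, ¬Relation.ReflTransGen (Unoriented G F₀) c w :=
    fun w hw c hc h => hw (Relation.ReflTransGen.trans hc h)
  have hFT : ∀ w, w ∉ C → ∀ c ∈ C, (T w c → F₀ w c) ∧ (T c w → F₀ c w) := by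
    intro w hw c hc
    have hu : ¬Unoriented G F₀ w c := fun h => hout w hw c hc (.single h.symm)
    constructor <;> intro h
    · by_contra hcon
      exact hu ⟨hT.ne h, hT.not_adj h, hcon, fun h' => hT.asymm h (hle _ _ h')⟩
    · by_contra hcon
      exact hu ⟨(hT.ne h).symm, fun h' => hT.not_adj h h'.symm,
        fun h' => hT.asymm h (hle _ _ h'), hcon⟩
  have hunif := fun w hw c hc c' hc' => hF₀.closed.uniform_of_reach
    (fun a b h => hT.not_adj (hle a b h)) (hconn c hc c' hc') (hout w hw c hc)
  -- Pairs that leave the module `C` are compared by `F₀` already, and uniformly; no edge joins `K`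
  -- to the rest of `C`. Hence both orders of `K` are admissible. They extend `F₀` because `F₀`
  -- compares nothing inside `C`.
  have hTr : ∀ r, IsCoOrient G (rearrange T C K r) := fun r => hT.rearrange r
    (fun w hw c hc c' hc' h => hle _ _ ((hunif w hw c hc c' hc').2.1 ((hFT w hw c hc).1 h)))
    (fun w hw c hc c' hc' h => hle _ _ ((hunif w hw c hc c' hc').2.2 ((hFT w hw c hc).2 h)))
    (by
      intro a ha b hb hbK hab
      by_cases haC : a ∈ C
      · exact hbK (Relation.ReflTransGen.tail ha ⟨hab, haC, hb⟩)
      · rcases Relation.ReflTransGen.cases_tail ha with h | ⟨c, _, h⟩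
        · exact haC (h ▸ hzC)
        · exact haC h.2.2)
  have hler : ∀ r, ∀ a b, F₀ a b → rearrange T C K r a b := by
    intro r a b h
    unfold rearrange
    rw [if_neg]
    · exact hle _ _ h
    · exact fun h' => hF₀.sep a b (hconn a h'.1 b h'.2) h
  have hreach : ∀ v ∈ K, Relation.ReflTransGen (AdjIn G C) v z := fun v hv =>
    reflTransGen_symm (fun _ _ h => ⟨h.1.symm, h.2.2, h.2.1⟩) hv
  have hmemC : ∀ F : V → V → Prop, (∀ a b, F₀ a b → F a b) → ∀ v, Unoriented G F z v → v ∈ C :=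
    fun F hF v hv => Relation.ReflTransGen.single
      ⟨hv.1, hv.2.1, fun h => hv.2.2.1 (hF _ _ h), fun h => hv.2.2.2 (hF _ _ h)⟩
  have hnotK : ∀ r v, v ∈ C → v ∉ K → rearrange T C K r z v := fun r v hv hvK => by
    unfold rearrange
    rw [if_pos ⟨hzC, hv⟩]
    exact Or.inr (Or.inl ⟨hzK, hvK⟩)
  -- The vertices are tried by decreasing index, so the largest `v₀` in this set is the first
  -- nonneighbour of `z` in `K` to be reached. `K` is reversed exactly if `T` puts `v₀` before `z`.
  -- A smaller member of the set is never uncompared when its turn comes, since its comparison with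
  -- `z` is forced by that of `v₀`.
  by_cases hS : (Finset.univ.filter fun v => v ∈ C ∧ v ∈ K ∧ v ≠ z ∧ ¬G.Adj v z).Nonempty
  · obtain ⟨v₀, hv₀, hmax⟩ := Finset.exists_max_image _ id hS
    simp only [Finset.mem_filter, Finset.mem_univ, true_and, id] at hv₀ hmax
    obtain ⟨hv₀C, hv₀K, hv₀z, hv₀a⟩ := hv₀
    refine ⟨rearrange T C K (T v₀ z), hTr _, hler _, fun F hF hF₀F hFT' v hv hprev => ?_⟩
    have hvC := hmemC F hF₀F v hv
    by_cases hvK : v ∈ K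
    · rcases (hmax v ⟨hvC, hvK, hv.1.symm, hv.symm.2.1⟩).lt_or_eq with hlt | rfl
      · have h0 : F z v₀ ∨ F v₀ z := by
          by_contra h'
          exact hprev v₀ hlt ⟨hv₀z.symm, fun h => hv₀a h.symm, fun h => h' (Or.inl h),
            fun h => h' (Or.inr h)⟩
        rcases hF.oriented_of_reach hG (hTr _) hFT' hdeg (hreach v₀ hv₀K) hv₀z hv₀a
          (hreach v hvK) hv.1.symm hv.symm.2.1 h0 with h | h
        · exact absurd h hv.2.2.1
        · exact absurd h hv.2.2.2
      · unfold rearrange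
        rw [if_pos ⟨hzC, hvC⟩]
        refine Or.inl ⟨hzK, hvK, ?_⟩
        by_cases h : T v z
        · exact Or.inl ⟨h, h⟩
        · exact Or.inr ⟨h, (hT.total hv.1 hv.2.1).resolve_right h⟩
    · exact hnotK _ v hvC hvK
  · refine ⟨rearrange T C K False, hTr _, hler _, fun F hF hF₀F hFT' v hv hprev => ?_⟩
    have hvC := hmemC F hF₀F v hv
    refine hnotK _ v hvC fun hvK => hS ⟨v, ?_⟩
    simp only [Finset.mem_filter, Finset.mem_univ, true_and]
    exact ⟨hvC, hvK, hv.1.symm, hv.symm.2.1⟩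

/-- The relations that arise while the vertex `z` is processed, starting from `F₀`. -/
structure IsPhase (G : SimpleGraph V) (F₀ T : V → V → Prop) (z : V) (F : V → V → Prop) : Prop where
  le : ∀ a b, F₀ a b → F a b
  closed : CoClosed G F
  le_orient : ∀ a b, F a b → T a b
  sep : ∀ C : Set V, z ∉ C → (∀ w, w ∉ C → ∀ c ∈ C, ∀ c' ∈ C, G.Adj w c → G.Adj w c') →
    (∀ a ∈ C, ∀ w ∈ C, ∀ b, F a b → F b w → b ∈ C) → (∀ a ∈ C, ∀ b ∈ C, ¬F₀ a b) →
      ∀ a ∈ C, ∀ b ∈ C, ¬F a b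

theorem IsStage.isPhase {F₀ : V → V → Prop} (hF₀ : IsStage G F₀)
    (hle : ∀ a b, F₀ a b → T a b) (z : V) : IsPhase G F₀ T z F₀ :=
  ⟨fun _ _ h => h, hF₀.closed, hle, fun _ _ _ _ h => h⟩

/-- The delicate field is `sep`, by induction on the derivation. The new pair involves `z ∉ C`. If a
rule put a pair inside `C`, its middle vertex would be in `C`, where the induction hypothesis
forbids the premise, or outside, which contradicts that `C` is a module (for an edge) or convex (for
transitivity). -/
theorem IsPhase.coClosure {F₀ : V → V → Prop} {z v : V} (hF : IsPhase G F₀ T z F)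
    (hT : IsCoOrient G T) (hv : T z v) :
    IsPhase G F₀ T z (CoClosure G fun a b => F a b ∨ a = z ∧ b = v) where
  le a b h := .base (Or.inl (hF.le a b h))
  closed := coClosed_coClosure _
  le_orient a b h := h.le_of_coClosed hT.coClosed (by
    rintro a b (h | ⟨rfl, rfl⟩)
    · exact hF.le_orient a b h
    · exact hv)
  sep C hz hmod hconv h0 := by
    have hF' := hF.sep C hz hmod (fun a ha w hw b h1 h2 =>
      hconv a ha w hw b (.base (Or.inl h1)) (.base (Or.inl h2))) h0
    have hadj : ∀ a b, CoClosure G (fun a b => F a b ∨ a = z ∧ b = v) a b → ¬G.Adj a b :=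
      fun a b h => hT.not_adj (h.le_of_coClosed hT.coClosed (by
        rintro a b (h | ⟨rfl, rfl⟩)
        · exact hF.le_orient a b h
        · exact hv))
    suffices ∀ a b, CoClosure G (fun a b => F a b ∨ a = z ∧ b = v) a b → a ∈ C → b ∉ C from
      fun a ha b hb h => this a b h ha hb
    intro a b hab
    induction hab with
    | base h =>
      rcases h with h | ⟨rfl, rfl⟩
      · exact fun ha hb => hF' _ ha _ hb h
      · exact fun ha => absurd ha hz
    | @right a b w h h1 h2 ih =>
      intro ha hw
      exact hadj _ _ h (hmod b (ih ha) w hw a ha h1).symm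
    | @left a b w h h1 h2 ih =>
      intro hw hb
      exact hadj _ _ h (hmod a (fun ha => ih ha hb) w hw b hb h1.symm)
    | @trans a b w h h' h2 ih ih' =>
      intro ha hw
      exact ih ha (hconv a ha w hw b h h')

/-- A component of the new uncompared pairs is a module, is convex, and lies inside an old
component, so `sep` applies to it unless it contains `z`. Since `z` is compared with everything, its
component is a single vertex. -/
theorem IsPhase.isStage {F₀ : V → V → Prop} {z : V} (hF : IsPhase G F₀ T z F)
    (hF₀ : IsStage G F₀) (hT : IsCoOrient G T) (hz : ∀ v, ¬Unoriented G F z v) :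
    IsStage G F where
  closed := hF.closed
  exists_le := ⟨T, hT, hF.le_orient⟩
  sep a b hab h := by
    have hadj : ∀ a b, F a b → ¬G.Adj a b := fun a b h => hT.not_adj (hF.le_orient a b h)
    set C : Set V := {x | Relation.ReflTransGen (Unoriented G F) a x} with hC
    have hconn : ∀ c ∈ C, ∀ c' ∈ C, Relation.ReflTransGen (Unoriented G F) c c' :=
      fun c hc c' hc' => (unoriented_reach_symm hc).trans hc'
    have hout : ∀ w, w ∉ C → ∀ c ∈ C, ¬Relation.ReflTransGen (Unoriented G F) c w :=
      fun w hw c hc h => hw (Relation.ReflTransGen.trans hc h)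
    have hne : a ≠ b := hT.ne (hF.le_orient _ _ h)
    by_cases hzC : z ∈ C
    · have h1 : ∀ x, Relation.ReflTransGen (Unoriented G F) z x → x = z := fun x hx => by
        rcases hx.cases_head with h | ⟨c, hc, _⟩
        · exact h.symm
        · exact absurd hc (hz c)
      exact hne ((h1 a (hconn z hzC a .refl)).trans (h1 b (hconn z hzC b hab)).symm)
    · refine hF.sep C hzC ?_ ?_ ?_ a .refl b hab h
      · exact fun w hw c hc c' hc' => (hF.closed.uniform_of_reach hadj (hconn c hc c' hc')
          (hout w hw c hc)).1.1
      · intro x hx w hw y h1 h2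
        by_contra hy
        have h3 := (hF.closed.uniform_of_reach hadj (hconn w hw x hx) (hout y hy w hw)).2.1 h2
        exact hT.asymm (hF.le_orient _ _ h1) (hF.le_orient _ _ h3)
      · intro x hx y hy
        refine hF₀.sep x y (Relation.ReflTransGen.mono ?_ _ _ (hconn x hx y hy))
        exact fun u v h => ⟨h.1, h.2.1, fun h' => h.2.2.1 (hF.le _ _ h'),
          fun h' => h.2.2.2 (hF.le _ _ h')⟩

theorem isStage_empty (hG : ∃ T, IsCoOrient G T) : IsStage G fun _ _ => False where
  closed := ⟨fun h => h.elim, fun h => h.elim, fun h => h.elim⟩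
  exists_le := hG.imp fun _ hT => ⟨hT, fun _ _ h => h.elim⟩
  sep _ _ _ h := h

theorem IsStage.isCoOrient (hF : IsStage G F) (h : ∀ a b, ¬Unoriented G F a b) :
    IsCoOrient G F := by
  obtain ⟨T, hT, hle⟩ := hF.exists_le
  have : F = T := by
    funext a b
    refine propext ⟨hle a b, fun hab => ?_⟩
    by_contra hcon
    exact h a b ⟨hT.ne hab, hT.not_adj hab, hcon, fun h' => hT.asymm hab (hle _ _ h')⟩
  exact this ▸ hT

end Orientation

/-! ### A program logic for random access machines -/

section Logic

/-- Started in `s` at time `t`, the program `P` halts with words bounded by `W`, and the final time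
and configuration satisfy `Q`. -/
def wp (W : ℕ) (P : RAMProg) (Q : ℕ → RAMState → Prop) (t : ℕ) (s : RAMState) : Prop :=
  ∃ t' s', RAMExec W P s t' s' ∧ Q (t + t') s'

variable {W : ℕ} {Q : ℕ → RAMState → Prop} {t : ℕ} {s : RAMState}

theorem wp.mono {P : RAMProg} {Q' : ℕ → RAMState → Prop} (h : wp W P Q t s)
    (hQ : ∀ t' s', Q t' s' → Q' t' s') : wp W P Q' t s := by
  obtain ⟨t', s', h1, h2⟩ := h
  exact ⟨t', s', h1, hQ _ _ h2⟩

theorem wp_const {d v : ℕ} (hv : v ≤ W) (h : Q (t + 1) (s.setReg d v)) :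
    wp W (.const d v) Q t s := ⟨_, _, .const s d v hv, h⟩

theorem wp_copy {d a : ℕ} (h : Q (t + 1) (s.setReg d (s.reg a))) : wp W (.copy d a) Q t s :=
  ⟨_, _, .copy s d a, h⟩

theorem wp_add {d a b : ℕ} (hv : s.reg a + s.reg b ≤ W)
    (h : Q (t + 1) (s.setReg d (s.reg a + s.reg b))) : wp W (.add d a b) Q t s :=
  ⟨_, _, .add s d a b hv, h⟩

theorem wp_sub {d a b : ℕ} (h : Q (t + 1) (s.setReg d (s.reg a - s.reg b))) :
    wp W (.sub d a b) Q t s := ⟨_, _, .sub s d a b, h⟩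

theorem wp_mul {d a b : ℕ} (hv : s.reg a * s.reg b ≤ W)
    (h : Q (t + 1) (s.setReg d (s.reg a * s.reg b))) : wp W (.mul d a b) Q t s :=
  ⟨_, _, .mul s d a b hv, h⟩

theorem wp_load {d a : ℕ} (h : Q (t + 1) (s.setReg d (s.mem (s.reg a)))) :
    wp W (.load d a) Q t s := ⟨_, _, .load s d a, h⟩

theorem wp_store {a b : ℕ} (h : Q (t + 1) (s.setMem (s.reg a) (s.reg b))) :
    wp W (.store a b) Q t s := ⟨_, _, .store s a b, h⟩

theorem wp_seq {p q : RAMProg} (h : wp W p (wp W q Q) t s) : wp W (.seq p q) Q t s := by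
  obtain ⟨t₁, s₁, h1, t₂, s₂, h2, h3⟩ := h
  exact ⟨_, _, .seq h1 h2, by rwa [← add_assoc]⟩

theorem wp_ite {c : ℕ} {p q : RAMProg} (hp : s.reg c ≠ 0 → wp W p Q (t + 1) s)
    (hq : s.reg c = 0 → wp W q Q (t + 1) s) : wp W (.ite c p q) Q t s := by
  by_cases hc : s.reg c = 0
  · obtain ⟨t', s', h1, h2⟩ := hq hc
    exact ⟨_, _, .iteFalse p hc h1, by rwa [add_right_comm, add_assoc] at h2⟩
  · obtain ⟨t', s', h1, h2⟩ := hp hc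
    exact ⟨_, _, .iteTrue q hc h1, by rwa [add_right_comm, add_assoc] at h2⟩

theorem wp_loop {c : ℕ} {p : RAMProg} (Inv : ℕ → RAMState → Prop) (μ : RAMState → ℕ)
    (hinit : Inv t s)
    (hstep : ∀ t s, Inv t s → s.reg c ≠ 0 → wp W p (fun t' s' => Inv t' s' ∧ μ s' < μ s) (t + 1) s)
    (hexit : ∀ t s, Inv t s → s.reg c = 0 → Q (t + 1) s) : wp W (.loop c p) Q t s := by
  induction hμ : μ s using Nat.strong_induction_on generalizing t s with
  | _ m ih =>
    by_cases hc : s.reg c = 0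
    · exact ⟨_, _, .loopDone p hc, hexit t s hinit hc⟩
    · obtain ⟨t₁, s₁, h1, h2, h3⟩ := hstep t s hinit hc
      obtain ⟨t₂, s₂, h4, h5⟩ := ih (μ s₁) (hμ ▸ h3) h2 rfl
      refine ⟨_, _, .loopStep hc h1 h4, ?_⟩
      have : t + (t₁ + t₂ + 1) = t + 1 + t₁ + t₂ := by ring
      rwa [this]

/-- Run `p` with the values `m - 1, …, 0` in register `c`, which initially holds `m`; register `1`
holds the constant `1`. -/
def forDown (c : ℕ) (p : RAMProg) : RAMProg := .loop c (.seq (.sub c c 1) p)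

/-- The first argument of `Inv` counts the iterations still to come. The two steps charged before
the body are the loop test and the decrement. -/
theorem wp_forDown {c m : ℕ} {p : RAMProg} (Inv : ℕ → ℕ → RAMState → Prop) (hc : s.reg c = m)
    (hinit : Inv m t s)
    (hone : ∀ i t s, Inv i t s → s.reg 1 = 1)
    (hstep : ∀ i < m, ∀ t s, Inv (i + 1) t s → s.reg c = i + 1 →
      wp W p (fun t' s' => Inv i t' s' ∧ s'.reg c = i) (t + 2) (s.setReg c i))
    (hexit : ∀ t s, Inv 0 t s → Q (t + 1) s) : wp W (forDown c p) Q t s := by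
  refine wp_loop (fun t s => s.reg c ≤ m ∧ Inv (s.reg c) t s) (fun s => s.reg c)
    ⟨hc.le, hc ▸ hinit⟩ ?_ ?_
  · rintro t s ⟨hle, hinv⟩ hne
    obtain ⟨i, hi⟩ := Nat.exists_eq_succ_of_ne_zero hne
    rw [hi] at hinv hle
    refine wp_seq (wp_sub ?_)
    have : s.reg c - s.reg 1 = i := by
      rw [hone _ _ _ hinv, hi]
      rfl
    rw [this]
    refine (hstep i (by omega) t s hinv hi).mono fun t' s' h => ?_
    rw [h.2, hi]
    exact ⟨⟨by omega, h.1⟩, by omega⟩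
  · rintro t s ⟨_, hinv⟩ h0
    exact hexit t s (h0 ▸ hinv)

end Logic

/-! ### Arrays in memory

The memory is divided into regions of `n ^ 2` cells, each holding an `n × n` matrix or a list. -/

section Arrays

/-- Cell number `h` of region `b`. -/
def RAMState.cell (s : RAMState) (n b h : ℕ) : ℕ := s.mem (b * (n * n) + h)

/-- The `(i, j)` entry of the matrix in region `b`. -/
def RAMState.mat (s : RAMState) (n b i j : ℕ) : ℕ := s.cell n b (i * n + j)

@[simp] theorem RAMState.reg_setReg (s : RAMState) (d v r : ℕ) :
    (s.setReg d v).reg r = if r = d then v else s.reg r := by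
  simp [setReg, Function.update_apply]

@[simp] theorem RAMState.reg_setMem (s : RAMState) (a v : ℕ) : (s.setMem a v).reg = s.reg := rfl

@[simp] theorem RAMState.mem_setReg (s : RAMState) (d v : ℕ) : (s.setReg d v).mem = s.mem := rfl

@[simp] theorem RAMState.cell_setReg (s : RAMState) (d v n b h : ℕ) :
    (s.setReg d v).cell n b h = s.cell n b h := rfl

@[simp] theorem RAMState.mat_setReg (s : RAMState) (d v n b i j : ℕ) :
    (s.setReg d v).mat n b i j = s.mat n b i j := rfl

theorem mul_add_inj {N b h b' h' : ℕ} (hh : h < N) (hh' : h' < N) :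
    b * N + h = b' * N + h' ↔ b = b' ∧ h = h' := by
  refine ⟨fun e => ?_, fun ⟨h1, h2⟩ => by rw [h1, h2]⟩
  have hN : 0 < N := by omega
  have h1 : (b * N + h) / N = b := by
    rw [mul_comm, Nat.mul_add_div hN, Nat.div_eq_of_lt hh, add_zero]
  have h2 : (b' * N + h') / N = b' := by
    rw [mul_comm, Nat.mul_add_div hN, Nat.div_eq_of_lt hh', add_zero]
  have h3 : b = b' := by rw [← h1, ← h2, e]
  subst h3
  exact ⟨rfl, by omega⟩

theorem index_lt {n i j : ℕ} (hi : i < n) (hj : j < n) : i * n + j < n * n := by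
  have : (i + 1) * n ≤ n * n := Nat.mul_le_mul_right n hi
  rw [add_mul] at this
  omega

theorem RAMState.cell_setMem (s : RAMState) {n b h b' h' : ℕ} (v : ℕ) (hh : h < n * n)
    (hh' : h' < n * n) : (s.setMem (b * (n * n) + h) v).cell n b' h' =
      if b' = b ∧ h' = h then v else s.cell n b' h' := by
  simp only [cell, setMem, Function.update_apply, mul_add_inj hh' hh]

theorem RAMState.mat_setMem (s : RAMState) {n b i j b' i' j' : ℕ} (v : ℕ) (hi : i < n)
    (hj : j < n) (hi' : i' < n) (hj' : j' < n) :
    (s.setMem (b * (n * n) + (i * n + j)) v).mat n b' i' j' =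
      if b' = b ∧ i' = i ∧ j' = j then v else s.mat n b' i' j' := by
  simp only [mat, s.cell_setMem v (index_lt hi hj) (index_lt hi' hj'), mul_add_inj hj' hj]

/-- The register holding the address of region `b`. -/
def regionReg (b : ℕ) : ℕ := if b = 0 then 7 else b + 1

/-- The constants that the program keeps in its first registers. -/
structure Consts (n : ℕ) (s : RAMState) : Prop where
  size : s.reg 0 = n
  one : s.reg 1 = 1
  region : ∀ b < 6, s.reg (regionReg b) = b * (n * n)

theorem regionReg_lt {b : ℕ} (hb : b < 6) : regionReg b < 8 := by
  unfold regionReg; split_ifs <;> omega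

theorem Consts.of_eq {n : ℕ} {s s' : RAMState} (hs : Consts n s)
    (h : ∀ r < 8, s'.reg r = s.reg r) : Consts n s' where
  size := (h 0 (by norm_num)).trans hs.size
  one := (h 1 (by norm_num)).trans hs.one
  region b hb := (h _ (regionReg_lt hb)).trans (hs.region b hb)

theorem Consts.setReg {n d v : ℕ} {s : RAMState} (hs : Consts n s) (hd : 8 ≤ d) :
    Consts n (s.setReg d v) :=
  hs.of_eq fun r hr => by simp [show r ≠ d by omega]

/-- The word bound leaves room for the numbers that occur. -/
structure Roomy (n W : ℕ) : Prop where
  pos : 1 ≤ n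
  bound : 8 * (n * n * n) ≤ W

theorem Roomy.sq_le {n W : ℕ} (h : Roomy n W) : 8 * (n * n) ≤ W :=
  (Nat.mul_le_mul_left 8 (Nat.le_mul_of_pos_right _ h.pos)).trans h.bound

theorem Roomy.le {n W : ℕ} (h : Roomy n W) : 8 * n ≤ W :=
  (Nat.mul_le_mul_left 8 (Nat.le_mul_of_pos_right _ h.pos)).trans h.sq_le

/-- Put the address of the `(i, j)` entry of region `b` into register `20`. -/
def addrMat (b i j : ℕ) : RAMProg :=
  .seq (.mul 20 i 0) (.seq (.add 20 20 j) (.add 20 20 (regionReg b)))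

def loadMat (b d i j : ℕ) : RAMProg := .seq (addrMat b i j) (.load d 20)

def storeMat (b i j a : ℕ) : RAMProg := .seq (addrMat b i j) (.store 20 a)

def loadCell (b d h : ℕ) : RAMProg := .seq (.add 20 h (regionReg b)) (.load d 20)

def storeCell (b h a : ℕ) : RAMProg := .seq (.add 20 h (regionReg b)) (.store 20 a)

variable {W n : ℕ} {Q : ℕ → RAMState → Prop} {t : ℕ} {s : RAMState}

theorem region_add_le {b h : ℕ} (hW : Roomy n W) (hb : b < 6) (hh : h < n * n) :
    h + b * (n * n) ≤ W := by
  have h1 : b * (n * n) ≤ 5 * (n * n) := Nat.mul_le_mul_right _ (by omega)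
  have := hW.sq_le
  omega

theorem wp_addrMat {b i j : ℕ} (hW : Roomy n W) (hs : Consts n s) (hb : b < 6)
    (hi : s.reg i < n) (hj : s.reg j < n) (hj' : j ≠ 20)
    (h : Q (t + 3) (s.setReg 20 (b * (n * n) + (s.reg i * n + s.reg j)))) :
    wp W (addrMat b i j) Q t s := by
  have h1 := index_lt hi hj
  have h2 := region_add_le hW hb h1
  have h3 := regionReg_lt hb
  have h4 := hs.region b hb
  refine wp_seq (wp_mul ?_ (wp_seq (wp_add ?_ (wp_add ?_ ?_))))
  · rw [hs.size]; omega
  · simp only [RAMState.reg_setReg, hj', hs.size, if_true, if_false]; omega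
  · simp only [RAMState.reg_setReg, hj', hs.size, if_true, if_false,
      show regionReg b ≠ 20 by omega, h4]
    omega
  · convert h using 1
    simp only [RAMState.reg_setReg, hj', hs.size, if_true, if_false,
      show regionReg b ≠ 20 by omega, h4]
    simp [RAMState.setReg, add_comm]

theorem wp_loadMat {b d i j : ℕ} (hW : Roomy n W) (hs : Consts n s) (hb : b < 6)
    (hi : s.reg i < n) (hj : s.reg j < n) (hj' : j ≠ 20)
    (h : Q (t + 4) ((s.setReg 20 (b * (n * n) + (s.reg i * n + s.reg j))).setReg d
      (s.mat n b (s.reg i) (s.reg j)))) :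
    wp W (loadMat b d i j) Q t s := by
  refine wp_seq (wp_addrMat hW hs hb hi hj hj' (wp_load ?_))
  simpa [RAMState.mat, RAMState.cell] using h

theorem wp_storeMat {b i j a : ℕ} (hW : Roomy n W) (hs : Consts n s) (hb : b < 6)
    (hi : s.reg i < n) (hj : s.reg j < n) (hj' : j ≠ 20) (ha : a ≠ 20)
    (h : Q (t + 4) ((s.setReg 20 (b * (n * n) + (s.reg i * n + s.reg j))).setMem
      (b * (n * n) + (s.reg i * n + s.reg j)) (s.reg a))) :
    wp W (storeMat b i j a) Q t s := by
  refine wp_seq (wp_addrMat hW hs hb hi hj hj' (wp_store ?_))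
  simpa [ha] using h

theorem wp_loadCell {b d i : ℕ} (hW : Roomy n W) (hs : Consts n s) (hb : b < 6)
    (hi : s.reg i < n * n)
    (h : Q (t + 2) ((s.setReg 20 (b * (n * n) + s.reg i)).setReg d (s.cell n b (s.reg i)))) :
    wp W (loadCell b d i) Q t s := by
  have h4 := hs.region b hb
  refine wp_seq (wp_add ?_ (wp_load ?_))
  · rw [h4]; exact region_add_le hW hb hi
  · simpa [RAMState.cell, h4, add_comm (s.reg i)] using h

theorem wp_storeCell {b i a : ℕ} (hW : Roomy n W) (hs : Consts n s) (hb : b < 6)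
    (hi : s.reg i < n * n) (ha : a ≠ 20)
    (h : Q (t + 2) ((s.setReg 20 (b * (n * n) + s.reg i)).setMem (b * (n * n) + s.reg i)
      (s.reg a))) :
    wp W (storeCell b i a) Q t s := by
  have h4 := hs.region b hb
  refine wp_seq (wp_add ?_ (wp_store ?_))
  · rw [h4]; exact region_add_le hW hb hi
  · simpa [h4, ha, add_comm (s.reg i)] using h

/-- The configurations agree except for the registers from `20` on. -/
structure Same (s s' : RAMState) : Prop where
  mem : s'.mem = s.mem
  reg : ∀ r < 20, s'.reg r = s.reg r

theorem Same.refl (s : RAMState) : Same s s := ⟨rfl, fun _ _ => rfl⟩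

theorem Same.setReg {s s₀ : RAMState} {d v : ℕ} (h : Same s₀ s) (hd : 20 ≤ d) :
    Same s₀ (s.setReg d v) :=
  ⟨h.mem, fun r hr => by rw [RAMState.reg_setReg, if_neg (by omega), h.reg r hr]⟩

theorem Same.cell {s s' : RAMState} (h : Same s s') (n b k : ℕ) :
    s'.cell n b k = s.cell n b k := by
  rw [RAMState.cell, RAMState.cell, h.mem]

theorem Same.mat {s s' : RAMState} (h : Same s s') (n b i j : ℕ) :
    s'.mat n b i j = s.mat n b i j := h.cell n b _

theorem Same.consts {s s' : RAMState} (h : Same s s') {n : ℕ} (hs : Consts n s) : Consts n s' :=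
  hs.of_eq fun r hr => h.reg r (by omega)

theorem Same.wp_loadMat {s₀ : RAMState} {b d i j x y : ℕ} (hS : Same s₀ s) (hW : Roomy n W)
    (hs : Consts n s₀) (hb : b < 6) (hi : i < 20) (hj : j < 20) (hx : s₀.reg i = x)
    (hy : s₀.reg j = y) (hxn : x < n) (hyn : y < n) (hd : 20 ≤ d)
    (h : ∀ s', Same s₀ s' → s'.reg d = s₀.mat n b x y →
      (∀ r, r ≠ 20 → r ≠ d → s'.reg r = s.reg r) → Q (t + 4) s') :
    wp W (loadMat b d i j) Q t s := by
  have hi' : s.reg i = x := (hS.reg i hi).trans hx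
  have hj' : s.reg j = y := (hS.reg j hj).trans hy
  refine _root_.wp_loadMat hW (hS.consts hs) hb (hi' ▸ hxn) (hj' ▸ hyn) hj.ne
    (h _ ((hS.setReg le_rfl).setReg hd) ?_ fun r h1 h2 => ?_)
  · simp [hi', hj', hS.mat]
  · simp [h1, h2]

theorem Same.wp_loadCell {s₀ : RAMState} {b d i x : ℕ} (hS : Same s₀ s) (hW : Roomy n W)
    (hs : Consts n s₀) (hb : b < 6) (hi : i < 20) (hx : s₀.reg i = x) (hxn : x < n * n)
    (hd : 20 ≤ d)
    (h : ∀ s', Same s₀ s' → s'.reg d = s₀.cell n b x →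
      (∀ r, r ≠ 20 → r ≠ d → s'.reg r = s.reg r) → Q (t + 2) s') :
    wp W (loadCell b d i) Q t s := by
  have hi' : s.reg i = x := (hS.reg i hi).trans hx
  refine _root_.wp_loadCell hW (hS.consts hs) hb (hi' ▸ hxn)
    (h _ ((hS.setReg le_rfl).setReg hd) ?_ fun r h1 h2 => ?_)
  · simp [hi', hS.cell]
  · simp [h1, h2]

theorem Same.wp_add {s₀ : RAMState} {d a b x y : ℕ} (hS : Same s₀ s) (ha : s.reg a = x)
    (hb : s.reg b = y) (hd : 20 ≤ d) (hv : x + y ≤ W)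
    (h : ∀ s', Same s₀ s' → s'.reg d = x + y → (∀ r, r ≠ d → s'.reg r = s.reg r) →
      Q (t + 1) s') : wp W (.add d a b) Q t s := by
  subst ha hb
  exact _root_.wp_add hv (h _ (hS.setReg hd) (by simp) fun r hr => by simp [hr])

theorem Same.wp_mul {s₀ : RAMState} {d a b x y : ℕ} (hS : Same s₀ s) (ha : s.reg a = x)
    (hb : s.reg b = y) (hd : 20 ≤ d) (hv : x * y ≤ W)
    (h : ∀ s', Same s₀ s' → s'.reg d = x * y → (∀ r, r ≠ d → s'.reg r = s.reg r) →
      Q (t + 1) s') : wp W (.mul d a b) Q t s := by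
  subst ha hb
  exact _root_.wp_mul hv (h _ (hS.setReg hd) (by simp) fun r hr => by simp [hr])

theorem Same.wp_sub {s₀ : RAMState} {d a b x y : ℕ} (hS : Same s₀ s) (ha : s.reg a = x)
    (hb : s.reg b = y) (hd : 20 ≤ d)
    (h : ∀ s', Same s₀ s' → s'.reg d = x - y → (∀ r, r ≠ d → s'.reg r = s.reg r) →
      Q (t + 1) s') : wp W (.sub d a b) Q t s := by
  subst ha hb
  exact _root_.wp_sub (h _ (hS.setReg hd) (by simp) fun r hr => by simp [hr])

/-- Do nothing. -/
def skipProg : RAMProg := .const 20 0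

theorem wp_skip (h : Q (t + 1) (s.setReg 20 0)) : wp W skipProg Q t s := wp_const (Nat.zero_le _) h

end Arrays

/-! ### Orienting the complement on a random access machine -/

section OrientProgram

open Classical

/-- The memory holds the adjacency matrix, the degrees, and the list `L` of oriented pairs together
with its characteristic matrix. -/
structure OrientEnv {n : ℕ} (G : SimpleGraph (Fin n)) (L : List (Fin n × Fin n))
    (s : RAMState) : Prop where
  consts : Consts n s
  adj : ∀ i j : Fin n, s.mat n 0 i j = if G.Adj i j then 1 else 0
  deg : ∀ i : Fin n, s.cell n 5 i = vdeg G i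
  mem : ∀ i j : Fin n, s.mat n 1 i j = if (i, j) ∈ L then 1 else 0
  nodup : L.Nodup
  len : s.reg 9 = L.length
  fst : ∀ k (hk : k < L.length), s.cell n 2 k = (L[k].1 : ℕ)
  snd : ∀ k (hk : k < L.length), s.cell n 3 k = (L[k].2 : ℕ)

variable {W n : ℕ} {Q : ℕ → RAMState → Prop} {t : ℕ} {s : RAMState} {G : SimpleGraph (Fin n)}
  {L : List (Fin n × Fin n)}

theorem OrientEnv.setReg {d v : ℕ} (h : OrientEnv G L s) (hd : 10 ≤ d) :
    OrientEnv G L (s.setReg d v) where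
  consts := h.consts.setReg (by omega)
  adj := h.adj
  deg := h.deg
  mem := h.mem
  nodup := h.nodup
  len := by rw [RAMState.reg_setReg, if_neg (by omega), h.len]
  fst := h.fst
  snd := h.snd

theorem OrientEnv.same {s' : RAMState} (h : OrientEnv G L s) (hS : Same s s') :
    OrientEnv G L s' where
  consts := hS.consts h.consts
  adj i j := (hS.mat _ _ _ _).trans (h.adj i j)
  deg i := (hS.cell _ _ _).trans (h.deg i)
  mem i j := (hS.mat _ _ _ _).trans (h.mem i j)
  nodup := h.nodup
  len := (hS.reg _ (by norm_num)).trans h.len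
  fst k hk := (hS.cell _ _ _).trans (h.fst k hk)
  snd k hk := (hS.cell _ _ _).trans (h.snd k hk)

theorem OrientEnv.setReg_eight {v : ℕ} (h : OrientEnv G L s) : OrientEnv G L (s.setReg 8 v) where
  consts := h.consts.setReg le_rfl
  adj := h.adj
  deg := h.deg
  mem := h.mem
  nodup := h.nodup
  len := by rw [RAMState.reg_setReg, if_neg (by omega), h.len]
  fst := h.fst
  snd := h.snd

theorem length_le_of_nodup (h : L.Nodup) : L.length ≤ n * n := by
  simpa using h.length_le_card

/-- Append the pair in the registers `a` and `b` to the list of oriented pairs. -/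
def pushPair (a b : ℕ) : RAMProg :=
  .seq (storeMat 1 a b 1) (.seq (storeCell 2 9 a) (.seq (storeCell 3 9 b) (.add 9 9 1)))

theorem wp_pushPair {a b : ℕ} {x y : Fin n} (hW : Roomy n W) (hs : OrientEnv G L s) (ha : a < 20)
    (hb : b < 20) (hx : s.reg a = x) (hy : s.reg b = y) (hxy : (x, y) ∉ L)
    (h : ∀ s', OrientEnv G (L ++ [(x, y)]) s' → (∀ r < 20, r ≠ 9 → s'.reg r = s.reg r) →
      Q (t + 9) s') :
    wp W (pushPair a b) Q t s := by
  have hnd : (L ++ [(x, y)]).Nodup := by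
    rw [List.nodup_append]
    refine ⟨hs.nodup, by simp, ?_⟩
    intro p hp q hq
    rw [List.mem_singleton.1 hq]
    rintro rfl
    exact hxy hp
  -- The extended list still has no repetition, hence at most `n ^ 2` entries, so the new position
  -- is a cell of the regions that hold the list.
  have hlen : L.length < n * n := by
    have := length_le_of_nodup hnd
    rw [List.length_append, List.length_singleton] at this
    omega
  have hsq := hW.sq_le
  have hidx := index_lt x.2 y.2
  refine wp_seq (wp_storeMat hW hs.consts (by norm_num) (by rw [hx]; exact x.2)
    (by rw [hy]; exact y.2) hb.ne (by norm_num) ?_)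
  rw [hx, hy, hs.consts.one]
  refine wp_seq (wp_storeCell hW (hs.consts.of_eq fun r hr => ?_) (by norm_num) ?_ ha.ne ?_)
  · simp [show r ≠ 20 by omega]
  · simp [hs.len, hlen]
  refine wp_seq (wp_storeCell hW (hs.consts.of_eq fun r hr => ?_) (by norm_num) ?_ hb.ne ?_)
  · simp [show r ≠ 20 by omega]
  · simp [hs.len, hlen]
  refine wp_add ?_ (h _ ?_ ?_)
  · simp [hs.len, hs.consts.one]; omega
  · simp only [RAMState.reg_setReg, RAMState.reg_setMem, ha.ne, hb.ne, hx, hy, hs.len,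
      hs.consts.one, if_false, show (9 : ℕ) ≠ 20 by norm_num,
      show (1 : ℕ) ≠ 20 by norm_num]
    refine ⟨hs.consts.of_eq fun r hr => ?_, fun i j => ?_, fun i => ?_, fun i j => ?_, hnd, ?_,
      fun k hk => ?_, fun k hk => ?_⟩
    · simp [show r ≠ 20 by omega, show r ≠ 9 by omega]
    · have h2 := index_lt i.2 j.2
      have h3 := hs.adj i j
      simp only [RAMState.mat] at h3
      simp only [RAMState.mat, RAMState.cell_setReg, RAMState.cell_setMem, h2, hidx, hlen, h3]
      simp
    · have h2 : (i : ℕ) < n * n := i.2.trans_le (Nat.le_mul_self n)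
      simp only [RAMState.cell_setReg, RAMState.cell_setMem, h2, hidx, hlen, hs.deg]
      simp
    · have h2 := index_lt i.2 j.2
      have h3 := hs.mem i j
      simp only [RAMState.mat] at h3
      simp only [RAMState.mat, RAMState.cell_setReg, RAMState.cell_setMem, h2, hidx, hlen, h3]
      simp only [mul_add_inj j.2 y.2, List.mem_append, List.mem_singleton, Prod.mk.injEq,
        Fin.ext_iff]
      by_cases h4 : (i : ℕ) = x ∧ (j : ℕ) = y <;> simp [h4]
    · simp
    · have hk' : k < n * n := hk.trans_le (length_le_of_nodup hnd)
      simp only [RAMState.cell_setReg, RAMState.cell_setMem, hk', hidx, hlen]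
      rw [List.length_append, List.length_singleton] at hk
      by_cases hkl : k = L.length
      · simp [hkl]
      · have := hs.fst k (by omega)
        rw [List.getElem_append_left (by omega)]
        simp [hkl, this]
    · have hk' : k < n * n := hk.trans_le (length_le_of_nodup hnd)
      simp only [RAMState.cell_setReg, RAMState.cell_setMem, hk', hidx, hlen]
      rw [List.length_append, List.length_singleton] at hk
      by_cases hkl : k = L.length
      · simp [hkl]
      · have := hs.snd k (by omega)
        rw [List.getElem_append_left (by omega)]
        simp [hkl, this]
  · intro r hr hr'
    simp [hr.ne, hr']

/-- If the pair in the registers `p` is adjacent or oriented, and the pair in the registers `q` is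
neither, orient the latter. -/
def derivePair (p₁ p₂ q₁ q₂ : ℕ) : RAMProg :=
  .seq (loadMat 0 21 p₁ p₂) <| .seq (loadMat 1 22 p₁ p₂) <| .seq (.add 21 21 22) <|
  .seq (loadMat 0 22 q₁ q₂) <| .seq (loadMat 1 23 q₁ q₂) <| .seq (.add 22 22 23) <|
  .seq (.sub 22 1 22) <| .seq (.mul 21 21 22) <| .ite 21 (pushPair q₁ q₂) skipProg

theorem wp_derivePair {p₁ p₂ q₁ q₂ : ℕ} {a b c d : Fin n} (hW : Roomy n W)
    (hs : OrientEnv G L s) (h₁ : p₁ < 20) (h₂ : p₂ < 20) (h₃ : q₁ < 20) (h₄ : q₂ < 20)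
    (ha : s.reg p₁ = a) (hb : s.reg p₂ = b) (hc : s.reg q₁ = c) (hd : s.reg q₂ = d)
    (h : ∀ t' s' L', t' ≤ t + 30 → OrientEnv G L' s' →
      L' = (if (G.Adj a b ∨ (a, b) ∈ L) ∧ ¬G.Adj c d ∧ (c, d) ∉ L then L ++ [(c, d)] else L) →
      (∀ r < 20, r ≠ 9 → s'.reg r = s.reg r) → Q t' s') :
    wp W (derivePair p₁ p₂ q₁ q₂) Q t s := by
  have hle := hW.le
  have hpos := hW.pos
  have hA : ∀ i j : Fin n, s.mat n 0 i j ≤ 1 := fun i j => by rw [hs.adj]; split_ifs <;> omega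
  have hM : ∀ i j : Fin n, s.mat n 1 i j ≤ 1 := fun i j => by rw [hs.mem]; split_ifs <;> omega
  have := hA a b
  have := hA c d
  have := hM a b
  have := hM c d
  refine wp_seq ((Same.refl s).wp_loadMat hW hs.consts (by norm_num) h₁ h₂ ha hb a.2 b.2
    (by norm_num) fun s1 S1 v1 k1 => ?_)
  refine wp_seq (S1.wp_loadMat hW hs.consts (by norm_num) h₁ h₂ ha hb a.2 b.2
    (by norm_num) fun s2 S2 v2 k2 => ?_)
  refine wp_seq (S2.wp_add ((k2 21 (by norm_num) (by norm_num)).trans v1) v2 (by norm_num)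
    (by omega) fun s3 S3 v3 k3 => ?_)
  refine wp_seq (S3.wp_loadMat hW hs.consts (by norm_num) h₃ h₄ hc hd c.2 d.2
    (by norm_num) fun s4 S4 v4 k4 => ?_)
  refine wp_seq (S4.wp_loadMat hW hs.consts (by norm_num) h₃ h₄ hc hd c.2 d.2
    (by norm_num) fun s5 S5 v5 k5 => ?_)
  refine wp_seq (S5.wp_add ((k5 22 (by norm_num) (by norm_num)).trans v4) v5 (by norm_num)
    (by omega) fun s6 S6 v6 k6 => ?_)
  refine wp_seq (S6.wp_sub ((S6.reg 1 (by norm_num)).trans hs.consts.one) v6 (by norm_num)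
    fun s7 S7 v7 k7 => ?_)
  have v21 : s7.reg 21 = s.mat n 0 a b + s.mat n 1 a b := by
    rw [k7 21 (by norm_num), k6 21 (by norm_num), k5 21 (by norm_num) (by norm_num),
      k4 21 (by norm_num) (by norm_num), v3]
  refine wp_seq (S7.wp_mul v21 v7 (by norm_num) ((show _ ≤ 2 * 1 from Nat.mul_le_mul
    (by omega) (by omega)).trans (by omega))
    fun s8 S8 v8 k8 => wp_ite (fun hcond => ?_) fun hcond => ?_)
  · rw [v8, mul_ne_zero_iff, hs.adj, hs.adj, hs.mem, hs.mem] at hcond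
    have hif : (G.Adj a b ∨ (a, b) ∈ L) ∧ ¬G.Adj c d ∧ (c, d) ∉ L := by
      by_cases g1 : G.Adj a b <;> by_cases g2 : (a, b) ∈ L <;> by_cases g3 : G.Adj c d <;>
        by_cases g4 : (c, d) ∈ L <;> simp [g1, g2, g3, g4] at hcond ⊢
    refine wp_pushPair hW (hs.same S8) h₃ h₄ ((S8.reg _ h₃).trans hc) ((S8.reg _ h₄).trans hd)
      hif.2.2 fun s' hs' hreg => h _ _ _ (by omega) hs' (by rw [if_pos hif]) fun r hr hr' => ?_
    rw [hreg r hr hr', S8.reg r hr]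
  · rw [v8, mul_eq_zero, hs.adj, hs.adj, hs.mem, hs.mem] at hcond
    have hif : ¬((G.Adj a b ∨ (a, b) ∈ L) ∧ ¬G.Adj c d ∧ (c, d) ∉ L) := by
      by_cases g1 : G.Adj a b <;> by_cases g2 : (a, b) ∈ L <;> by_cases g3 : G.Adj c d <;>
        by_cases g4 : (c, d) ∈ L <;> simp [g1, g2, g3, g4] at hcond ⊢
    have S9 := S8.setReg (d := 20) (v := 0) le_rfl
    exact wp_skip (h _ _ L (by omega) (hs.same S9) (by rw [if_neg hif]) fun r hr _ => S9.reg r hr)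

end OrientProgram

/-! ### Closing the list of oriented pairs under forcing, with the list as a queue -/

section CloseProgram

open Classical

variable {W n : ℕ} {Q : ℕ → RAMState → Prop} {t : ℕ} {s : RAMState} {G : SimpleGraph (Fin n)}
  {L : List (Fin n × Fin n)}

/-- `L'` extends `L` by consequences of the pair `(a, b)`, and contains all those that involve a
vertex `w ≥ i`. -/
structure Consequences (G : SimpleGraph (Fin n)) (a b : Fin n) (L L' : List (Fin n × Fin n))
    (i : ℕ) : Prop where
  subset : L <+: L'
  sound : ∀ R : Fin n → Fin n → Prop, (∀ p ∈ L, CoClosure G R p.1 p.2) →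
    ∀ p ∈ L', CoClosure G R p.1 p.2
  right : ∀ w : Fin n, i ≤ w → (G.Adj b w ∨ (b, w) ∈ L) → ¬G.Adj a w → (a, w) ∈ L'
  left : ∀ w : Fin n, i ≤ w → (G.Adj w a ∨ (w, a) ∈ L) → ¬G.Adj w b → (w, b) ∈ L'

/-- Each addition is an instance of one closure rule: an edge gives `right` or `left`, an oriented
pair gives `trans`. Completeness refers only to pairs already in `L`; pairs appended during the scan
are matched with `(a, b)` when their own turn comes. -/
theorem Consequences.step {a b : Fin n} {L L' L₁ L₂ : List (Fin n × Fin n)} (hab : (a, b) ∈ L)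
    (w : Fin n) (h : Consequences G a b L L' (w + 1))
    (h₁ : L₁ = if (G.Adj b w ∨ (b, w) ∈ L') ∧ ¬G.Adj a w ∧ (a, w) ∉ L' then L' ++ [(a, w)]
      else L')
    (h₂ : L₂ = if (G.Adj w a ∨ (w, a) ∈ L₁) ∧ ¬G.Adj w b ∧ (w, b) ∉ L₁ then L₁ ++ [(w, b)]
      else L₁) : Consequences G a b L L₂ w := by
  have p₁ : L' <+: L₁ := by
    rw [h₁]; split_ifs
    · exact List.prefix_append _ _
    · exact List.prefix_refl _
  have p₂ : L₁ <+: L₂ := by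
    rw [h₂]; split_ifs
    · exact List.prefix_append _ _
    · exact List.prefix_refl _
  have m₁ : (G.Adj b w ∨ (b, w) ∈ L') → ¬G.Adj a w → (a, w) ∈ L₁ := by
    intro g1 g2
    rw [h₁]
    by_cases g3 : (a, w) ∈ L' <;> simp [g1, g2, g3]
  have m₂ : (G.Adj w a ∨ (w, a) ∈ L₁) → ¬G.Adj w b → (w, b) ∈ L₂ := by
    intro g1 g2
    rw [h₂]
    by_cases g3 : (w, b) ∈ L₁ <;> simp [g1, g2, g3]
  refine ⟨h.subset.trans (p₁.trans p₂), fun R hR => ?_, fun u hu g1 g2 => ?_, fun u hu g1 g2 => ?_⟩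
  · have s₀ := h.sound R hR
    have hR' : CoClosure G R a b := hR _ hab
    have s₁ : ∀ p ∈ L₁, CoClosure G R p.1 p.2 := by
      rw [h₁]
      split_ifs with g
      · intro p hp
        rcases List.mem_append.1 hp with hp | hp
        · exact s₀ p hp
        · rw [List.mem_singleton.1 hp]
          rcases g.1 with g1 | g1
          · exact hR'.right g1 g.2.1
          · exact hR'.trans (s₀ _ g1) g.2.1
      · exact s₀
    rw [h₂]
    split_ifs with g
    · intro p hp
      rcases List.mem_append.1 hp with hp | hp
      · exact s₁ p hp
      · rw [List.mem_singleton.1 hp]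
        rcases g.1 with g1 | g1
        · exact hR'.left g1 g.2.1
        · exact CoClosure.trans (s₁ (w, a) g1) hR' g.2.1
    · exact s₁
  · by_cases hw : u = w
    · subst hw
      exact p₂.subset (m₁ (g1.imp id fun g => h.subset.subset g) g2)
    · have : (w : ℕ) + 1 ≤ u := by
        have : (w : ℕ) ≠ u := fun h => hw (Fin.ext h.symm)
        omega
      exact p₂.subset (p₁.subset (h.right u this g1 g2))
  · by_cases hw : u = w
    · subst hw
      exact m₂ (g1.imp id fun g => p₁.subset (h.subset.subset g)) g2
    · have : (w : ℕ) + 1 ≤ u := by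
        have : (w : ℕ) ≠ u := fun h => hw (Fin.ext h.symm)
        omega
      exact p₂.subset (p₁.subset (h.left u this g1 g2))

/-- Add the immediate consequences of the pair in the registers `14` and `15`. -/
def closePair : RAMProg :=
  .seq (.copy 16 0) (forDown 16 (.seq (derivePair 15 16 14 16) (derivePair 16 14 16 15)))

theorem wp_closePair {a b : Fin n} (hW : Roomy n W) (hs : OrientEnv G L s) (ha : s.reg 14 = a)
    (hb : s.reg 15 = b) (hab : (a, b) ∈ L)
    (h : ∀ t' s' L', t' ≤ t + 62 * n + 2 → OrientEnv G L' s' → Consequences G a b L L' 0 →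
      (∀ r < 16, r ≠ 9 → s'.reg r = s.reg r) → Q t' s') :
    wp W closePair Q t s := by
  refine wp_seq (wp_copy ?_)
  refine wp_forDown (m := n) (fun i t' s' => t' + 62 * i ≤ t + 1 + 62 * n ∧
    (∀ r < 16, r ≠ 9 → s'.reg r = s.reg r) ∧ ∃ L', OrientEnv G L' s' ∧ Consequences G a b L L' i)
    (by simp [hs.consts.size]) ⟨le_rfl, fun r hr _ => by simp [hr.ne], L,
      hs.setReg (by norm_num), List.prefix_refl L, fun R hR => hR, fun w hw => ?_, fun w hw => ?_⟩
    (fun i t s h => ?_) (fun i hi t₁ s₁ hinv hreg => ?_) (fun t' s' hinv => ?_)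
  · exact absurd w.2 (by omega)
  · exact absurd w.2 (by omega)
  · obtain ⟨_, _, L', h, _⟩ := h
    exact h.consts.one
  · obtain ⟨ht, hr, L', hs', hL'⟩ := hinv
    have r14 : (s₁.setReg 16 i).reg 14 = a := by simp [hr, ha]
    have r15 : (s₁.setReg 16 i).reg 15 = b := by simp [hr, hb]
    refine wp_seq (wp_derivePair (c := a) (d := ⟨i, hi⟩) (a := b) (b := ⟨i, hi⟩) hW
      (hs'.setReg (by norm_num)) (by norm_num) (by norm_num) (by norm_num) (by norm_num)
      r15 (by simp) r14 (by simp) fun t₂ s₂ L₂ ht₂ hs₂ hL₂ hr₂ => ?_)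
    refine wp_derivePair (a := ⟨i, hi⟩) (b := a) (c := ⟨i, hi⟩) (d := b) hW
      hs₂ (by norm_num) (by norm_num) (by norm_num) (by norm_num)
      (by simp [hr₂]) (by rw [hr₂ _ (by norm_num) (by norm_num), r14]) (by simp [hr₂])
      (by rw [hr₂ _ (by norm_num) (by norm_num), r15]) fun t₃ s₃ L₃ ht₃ hs₃ hL₃ hr₃ => ?_
    refine ⟨⟨by omega, fun r hlt hne => ?_, L₃, hs₃, hL'.step hab ⟨i, hi⟩ hL₂ hL₃⟩, ?_⟩
    · rw [hr₃ r (by omega) hne, hr₂ r (by omega) hne, RAMState.reg_setReg, if_neg (by omega),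
        hr r hlt hne]
    · rw [hr₃ 16 (by norm_num) (by norm_num), hr₂ 16 (by norm_num) (by norm_num)]
      simp
  · obtain ⟨ht, hr, L', hs', hL'⟩ := hinv
    exact h _ _ L' (by omega) hs' hL' hr

/-- The consequences of the first `h` pairs of `L` belong to `L`. -/
structure ClosedUpTo (G : SimpleGraph (Fin n)) (L : List (Fin n × Fin n)) (h : ℕ) : Prop where
  right : ∀ {a b w}, (a, b) ∈ L.take h → G.Adj b w → ¬G.Adj a w → (a, w) ∈ L
  left : ∀ {a b w}, (a, b) ∈ L.take h → G.Adj w a → ¬G.Adj w b → (w, b) ∈ L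
  trans : ∀ {a b w}, (a, b) ∈ L.take h → (b, w) ∈ L.take h → ¬G.Adj a w → (a, w) ∈ L

/-- For transitivity, of two composable pairs in the prefix the one processed later finds the other
in the list. The prefix itself does not change, because pairs are only appended. -/
theorem ClosedUpTo.succ {h : ℕ} (hL : ClosedUpTo G L h) (hh : h < L.length)
    {L' : List (Fin n × Fin n)} (hc : Consequences G L[h].1 L[h].2 L L' 0) :
    ClosedUpTo G L' (h + 1) := by
  have htake : L'.take (h + 1) = L.take h ++ [L[h]] := by
    obtain ⟨M, rfl⟩ := hc.subset
    rw [List.take_append_of_le_length (by omega), List.take_succ_eq_append_getElem hh]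
  have hmem : ∀ p, p ∈ L'.take (h + 1) ↔ p ∈ L.take h ∨ p = L[h] := by
    intro p
    rw [htake, List.mem_append, List.mem_singleton]
  have hsub : ∀ {p}, p ∈ L → p ∈ L' := fun hp => hc.subset.subset hp
  refine ⟨fun {a b w} h1 h2 h3 => ?_, fun {a b w} h1 h2 h3 => ?_, fun {a b w} h1 h2 h3 => ?_⟩
  · rcases (hmem _).1 h1 with h1 | h1
    · exact hsub (hL.right h1 h2 h3)
    · have := hc.right w (Nat.zero_le _)
      rw [← h1] at this
      exact this (Or.inl h2) h3
  · rcases (hmem _).1 h1 with h1 | h1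
    · exact hsub (hL.left h1 h2 h3)
    · have := hc.left w (Nat.zero_le _)
      rw [← h1] at this
      exact this (Or.inl h2) h3
  · have hin : ∀ {p}, p ∈ L'.take (h + 1) → p ∈ L := fun {p} hp => by
      rcases (hmem _).1 hp with hp | hp
      · exact List.mem_of_mem_take hp
      · rw [hp]; exact List.getElem_mem hh
    rcases (hmem _).1 h1 with h1' | h1'
    · rcases (hmem _).1 h2 with h2' | h2'
      · exact hsub (hL.trans h1' h2' h3)
      · have := hc.left a (Nat.zero_le _)
        rw [← h2'] at this
        exact this (Or.inr (hin h1)) h3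
    · have := hc.right w (Nat.zero_le _)
      rw [← h1'] at this
      exact this (Or.inr (hin h2)) h3

/-- Add the consequences of all pairs from the position in register `8` on. -/
def closeList : RAMProg :=
  .seq (.sub 13 9 8) <| .loop 13 <| .seq (loadCell 2 14 8) <| .seq (loadCell 3 15 8) <|
  .seq (.add 8 8 1) <| .seq closePair (.sub 13 9 8)

/-- The running time is charged to queue positions, `72 * n` for each. A position is processed only
once in the whole computation, so these bounds telescope over successive calls. -/
theorem wp_closeList {h₀ : ℕ} (hW : Roomy n W) (hs : OrientEnv G L s) (h8 : s.reg 8 = h₀)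
    (hle : h₀ ≤ L.length) (hcl : ClosedUpTo G L h₀)
    (h : ∀ t' s' L', t' + 72 * n * h₀ ≤ t + 2 + 72 * n * L'.length → OrientEnv G L' s' →
      s'.reg 8 = L'.length → (∀ a b, (a, b) ∈ L' ↔ CoClosure G (fun a b => (a, b) ∈ L) a b) →
      (∀ r < 13, r ≠ 8 → r ≠ 9 → s'.reg r = s.reg r) → Q t' s') :
    wp W closeList Q t s := by
  refine wp_seq (wp_sub ?_)
  refine wp_loop (fun t' s' => ∃ L' k, OrientEnv G L' s' ∧ s'.reg 8 = k ∧ k ≤ L'.length ∧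
      s'.reg 13 = L'.length - k ∧ ClosedUpTo G L' k ∧ L <+: L' ∧
      (∀ p ∈ L', CoClosure G (fun a b => (a, b) ∈ L) p.1 p.2) ∧
      t' + 72 * n * h₀ ≤ t + 1 + 72 * n * k ∧
      (∀ r < 13, r ≠ 8 → r ≠ 9 → s'.reg r = s.reg r))
    -- The queue grows while it is processed; termination holds because its position increases and
    -- stays at most `n ^ 2`.
    (fun s' => n * n - s'.reg 8) ?_ ?_ ?_
  · refine ⟨L, h₀, hs.setReg (by norm_num), by simp [h8], hle, by simp [h8, hs.len], hcl,
      List.prefix_refl L, fun p hp => .base hp, le_rfl, fun r h1 _ _ => by simp [h1.ne]⟩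
  · rintro t₁ s₁ ⟨L', k, hs₁, hk, hkle, h13, hcl₁, hpre, hsound, ht₁, hr₁⟩ hne
    have hklt : k < L'.length := by omega
    have hkn : k < n * n := hklt.trans_le (length_le_of_nodup hs₁.nodup)
    have hpos := hW.pos
    have hsq := hW.sq_le
    refine wp_seq (wp_loadCell hW hs₁.consts (by norm_num) (by rw [hk]; exact hkn) ?_)
    rw [hk, hs₁.fst k hklt]
    have hs₂ := (hs₁.setReg (d := 20) (v := 2 * (n * n) + k) (by norm_num)).setReg (d := 14)
      (v := L'[k].1) (by norm_num)
    refine wp_seq (wp_loadCell hW hs₂.consts (by norm_num) (by simpa [hk] using hkn) ?_)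
    rw [RAMState.reg_setReg, if_neg (by norm_num), RAMState.reg_setReg, if_neg (by norm_num), hk,
      hs₂.snd k hklt]
    refine wp_seq (wp_add ?_ ?_)
    · simp [hk, hs₁.consts.one]; omega
    simp only [RAMState.reg_setReg, hk, hs₁.consts.one, Nat.reduceEqDiff, if_false,
      OfNat.one_ne_ofNat]
    refine wp_seq (wp_closePair (a := L'[k].1) (b := L'[k].2) hW
      (((hs₂.setReg (by norm_num)).setReg (by norm_num)).setReg_eight) (by simp) (by simp)
      (List.getElem_mem hklt) fun t₂ s₂ L₂ ht₂ hs₃ hc hr₂ => wp_sub ?_)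
    have h8' : s₂.reg 8 = k + 1 := by simp [hr₂]
    have hlen := hc.subset.length_le
    have hk2 : k + 1 ≤ n * n := by omega
    refine ⟨⟨L₂, k + 1, hs₃.setReg (by norm_num), by simp [h8'], by omega, by simp [h8', hs₃.len],
      hcl₁.succ hklt hc, hpre.trans hc.subset, hc.sound _ hsound, ?_, fun r h1 h2 h3 => ?_⟩, ?_⟩
    · have : 72 * n * (k + 1) = 72 * n * k + 72 * n := by ring
      omega
    · rw [RAMState.reg_setReg, if_neg (by omega), hr₂ r (by omega) h3]
      simp [h2, show r ≠ 15 by omega, show r ≠ 20 by omega, show r ≠ 14 by omega, hr₁ r h1 h2 h3]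
    · simp [h8']; omega
  · rintro t₁ s₁ ⟨L', k, hs₁, hk, hkle, h13, hcl₁, hpre, hsound, ht₁, hr₁⟩ h0
    have hkeq : k = L'.length := by omega
    subst hkeq
    refine h _ _ L' (by omega) hs₁ hk (fun a b => ⟨fun hab => hsound _ hab, fun hab => ?_⟩) hr₁
    have hclosed : CoClosed G fun a b => (a, b) ∈ L' :=
      ⟨fun h1 => hcl₁.right (by simpa using h1), fun h1 => hcl₁.left (by simpa using h1),
        fun h1 h2 => hcl₁.trans (by simpa using h1) (by simpa using h2)⟩
    exact hab.le_of_coClosed hclosed fun _ _ h => hpre.subset h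

end CloseProgram

/-! ### Choosing the free comparisons by decreasing degree -/

section OrientLoops

open Classical

variable {W n : ℕ} {Q : ℕ → RAMState → Prop} {t : ℕ} {s : RAMState} {G : SimpleGraph (Fin n)}
  {L : List (Fin n × Fin n)}

/-- The relation given by a list of pairs. -/
def pairRel (L : List (Fin n × Fin n)) (a b : Fin n) : Prop := (a, b) ∈ L

/-- If the vertices in the registers `11` and `12` are not compared yet, make the former smaller and
add all consequences. -/
def orientPair : RAMProg :=
  .seq (loadMat 0 21 11 12) <| .seq (loadMat 1 22 11 12) <| .seq (.add 21 21 22) <|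
  .seq (loadMat 1 22 12 11) <| .seq (.add 21 21 22) <| .seq (.sub 21 1 21) <|
  .seq (.sub 22 11 12) <| .seq (.sub 23 12 11) <| .seq (.add 22 22 23) <|
  .seq (.mul 21 21 22) <| .ite 21 (.seq (pushPair 11 12) closeList) skipProg

theorem wp_orientPair {z v : Fin n} (hW : Roomy n W) (hs : OrientEnv G L s)
    (h8 : s.reg 8 = L.length) (hz : s.reg 11 = z) (hv : s.reg 12 = v)
    (hL : CoClosed G (pairRel L))
    (h : ∀ t' s' L', t' + 72 * n * L.length ≤ t + 40 + 72 * n * L'.length → OrientEnv G L' s' →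
      s'.reg 8 = L'.length → (pairRel L' = if Unoriented G (pairRel L) z v then
        CoClosure G (fun a b => pairRel L a b ∨ a = z ∧ b = v) else pairRel L) →
      (∀ r < 13, r ≠ 8 → r ≠ 9 → s'.reg r = s.reg r) → Q t' s') :
    wp W orientPair Q t s := by
  have hle := hW.le
  have hpos := hW.pos
  have hsq := hW.sq_le
  have hzn := z.2
  have hvn := v.2
  have hA : s.mat n 0 z v ≤ 1 := by rw [hs.adj]; split_ifs <;> omega
  have hM : s.mat n 1 z v ≤ 1 := by rw [hs.mem]; split_ifs <;> omega
  have hM' : s.mat n 1 v z ≤ 1 := by rw [hs.mem]; split_ifs <;> omega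
  refine wp_seq ((Same.refl s).wp_loadMat hW hs.consts (by norm_num) (by norm_num) (by norm_num)
    hz hv z.2 v.2 (by norm_num) fun s1 S1 v1 k1 => ?_)
  refine wp_seq (S1.wp_loadMat hW hs.consts (by norm_num) (by norm_num) (by norm_num)
    hz hv z.2 v.2 (by norm_num) fun s2 S2 v2 k2 => ?_)
  refine wp_seq (S2.wp_add ((k2 21 (by norm_num) (by norm_num)).trans v1) v2 (by norm_num)
    (by omega) fun s3 S3 v3 k3 => ?_)
  refine wp_seq (S3.wp_loadMat hW hs.consts (by norm_num) (by norm_num) (by norm_num)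
    hv hz v.2 z.2 (by norm_num) fun s4 S4 v4 k4 => ?_)
  refine wp_seq (S4.wp_add ((k4 21 (by norm_num) (by norm_num)).trans v3) v4 (by norm_num)
    (by omega) fun s5 S5 v5 k5 => ?_)
  refine wp_seq (S5.wp_sub ((S5.reg 1 (by norm_num)).trans hs.consts.one) v5 (by norm_num)
    fun s6 S6 v6 k6 => ?_)
  refine wp_seq (S6.wp_sub ((S6.reg 11 (by norm_num)).trans hz)
    ((S6.reg 12 (by norm_num)).trans hv) (by norm_num) fun s7 S7 v7 k7 => ?_)
  refine wp_seq (S7.wp_sub ((S7.reg 12 (by norm_num)).trans hv)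
    ((S7.reg 11 (by norm_num)).trans hz) (by norm_num) fun s8 S8 v8 k8 => ?_)
  refine wp_seq (S8.wp_add ((k8 22 (by norm_num)).trans v7) v8 (by norm_num)
    (by omega) fun s9 S9 v9 k9 => ?_)
  -- This factor is `1` exactly if the pair is neither adjacent nor compared; the other factor is
  -- `|z - v|`. Their product tests `Unoriented`.
  have v21 : s9.reg 21 = 1 - (s.mat n 0 z v + s.mat n 1 z v + s.mat n 1 v z) := by
    rw [k9 21 (by norm_num), k8 21 (by norm_num), k7 21 (by norm_num), v6]
  refine wp_seq (S9.wp_mul v21 v9 (by norm_num) ((show _ ≤ 1 * n from Nat.mul_le_mul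
    (by omega) (by omega)).trans (by omega)) fun s10 S10 v10 k10 =>
      wp_ite (fun hcond => ?_) fun hcond => ?_)
  · rw [v10, mul_ne_zero_iff, hs.adj, hs.mem, hs.mem] at hcond
    have hne : z ≠ v := by
      rintro rfl
      simp at hcond
    have hif : Unoriented G (pairRel L) z v := by
      refine ⟨hne, ?_⟩
      by_cases g1 : G.Adj z v <;> by_cases g2 : (z, v) ∈ L <;> by_cases g3 : (v, z) ∈ L <;>
        simp [g1, g2, g3, pairRel] at hcond ⊢
    have hnd : (L ++ [(z, v)]).Nodup := by
      rw [List.nodup_append]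
      refine ⟨hs.nodup, by simp, ?_⟩
      intro p hp q hq
      rw [List.mem_singleton.1 hq]
      rintro rfl
      exact hif.2.2.1 hp
    refine wp_seq (wp_pushPair hW (hs.same S10) (by norm_num) (by norm_num)
      ((S10.reg _ (by norm_num)).trans hz) ((S10.reg _ (by norm_num)).trans hv)
      hif.2.2.1 fun s₁ hs₁ hr₁ => ?_)
    have hmem : ∀ {p}, p ∈ L → p ∈ L ++ [(z, v)] := fun hp => List.mem_append_left _ hp
    -- The old list was closed, so the queue may start at the new pair.
    refine wp_closeList (h₀ := L.length) hW hs₁ ?_ (by simp) ⟨?_, ?_, ?_⟩ ?_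
    · rw [hr₁ 8 (by norm_num) (by norm_num), S10.reg 8 (by norm_num), h8]
    · simp only [List.take_left]
      exact fun h1 h2 h3 => hmem (hL.right h1 h2 h3)
    · simp only [List.take_left]
      exact fun h1 h2 h3 => hmem (hL.left h1 h2 h3)
    · simp only [List.take_left]
      exact fun h1 h2 h3 => hmem (hL.trans h1 h2 h3)
    · intro t' s' L' ht' hs' h8' hL' hr'
      refine h t' s' L' (by omega) hs' h8' ?_ fun r g1 g2 g3 => ?_
      · rw [if_pos hif]
        funext a b
        have : (fun a b => (a, b) ∈ L ++ [(z, v)]) = fun a b => pairRel L a b ∨ a = z ∧ b = v := by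
          funext a b
          simp [pairRel]
        rw [← this]
        exact propext (hL' a b)
      · rw [hr' r g1 g2 g3, hr₁ r (by omega) g3, S10.reg r (by omega)]
  · rw [v10, mul_eq_zero, hs.adj, hs.mem, hs.mem] at hcond
    have hif : ¬Unoriented G (pairRel L) z v := by
      rintro ⟨g0, g1, g2, g3⟩
      have g0' : (z : ℕ) ≠ v := fun h => g0 (Fin.ext h)
      simp only [pairRel] at g2 g3
      simp only [g1, g2, g3, if_false] at hcond
      omega
    have S11 := S10.setReg (d := 20) (v := 0) le_rfl
    exact wp_skip (h _ _ L (by omega) (hs.same S11) ((S11.reg 8 (by norm_num)).trans h8)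
      (by rw [if_neg hif]) fun r hr _ _ => S11.reg r (by omega))

theorem vdeg_lt (G : SimpleGraph (Fin n)) (x : Fin n) : vdeg G x < n := by
  have h : relNbhd G.Adj {x} ⊂ Finset.univ := by
    rw [Finset.ssubset_univ_iff]
    intro h
    have : x ∈ relNbhd G.Adj {x} := h ▸ Finset.mem_univ x
    simp [mem_relNbhd] at this
  simpa [vdeg] using Finset.card_lt_card h

/-- Compare the vertex in register `11` with all other vertices. -/
def orientVertex : RAMProg := .seq (.copy 12 0) (forDown 12 orientPair)

/-- Vertices of larger degree are compared with everything, hence isolated among the uncompared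
pairs, so `z` has the largest degree in its component. The order `T` from `IsStage.exists_orient` is
fixed for the whole loop, and every choice `z < v` agrees with it. -/
theorem wp_orientVertex {z : Fin n} (hW : Roomy n W) (hG : FourCycleChordal G)
    (hs : OrientEnv G L s) (h8 : s.reg 8 = L.length) (hz : s.reg 11 = z)
    (hL : IsStage G (pairRel L))
    (hdeg : ∀ x, x ≠ z → vdeg G z < vdeg G x → ∀ v, ¬Unoriented G (pairRel L) x v)
    (h : ∀ t' s' L', t' + 72 * n * L.length ≤ t + 2 + 42 * n + 72 * n * L'.length →
      OrientEnv G L' s' → s'.reg 8 = L'.length → IsStage G (pairRel L') →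
      (∀ v, ¬Unoriented G (pairRel L') z v) → (∀ a b, pairRel L a b → pairRel L' a b) →
      (∀ r < 12, r ≠ 8 → r ≠ 9 → s'.reg r = s.reg r) → Q t' s') :
    wp W orientVertex Q t s := by
  obtain ⟨T, hT, hLT, hnext⟩ := hL.exists_orient hG (z := z) (by
    intro x hx
    by_contra hlt
    rw [not_le] at hlt
    have hxz : x ≠ z := by rintro rfl; exact lt_irrefl _ hlt
    rcases (unoriented_reach_symm hx).cases_head with h | ⟨c, hc, _⟩
    · exact hxz h
    · exact hdeg x hxz hlt c hc)
  refine wp_seq (wp_copy ?_)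
  refine wp_forDown (m := n) (fun i t' s' => ∃ L', OrientEnv G L' s' ∧ s'.reg 8 = L'.length ∧
    IsPhase G (pairRel L) T z (pairRel L') ∧
    (∀ v : Fin n, i ≤ v → ¬Unoriented G (pairRel L') z v) ∧
    t' + 72 * n * L.length + 42 * i ≤ t + 1 + 42 * n + 72 * n * L'.length ∧
    (∀ r < 12, r ≠ 8 → r ≠ 9 → s'.reg r = s.reg r))
    (by simp [hs.consts.size]) ⟨L, hs.setReg (by norm_num), by simp [h8], hL.isPhase hLT z,
      fun v hv => absurd v.2 (by omega), by omega, fun r hr _ _ => by simp [hr.ne]⟩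
    (fun i t s ⟨L', h, _⟩ => h.consts.one) (fun i hi t₁ s₁ hinv hreg => ?_) (fun t' s' hinv => ?_)
  · obtain ⟨L', hs', h8', hph, hdone, ht, hr⟩ := hinv
    refine wp_orientPair (z := z) (v := ⟨i, hi⟩) hW (hs'.setReg (by norm_num)) (by simp [h8'])
      (by simp [hr, hz]) (by simp) hph.closed fun t₂ s₂ L₂ ht₂ hs₂ h8₂ hL₂ hr₂ => ?_
    have hph₂ : IsPhase G (pairRel L) T z (pairRel L₂) := by
      rw [hL₂]
      split_ifs with hu
      · refine hph.coClosure hT (hnext _ hph.closed hph.le hph.le_orient _ hu fun v' hv' => ?_)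
        exact hdone v' (by rw [Fin.lt_def] at hv'; exact hv')
      · exact hph
    have hmono : ∀ a b, pairRel L' a b → pairRel L₂ a b := by
      rw [hL₂]
      split_ifs with hu
      · exact fun a b h => .base (Or.inl h)
      · exact fun a b h => h
    refine ⟨⟨L₂, hs₂, h8₂, hph₂, fun v hv hu => ?_, by omega, fun r g1 g2 g3 => ?_⟩, ?_⟩
    · by_cases hvi : (v : ℕ) = i
      · have hvi' : v = ⟨i, hi⟩ := Fin.ext hvi
        rw [hvi'] at hu
        have hu' : Unoriented G (pairRel L') z ⟨i, hi⟩ :=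
          ⟨hu.1, hu.2.1, fun h => hu.2.2.1 (hmono _ _ h), fun h => hu.2.2.2 (hmono _ _ h)⟩
        rw [if_pos hu'] at hL₂
        exact hu.2.2.1 (hL₂ ▸ .base (Or.inr ⟨rfl, rfl⟩))
      · exact hdone v (by omega) ⟨hu.1, hu.2.1, fun h => hu.2.2.1 (hmono _ _ h),
          fun h => hu.2.2.2 (hmono _ _ h)⟩
    · rw [hr₂ r (by omega) g2 g3, RAMState.reg_setReg, if_neg (by omega), hr r g1 g2 g3]
    · rw [hr₂ 12 (by norm_num) (by norm_num) (by norm_num)]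
      simp
  · obtain ⟨L', hs', h8', hph, hdone, ht, hr⟩ := hinv
    exact h _ _ L' (by omega) hs' h8' (hph.isStage hL hT fun v => hdone v (Nat.zero_le _))
      (fun v => hdone v (Nat.zero_le _)) hph.le hr

/-- Process the vertex in register `11` if its degree is the number in register `10`. -/
def orientVertexOfDegree : RAMProg :=
  .seq (loadCell 5 21 11) <| .seq (.sub 22 10 21) <| .seq (.sub 21 21 10) <|
  .seq (.add 21 21 22) <| .ite 21 skipProg orientVertex

/-- Process all vertices in the order of decreasing degrees. -/
def orientAll : RAMProg :=
  .seq (.copy 10 0) (forDown 10 (.seq (.copy 11 0) (forDown 11 orientVertexOfDegree)))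

theorem wp_orientVertexOfDegree {z : Fin n} {d : ℕ} (hW : Roomy n W) (hG : FourCycleChordal G)
    (hs : OrientEnv G L s) (h8 : s.reg 8 = L.length) (hz : s.reg 11 = z) (hd : s.reg 10 = d)
    (hdn : d < n) (hL : IsStage G (pairRel L))
    (hdeg : ∀ x, d < vdeg G x → ∀ v, ¬Unoriented G (pairRel L) x v)
    (h : ∀ t' s' L', t' + 72 * n * L.length ≤ t + 8 + 42 * n + 72 * n * L'.length →
      OrientEnv G L' s' → s'.reg 8 = L'.length → IsStage G (pairRel L') →
      (vdeg G z = d → ∀ v, ¬Unoriented G (pairRel L') z v) →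
      (∀ a b, pairRel L a b → pairRel L' a b) →
      (∀ r < 12, r ≠ 8 → r ≠ 9 → s'.reg r = s.reg r) → Q t' s') :
    wp W orientVertexOfDegree Q t s := by
  have hle := hW.le
  have hzd := vdeg_lt G z
  refine wp_seq ((Same.refl s).wp_loadCell hW hs.consts (by norm_num) (by norm_num)
    hz (z.2.trans_le (Nat.le_mul_self n)) (by norm_num) fun s1 S1 v1 k1 => ?_)
  rw [hs.deg] at v1
  refine wp_seq (S1.wp_sub ((S1.reg 10 (by norm_num)).trans hd) v1 (by norm_num)
    fun s2 S2 v2 k2 => ?_)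
  refine wp_seq (S2.wp_sub ((k2 21 (by norm_num)).trans v1) ((S2.reg 10 (by norm_num)).trans hd)
    (by norm_num) fun s3 S3 v3 k3 => ?_)
  -- The sum of the two truncated differences is the distance between the degree and `d`; it
  -- vanishes exactly if they are equal.
  refine wp_seq (S3.wp_add v3 ((k3 22 (by norm_num)).trans v2) (by norm_num) (by omega)
    fun s4 S4 v4 k4 => wp_ite (fun hcond => ?_) fun hcond => ?_)
  · have S5 := S4.setReg (d := 20) (v := 0) le_rfl
    exact wp_skip (h _ _ L (by omega) (hs.same S5) ((S5.reg 8 (by norm_num)).trans h8) hL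
      (fun h => absurd h (by omega)) (fun _ _ h => h) fun r hr _ _ => S5.reg r (by omega))
  · have hzd' : vdeg G z = d := by omega
    refine wp_orientVertex (z := z) hW hG (hs.same S4) ((S4.reg 8 (by norm_num)).trans h8)
      ((S4.reg 11 (by norm_num)).trans hz) hL (fun x _ hx => hdeg x (hzd' ▸ hx))
      fun t' s' L' ht' hs' h8' hst hu hm hr => h t' s' L' (by omega) hs' h8' hst (fun _ => hu) hm
        fun r g1 g2 g3 => ?_
    rw [hr r g1 g2 g3, S4.reg r (by omega)]

/-- Degrees are less than `n`, so running through the values `n - 1, …, 0` and testing all vertices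
for each value visits the vertices by decreasing degree, without sorting. At the end no pair is
uncompared, and a stage without uncompared pairs equals the full orientation that it extends. -/
theorem wp_orientAll (hW : Roomy n W) (hG : IsIntervalGraph G)
    (hs : OrientEnv G [] s) (h8 : s.reg 8 = 0)
    (h : ∀ t' s' L', t' ≤ t + 3 + n * (n * (42 * n + 10) + 5) + 72 * n * (n * n) →
      OrientEnv G L' s' → IsCoOrient G (pairRel L') → Q t' s') :
    wp W orientAll Q t s := by
  have hG' := fourCycleChordal_of_isIntervalGraph hG
  have hmono : ∀ {L L' : List (Fin n × Fin n)}, (∀ a b, pairRel L a b → pairRel L' a b) →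
      ∀ {x v}, Unoriented G (pairRel L') x v → Unoriented G (pairRel L) x v :=
    fun hm x v hu => ⟨hu.1, hu.2.1, fun h => hu.2.2.1 (hm _ _ h), fun h => hu.2.2.2 (hm _ _ h)⟩
  refine wp_seq (wp_copy ?_)
  refine wp_forDown (m := n) (fun i t' s' => ∃ L', OrientEnv G L' s' ∧ s'.reg 8 = L'.length ∧
    IsStage G (pairRel L') ∧
    (∀ x, i ≤ vdeg G x → ∀ v, ¬Unoriented G (pairRel L') x v) ∧
    t' + i * (n * (42 * n + 10) + 5) ≤
      t + 1 + n * (n * (42 * n + 10) + 5) + 72 * n * L'.length)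
    (by simp [hs.consts.size]) ⟨[], hs.setReg (by norm_num), by simp [h8], ?_,
      fun x hx => absurd (vdeg_lt G x) (by omega), by simp⟩
    (fun i t s ⟨L', h, _⟩ => h.consts.one) (fun i hi t₁ s₁ hinv hreg => ?_) (fun t' s' hinv => ?_)
  · obtain ⟨J, hJ, rfl⟩ := hG
    have : pairRel ([] : List (Fin n × Fin n)) = fun _ _ => False := by
      funext a b
      simp [pairRel]
    rw [this]
    exact isStage_empty ⟨_, isCoOrient_liesLeft hJ⟩
  · obtain ⟨L₁, hs₁, h8₁, hst₁, hdone₁, ht₁⟩ := hinv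
    refine wp_seq (wp_copy ?_)
    refine wp_forDown (m := n) (fun j t' s' => ∃ L', OrientEnv G L' s' ∧ s'.reg 8 = L'.length ∧
      IsStage G (pairRel L') ∧
      (∀ x : Fin n, (i < vdeg G x ∨ vdeg G x = i ∧ j ≤ x) →
        ∀ v, ¬Unoriented G (pairRel L') x v) ∧
      s'.reg 10 = i ∧
      t' + 72 * n * L₁.length + j * (42 * n + 10) ≤
        t₁ + 3 + n * (42 * n + 10) + 72 * n * L'.length)
      (by simp [hs₁.consts.size]) ⟨L₁, (hs₁.setReg (by norm_num)).setReg (by norm_num),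
        by simp [h8₁], hst₁, ?_, by simp, by omega⟩
      (fun i t s ⟨L', h, _⟩ => h.consts.one) (fun j hj t₂ s₂ hinv₂ hreg₂ => ?_)
      (fun t' s' hinv => ?_)
    · rintro x (hx | ⟨_, hx⟩) v
      · exact hdone₁ x hx v
      · exact absurd x.2 (by omega)
    · obtain ⟨L₂, hs₂, h8₂, hst₂, hdone₂, h10, ht₂⟩ := hinv₂
      refine wp_orientVertexOfDegree (z := ⟨j, hj⟩) (d := i) hW hG' (hs₂.setReg (by norm_num))
        (by simp [h8₂]) (by simp) (by simp [h10]) hi hst₂ (fun x hx => hdone₂ x (Or.inl hx))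
        fun t₃ s₃ L₃ ht₃ hs₃ h8₃ hst₃ hu₃ hm₃ hr₃ => ?_
      refine ⟨⟨L₃, hs₃, h8₃, hst₃, fun x hx v hu => ?_, ?_, ?_⟩, ?_⟩
      · by_cases hxj : (x : ℕ) = j ∧ vdeg G x = i
        · have hxj' : x = ⟨j, hj⟩ := Fin.ext hxj.1
          exact hu₃ (hxj' ▸ hxj.2) v (hxj' ▸ hu)
        · refine hdone₂ x ?_ v (hmono hm₃ hu)
          rcases hx with hx | ⟨hx, hx'⟩
          · exact Or.inl hx
          · exact Or.inr ⟨hx, by omega⟩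
      · rw [hr₃ 10 (by norm_num) (by norm_num) (by norm_num)]
        simp [h10]
      · have : (j + 1) * (42 * n + 10) = j * (42 * n + 10) + (42 * n + 10) := by ring
        omega
      · rw [hr₃ 11 (by norm_num) (by norm_num) (by norm_num)]
        simp
    · obtain ⟨L₂, hs₂, h8₂, hst₂, hdone₂, h10, ht₂⟩ := hinv
      refine ⟨⟨L₂, hs₂, h8₂, hst₂, fun x hx => ?_, ?_⟩, h10⟩
      · refine hdone₂ x ?_
        rcases hx.lt_or_eq with hx | hx
        · exact Or.inl hx
        · exact Or.inr ⟨hx.symm, Nat.zero_le _⟩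
      · have : (i + 1) * (n * (42 * n + 10) + 5) =
          i * (n * (42 * n + 10) + 5) + (n * (42 * n + 10) + 5) := by ring
        omega
  · obtain ⟨L₁, hs₁, h8₁, hst₁, hdone₁, ht₁⟩ := hinv
    -- The total cost of forcing is `72 * n` for each of at most `n ^ 2` distinct pairs.
    have := Nat.mul_le_mul_left (72 * n) (length_le_of_nodup hs₁.nodup)
    exact h _ _ L₁ (by omega) hs₁ (hst₁.isCoOrient fun a b => hdone₁ a (Nat.zero_le _) b)

end OrientLoops

/-! ### The dynamic program on a random access machine -/

section Counting

open Classical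

variable {n : ℕ}

/-- The number of indices `y ≥ i` satisfying `P`. -/
noncomputable def tailCount (P : Fin n → Prop) (i : ℕ) : ℕ :=
  (Finset.univ.filter fun y : Fin n => i ≤ y ∧ P y).card

theorem tailCount_zero (P : Fin n → Prop) : tailCount P 0 = (Finset.univ.filter P).card := by
  simp [tailCount]

theorem tailCount_self (P : Fin n → Prop) : tailCount P n = 0 := by
  rw [tailCount, Finset.card_eq_zero, Finset.filter_eq_empty_iff]
  rintro y _ ⟨h, _⟩
  exact absurd y.2 (by omega)

theorem tailCount_le (P : Fin n → Prop) (i : ℕ) : tailCount P i ≤ n := by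
  unfold tailCount
  simpa using Finset.card_le_univ (Finset.univ.filter fun y : Fin n => i ≤ y ∧ P y)

theorem tailCount_succ (P : Fin n → Prop) {i : ℕ} (hi : i < n) :
    tailCount P i = tailCount P (i + 1) + if P ⟨i, hi⟩ then 1 else 0 := by
  have h : (Finset.univ.filter fun y : Fin n => i ≤ y ∧ P y) =
      (Finset.univ.filter fun y : Fin n => i + 1 ≤ y ∧ P y) ∪
        if P ⟨i, hi⟩ then {⟨i, hi⟩} else ∅ := by
    ext y
    simp only [Finset.mem_filter, Finset.mem_univ, true_and, Finset.mem_union]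
    by_cases hy : (y : ℕ) = i
    · have : y = ⟨i, hi⟩ := Fin.ext hy
      subst this
      split_ifs with h <;> simp [h]
    · have : y ≠ ⟨i, hi⟩ := fun h => hy (by rw [h])
      split_ifs <;> simp [this] <;> intro _ <;> omega
  rw [tailCount, h, Finset.card_union_of_disjoint]
  · split_ifs <;> simp [tailCount]
  · rw [Finset.disjoint_left]
    intro y hy hy'
    simp only [Finset.mem_filter, Finset.mem_univ, true_and] at hy
    split_ifs at hy'
    · rw [Finset.mem_singleton.1 hy'] at hy
      simp at hy
    · simp at hy'

theorem vdeg_eq_tailCount (G : SimpleGraph (Fin n)) (x : Fin n) :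
    vdeg G x = tailCount (G.Adj x) 0 := by
  rw [tailCount_zero, vdeg, relNbhd]
  simp

theorem diffCard_eq_tailCount (G : SimpleGraph (Fin n)) (x y : Fin n) :
    diffCard G x y =
      tailCount (fun w => G.Adj x w ∧ ¬G.Adj y w) 0 := by
  rw [tailCount_zero, diffCard]
  congr 1
  ext w
  simp [mem_relNbhd]

/-- `v` is the least `|N(I)|` of the independent sets `I` of cardinality `k` with largest element
`x`, or `n ^ 2` if there are none. -/
structure EntrySpec (G : SimpleGraph (Fin n)) (T : Fin n → Fin n → Prop) (k : ℕ) (x : Fin n)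
    (v : ℕ) : Prop where
  le : v ≤ n * n
  lower : ∀ I, IndepMax G T x I → I.card = k → v ≤ (relNbhd G.Adj I).card
  attained : v = n * n ∨ ∃ I, IndepMax G T x I ∧ I.card = k ∧ (relNbhd G.Adj I).card = v

theorem entrySpec_one (G : SimpleGraph (Fin n)) (T : Fin n → Fin n → Prop) (x : Fin n) :
    EntrySpec G T 1 x (vdeg G x) where
  le := (vdeg_lt G x).le.trans (Nat.le_mul_self n)
  lower I hI hc := by
    obtain ⟨a, rfl⟩ := Finset.card_eq_one.1 hc
    rw [← Finset.mem_singleton.1 hI.2.1]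
    rfl
  attained := Or.inr ⟨{x}, ⟨by simp [RelIndep], by simp, by simp⟩, by simp, rfl⟩

/-- The recurrence with `n ^ 2` in place of `∞`. The cap `v ≤ n * n` makes the substitute absorbing:
a minimum attained at `f y = n * n` is again `n * n`. -/
theorem EntrySpec.succ {G : SimpleGraph (Fin n)} {T : Fin n → Fin n → Prop} (hT : IsCoOrient G T)
    {k v : ℕ} {x : Fin n} {f : Fin n → ℕ} (hk : 1 ≤ k) (hf : ∀ y, EntrySpec G T k y (f y))
    (hv : v ≤ n * n)
    (hle : ∀ y, T y x → v ≤ f y + diffCard G x y)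
    (hatt : v = n * n ∨
      ∃ y, T y x ∧ v = f y + diffCard G x y) :
    EntrySpec G T (k + 1) x v where
  le := hv
  lower I hI hc := by
    obtain ⟨y, J, hyx, hJ, hJc, hN⟩ := hI.exists_erase hT (by omega)
    rw [hN]
    have := (hf y).lower J hJ (by omega)
    have := hle y hyx
    omega
  attained := by
    rcases hatt with h | ⟨y, hyx, h⟩
    · exact Or.inl h
    rcases (hf y).attained with h' | ⟨J, hJ, hJc, hN⟩
    · exact Or.inl (by omega)
    · obtain ⟨h1, h2, h3⟩ := hJ.insert hT hyx
      exact Or.inr ⟨_, h1, by omega, by omega⟩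

/-- `p` and `m` are the sizes of an independent set and of its neighbourhood. -/
def IsCandidate (G : SimpleGraph (Fin n)) (p m : ℕ) : Prop :=
  ∃ I, RelIndep G.Adj I ∧ I.card = p ∧ 0 < p ∧ (relNbhd G.Adj I).card = m

theorem IsCandidate.add_le {G : SimpleGraph (Fin n)} {p m : ℕ} (h : IsCandidate G p m) :
    p + m ≤ n := by
  obtain ⟨I, hI, rfl, _, rfl⟩ := h
  have hd : Disjoint I (relNbhd G.Adj I) := by
    rw [Finset.disjoint_left]
    intro v hv hv'
    obtain ⟨u, hu, huv⟩ := mem_relNbhd.1 hv'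
    exact hI u hu v hv huv
  rw [← Finset.card_union_of_disjoint hd]
  simpa using Finset.card_le_univ (I ∪ relNbhd G.Adj I)

/-- The value `n ^ 2` that stands for `∞` never wins a comparison, because `k * m ≤ n * n ≤ p * (n *
n)`. So an entry that beats a genuine candidate comes from an independent set. -/
theorem EntrySpec.isCandidate {G : SimpleGraph (Fin n)} {T : Fin n → Fin n → Prop} {k v : ℕ}
    {x : Fin n} (hv : EntrySpec G T k x v) (hk : 0 < k) (hkn : k ≤ n) {p m : ℕ}
    (hp : IsCandidate G p m) (hlt : p * v < k * m) : IsCandidate G k v := by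
  rcases hv.attained with h | ⟨I, hI, hc, hN⟩
  · have := hp.add_le
    obtain ⟨_, _, _, h0, _⟩ := hp
    have h1 : k * m ≤ n * n := Nat.mul_le_mul hkn (by omega)
    have h2 : v ≤ p * v := Nat.le_mul_of_pos_left _ h0
    omega
  · exact ⟨I, hI.1, hc, hk, hN⟩

/-- Every nonempty independent set has a largest element, so its ratio is bounded below by the table
entry for that element and its cardinality. A candidate that beats all entries is therefore optimal
among all independent sets. -/
theorem IsCandidate.isTensorCapacity {G : SimpleGraph (Fin n)} {T : Fin n → Fin n → Prop}
    (hT : IsCoOrient G T) (hn : 1 ≤ n) {p m : ℕ} (hp : IsCandidate G p m) {f : ℕ → Fin n → ℕ}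
    (hf : ∀ k < n, ∀ x, EntrySpec G T (k + 1) x (f k x))
    (hopt : ∀ k < n, ∀ x, m * (k + 1) ≤ p * f k x) :
    IsTensorCapacity G (if m < p then 1 else (p : ℝ) / (p + m)) := by
  obtain ⟨I, hI, rfl, h0, rfl⟩ := hp
  have : Nonempty (Fin n) := ⟨⟨0, hn⟩⟩
  refine isTensorCapacity_of_optimal G hI (Finset.card_pos.1 h0) fun I' hI' => ?_
  rcases I'.eq_empty_or_nonempty with rfl | hne
  · simp
  obtain ⟨x, hx⟩ := exists_indepMax hT hI' hne
  have hc := Finset.card_le_univ I'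
  rw [Fintype.card_fin] at hc
  have hpos := hne.card_pos
  have h1 := hopt (I'.card - 1) (by omega) x
  have h2 := (hf (I'.card - 1) (by omega) x).lower I' hx (by omega)
  rw [show I'.card - 1 + 1 = I'.card by omega] at h1
  exact h1.trans (Nat.mul_le_mul_left _ h2)

end Counting

/-! ### Setting up the constants and the degrees -/

section InitProgram

open Classical

variable {W n : ℕ} {Q : ℕ → RAMState → Prop} {t : ℕ} {s : RAMState} {G : SimpleGraph (Fin n)}

/-- Compute the constants in the first registers. -/
def initConsts : RAMProg :=
  .seq (.const 1 1) <| .seq (.mul 2 0 0) <| .seq (.add 3 2 2) <| .seq (.add 4 3 2) <|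
  .seq (.add 5 4 2) (.add 6 5 2)

/-- The memory holds the adjacency matrix, and no pair is oriented. -/
structure InitEnv (G : SimpleGraph (Fin n)) (s : RAMState) : Prop where
  consts : Consts n s
  adj : ∀ i j : Fin n, s.mat n 0 i j = if G.Adj i j then 1 else 0
  mem : ∀ i j : Fin n, s.mat n 1 i j = 0
  head : s.reg 8 = 0
  len : s.reg 9 = 0

theorem InitEnv.setReg {d v : ℕ} (h : InitEnv G s) (hd : 10 ≤ d) : InitEnv G (s.setReg d v) where
  consts := h.consts.setReg (by omega)
  adj := h.adj
  mem := h.mem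
  head := by rw [RAMState.reg_setReg, if_neg (by omega), h.head]
  len := by rw [RAMState.reg_setReg, if_neg (by omega), h.len]

theorem InitEnv.setMem {b k v : ℕ} (h : InitEnv G s) (hb : 2 ≤ b) (hk : k < n * n) :
    InitEnv G (s.setMem (b * (n * n) + k) v) where
  consts := h.consts.of_eq fun _ _ => rfl
  adj i j := by
    rw [RAMState.mat, s.cell_setMem v hk (index_lt i.2 j.2), if_neg (by omega)]
    exact h.adj i j
  mem i j := by
    rw [RAMState.mat, s.cell_setMem v hk (index_lt i.2 j.2), if_neg (by omega)]
    exact h.mem i j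
  head := h.head
  len := h.len

theorem wp_initConsts (hW : Roomy n W)
    (h : ∀ s', InitEnv G s' → Q (t + 6) s') : wp W initConsts Q t (graphInput G) := by
  have hsq := hW.sq_le
  have hpos := hW.pos
  have hle := hW.le
  have h0 : (graphInput G).reg 0 = n := by simp [graphInput]
  have hr : ∀ r, r ≠ 0 → (graphInput G).reg r = 0 := fun r hr => by simp [graphInput, hr]
  refine wp_seq (wp_const (by omega) (wp_seq (wp_mul ?_ (wp_seq (wp_add ?_ (wp_seq (wp_add ?_
    (wp_seq (wp_add ?_ (wp_add ?_ (h _ ⟨⟨?_, ?_, fun b hb => ?_⟩, fun i j => ?_, fun i j => ?_,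
      ?_, ?_⟩)))))))))))
  · simp [h0]; omega
  · simp [h0]; omega
  · simp [h0]; omega
  · simp [h0]; omega
  · simp [h0]; omega
  · simp [h0]
  · simp
  · interval_cases b <;> simp [regionReg, h0, hr] <;> ring
  · have : (∃ i' j' : Fin n, G.Adj i' j' ∧ (i : ℕ) * n + j = i' * n + j') ↔ G.Adj i j := by
      constructor
      · rintro ⟨i', j', hadj, he⟩
        obtain ⟨h1, h2⟩ := (mul_add_inj j.2 j'.2).1 he
        rwa [Fin.ext h1, Fin.ext h2]
      · exact fun h => ⟨i, j, h, rfl⟩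
    simp [RAMState.mat, RAMState.cell, graphInput, this]
  · have : ¬∃ i' j' : Fin n, G.Adj i' j' ∧ n * n + ((i : ℕ) * n + j) = i' * n + j' := by
      rintro ⟨i', j', _, he⟩
      have := index_lt i'.2 j'.2
      omega
    simp [RAMState.mat, RAMState.cell, graphInput, this]
  · simp [hr]
  · simp [hr]

/-- Store the degree of the vertex in register `10`. -/
def storeDegree : RAMProg :=
  .seq (.const 12 0) <| .seq (.copy 11 0) <|
  .seq (forDown 11 (.seq (loadMat 0 21 10 11) (.add 12 12 21))) (storeCell 5 10 12)

def storeDegrees : RAMProg := .seq (.copy 10 0) (forDown 10 storeDegree)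

theorem wp_storeDegree {x : Fin n} (hW : Roomy n W) (hs : InitEnv G s) (hx : s.reg 10 = x)
    (h : ∀ t' s', t' ≤ t + 7 * n + 5 → InitEnv G s' → s'.reg 10 = x →
      (∀ y : Fin n, s'.cell n 5 y = if y = x then vdeg G x else s.cell n 5 y) → Q t' s') :
    wp W storeDegree Q t s := by
  have hle := hW.le
  have hpos := hW.pos
  have hfin : ∀ y : Fin n, (y : ℕ) < n * n := fun y => y.2.trans_le (Nat.le_mul_self n)
  refine wp_seq (wp_const (Nat.zero_le _) (wp_seq (wp_copy (wp_seq ?_))))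
  refine wp_forDown (m := n) (fun i t' s' => t' + 7 * i ≤ t + 2 + 7 * n ∧ InitEnv G s' ∧
    s'.reg 10 = x ∧ s'.reg 12 = tailCount (G.Adj x) i ∧
    ∀ k, s'.cell n 5 k = s.cell n 5 k)
    (by simp [hs.consts.size]) ⟨by omega, (hs.setReg (by norm_num)).setReg (by norm_num),
      by simp [hx], by simp [tailCount_self], fun k => rfl⟩
    (fun i t s h => h.2.1.consts.one) (fun i hi t₁ s₁ hinv hreg => ?_) (fun t' s' hinv => ?_)
  · obtain ⟨ht, hs₁, h10, h12, hc⟩ := hinv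
    refine wp_seq ((Same.refl _).wp_loadMat (x := x) (y := i) hW
      (hs₁.setReg (d := 11) (by norm_num)).consts (by norm_num) (by norm_num) (by norm_num)
      (by simp [h10]) (by simp) x.2 hi (by norm_num) fun s2 S2 v2 k2 => ?_)
    rw [RAMState.mat_setReg, hs₁.adj x ⟨i, hi⟩] at v2
    have v12 : s2.reg 12 = tailCount (G.Adj x) (i + 1) := by
      rw [S2.reg 12 (by norm_num)]
      simp [h12]
    have hsum : s2.reg 12 + s2.reg 21 = tailCount (G.Adj x) i := by
      rw [v12, v2, tailCount_succ _ hi]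
    have htl := tailCount_le (G.Adj x) i
    refine wp_add (by omega) ?_
    rw [hsum]
    have hs₂ : InitEnv G s2 := by
      have := hs₁.setReg (d := 11) (v := i) (by norm_num)
      exact ⟨S2.consts this.consts, fun a b => (S2.mat _ _ _ _).trans (this.adj a b),
        fun a b => (S2.mat _ _ _ _).trans (this.mem a b),
        (S2.reg 8 (by norm_num)).trans this.head, (S2.reg 9 (by norm_num)).trans this.len⟩
    refine ⟨⟨by omega, hs₂.setReg (by norm_num), ?_, by simp, fun k => ?_⟩, ?_⟩
    · simp [S2.reg 10 (by norm_num), h10]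
    · rw [RAMState.cell_setReg, S2.cell, RAMState.cell_setReg, hc]
    · simp [S2.reg 11 (by norm_num)]
  · obtain ⟨ht, hs₁, h10, h12, hc⟩ := hinv
    refine wp_storeCell hW hs₁.consts (by norm_num) (by rw [h10]; exact hfin x) (by norm_num) ?_
    rw [h10, h12, ← vdeg_eq_tailCount]
    refine h _ _ (by omega) ((hs₁.setReg (by norm_num)).setMem (by norm_num) (hfin x))
      (by simp [h10]) fun y => ?_
    rw [RAMState.cell_setMem _ _ (hfin x) (hfin y), RAMState.cell_setReg, hc]
    simp [Fin.ext_iff]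

theorem wp_storeDegrees (hW : Roomy n W) (hs : InitEnv G s)
    (h : ∀ t' s', t' ≤ t + n * (7 * n + 7) + 2 → OrientEnv G [] s' → s'.reg 8 = 0 → Q t' s') :
    wp W storeDegrees Q t s := by
  refine wp_seq (wp_copy ?_)
  refine wp_forDown (m := n) (fun i t' s' => t' + i * (7 * n + 7) ≤ t + 1 + n * (7 * n + 7) ∧
    InitEnv G s' ∧ ∀ y : Fin n, i ≤ y → s'.cell n 5 y = vdeg G y)
    (by simp [hs.consts.size]) ⟨by omega, hs.setReg (by norm_num),
      fun y hy => absurd y.2 (by omega)⟩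
    (fun i t s h => h.2.1.consts.one) (fun i hi t₁ s₁ hinv hreg => ?_) (fun t' s' hinv => ?_)
  · obtain ⟨ht, hs₁, hd⟩ := hinv
    refine wp_storeDegree (x := ⟨i, hi⟩) hW (hs₁.setReg (by norm_num)) (by simp)
      fun t₂ s₂ ht₂ hs₂ h10 hc => ?_
    refine ⟨⟨?_, hs₂, fun y hy => ?_⟩, h10⟩
    · have : (i + 1) * (7 * n + 7) = i * (7 * n + 7) + (7 * n + 7) := by ring
      omega
    · rw [hc]
      split_ifs with hyi
      · rw [hyi]
      · have : (y : ℕ) ≠ i := fun h => hyi (Fin.ext h)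
        exact hd y (by omega)
  · obtain ⟨ht, hs₁, hd⟩ := hinv
    refine h _ _ (by omega) ⟨hs₁.consts, hs₁.adj, fun i => hd i (Nat.zero_le _), fun i j => ?_,
      List.nodup_nil, hs₁.len, fun k hk => ?_, fun k hk => ?_⟩ hs₁.head
    · simpa using hs₁.mem i j
    · simp at hk
    · simp at hk

end InitProgram

/-! ### The differences of neighbourhoods and the table of the recurrence -/

section TableProgram

open Classical

variable {W n : ℕ} {Q : ℕ → RAMState → Prop} {t : ℕ} {s : RAMState} {G : SimpleGraph (Fin n)}
  {T : Fin n → Fin n → Prop}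

/-- The memory holds the adjacency matrix and the matrix of the relation `T`. -/
structure GraphEnv (G : SimpleGraph (Fin n)) (T : Fin n → Fin n → Prop) (s : RAMState) :
    Prop where
  consts : Consts n s
  adj : ∀ i j : Fin n, s.mat n 0 i j = if G.Adj i j then 1 else 0
  rel : ∀ i j : Fin n, s.mat n 1 i j = if T i j then 1 else 0

theorem GraphEnv.setReg {d v : ℕ} (h : GraphEnv G T s) (hd : 8 ≤ d) :
    GraphEnv G T (s.setReg d v) :=
  ⟨h.consts.setReg hd, h.adj, h.rel⟩

theorem GraphEnv.same {s' : RAMState} (h : GraphEnv G T s) (hS : Same s s') : GraphEnv G T s' :=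
  ⟨hS.consts h.consts, fun i j => (hS.mat _ _ _ _).trans (h.adj i j),
    fun i j => (hS.mat _ _ _ _).trans (h.rel i j)⟩

theorem GraphEnv.setMem {b i j v : ℕ} (h : GraphEnv G T s) (hb : 2 ≤ b) (hi : i < n)
    (hj : j < n) : GraphEnv G T (s.setMem (b * (n * n) + (i * n + j)) v) where
  consts := h.consts.of_eq fun _ _ => rfl
  adj i' j' := by
    rw [s.mat_setMem v hi hj i'.2 j'.2, if_neg (by omega)]
    exact h.adj i' j'
  rel i' j' := by
    rw [s.mat_setMem v hi hj i'.2 j'.2, if_neg (by omega)]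
    exact h.rel i' j'

/-- Store `|N(x) \ N(y)|` for the vertices `x` and `y` in the registers `10` and `11`. -/
def storeDiff : RAMProg :=
  .seq (.const 13 0) <| .seq (.copy 12 0) <|
  .seq (forDown 12 (.seq (loadMat 0 21 10 12) <| .seq (loadMat 0 22 11 12) <|
    .seq (.sub 22 1 22) <| .seq (.mul 21 21 22) (.add 13 13 21)))
  (storeMat 4 10 11 13)

def storeDiffs : RAMProg :=
  .seq (.copy 10 0) (forDown 10 (.seq (.copy 11 0) (forDown 11 storeDiff)))

theorem wp_storeDiff {x y : Fin n} (hW : Roomy n W) (hs : GraphEnv G T s) (hx : s.reg 10 = x)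
    (hy : s.reg 11 = y)
    (h : ∀ t' s', t' ≤ t + 13 * n + 7 → GraphEnv G T s' → s'.reg 10 = x → s'.reg 11 = y →
      (∀ a b : Fin n, s'.mat n 4 a b = if a = x ∧ b = y then diffCard G x y else s.mat n 4 a b) →
      (∀ a b : Fin n, s'.mat n 5 a b = s.mat n 5 a b) → Q t' s') :
    wp W storeDiff Q t s := by
  have hle := hW.le
  have hpos := hW.pos
  refine wp_seq (wp_const (Nat.zero_le _) (wp_seq (wp_copy (wp_seq ?_))))
  refine wp_forDown (m := n) (fun i t' s' => t' + 13 * i ≤ t + 2 + 13 * n ∧ GraphEnv G T s' ∧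
    s'.reg 10 = x ∧ s'.reg 11 = y ∧
    s'.reg 13 = tailCount (fun w => G.Adj x w ∧ ¬G.Adj y w) i ∧ s'.mem = s.mem)
    (by simp [hs.consts.size]) ⟨by omega, (hs.setReg (by norm_num)).setReg (by norm_num),
      by simp [hx], by simp [hy], by simp [tailCount_self], rfl⟩
    (fun i t s h => h.2.1.consts.one) (fun i hi t₁ s₁ hinv hreg => ?_) (fun t' s' hinv => ?_)
  · obtain ⟨ht, hs₁, h10, h11, h13, hm⟩ := hinv
    have hs₀ := hs₁.setReg (d := 12) (v := i) (by norm_num)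
    have hA : ∀ a b : Fin n, (s₁.setReg 12 i).mat n 0 a b ≤ 1 := fun a b => by
      rw [hs₀.adj]; split_ifs <;> omega
    have := hA x ⟨i, hi⟩
    have := hA y ⟨i, hi⟩
    refine wp_seq ((Same.refl _).wp_loadMat (x := x) (y := i) hW
      hs₀.consts (by norm_num) (by norm_num) (by norm_num)
      (by simp [h10]) (by simp) x.2 hi (by norm_num) fun s2 S2 v2 k2 => ?_)
    refine wp_seq (S2.wp_loadMat (x := y) (y := i) hW
      hs₀.consts (by norm_num) (by norm_num) (by norm_num)
      (by simp [h11]) (by simp) y.2 hi (by norm_num) fun s3 S3 v3 k3 => ?_)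
    refine wp_seq (S3.wp_sub ((S3.reg 1 (by norm_num)).trans hs₀.consts.one) v3 (by norm_num)
      fun s4 S4 v4 k4 => ?_)
    have v21 := (k4 21 (by norm_num)).trans ((k3 21 (by norm_num) (by norm_num)).trans v2)
    refine wp_seq (S4.wp_mul v21 v4 (by norm_num) ((show _ ≤ 1 * 1 from Nat.mul_le_mul
      (by assumption) (by omega)).trans (by omega)) fun s5 S5 v5 k5 => ?_)
    have v13 : s5.reg 13 = tailCount (fun w => G.Adj x w ∧ ¬G.Adj y w) (i + 1) := by
      rw [S5.reg 13 (by norm_num)]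
      simp [h13]
    have hsum : s5.reg 13 + s5.reg 21 = tailCount (fun w => G.Adj x w ∧ ¬G.Adj y w) i := by
      rw [v13, v5, tailCount_succ _ hi, hs₀.adj x ⟨i, hi⟩, hs₀.adj y ⟨i, hi⟩]
      by_cases g1 : G.Adj x ⟨i, hi⟩ <;> by_cases g2 : G.Adj y ⟨i, hi⟩ <;> simp [g1, g2]
    have htl := tailCount_le (fun w => G.Adj x w ∧ ¬G.Adj y w) i
    refine wp_add (by omega) ?_
    rw [hsum]
    refine ⟨⟨by omega, (hs₀.same S5).setReg (by norm_num), ?_, ?_, by simp, ?_⟩, ?_⟩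
    · simp [S5.reg 10 (by norm_num), h10]
    · simp [S5.reg 11 (by norm_num), h11]
    · rw [RAMState.mem_setReg, S5.mem, RAMState.mem_setReg, hm]
    · simp [S5.reg 12 (by norm_num)]
  · obtain ⟨ht, hs₁, h10, h11, h13, hm⟩ := hinv
    refine wp_storeMat hW hs₁.consts (by norm_num) (by rw [h10]; exact x.2)
      (by rw [h11]; exact y.2) (by norm_num) (by norm_num) ?_
    rw [h10, h11, h13, ← diffCard_eq_tailCount]
    refine h _ _ (by omega) ((hs₁.setReg (by norm_num)).setMem (by norm_num) x.2 y.2)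
      (by simp [h10]) (by simp [h11]) (fun a b => ?_) fun a b => ?_
    · rw [RAMState.mat_setMem _ _ x.2 y.2 a.2 b.2, RAMState.mat_setReg]
      simp [Fin.ext_iff, RAMState.mat, RAMState.cell, hm]
    · rw [RAMState.mat_setMem _ _ x.2 y.2 a.2 b.2, RAMState.mat_setReg]
      simp [RAMState.mat, RAMState.cell, hm]

theorem wp_storeDiffs (hW : Roomy n W) (hs : GraphEnv G T s)
    (h : ∀ t' s', t' ≤ t + n * (n * (13 * n + 9) + 4) + 2 → GraphEnv G T s' →
      (∀ a b : Fin n, s'.mat n 4 a b = diffCard G a b) →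
      (∀ a b : Fin n, s'.mat n 5 a b = s.mat n 5 a b) → Q t' s') :
    wp W storeDiffs Q t s := by
  refine wp_seq (wp_copy ?_)
  refine wp_forDown (m := n) (fun i t' s' =>
    t' + i * (n * (13 * n + 9) + 4) ≤ t + 1 + n * (n * (13 * n + 9) + 4) ∧ GraphEnv G T s' ∧
    (∀ a b : Fin n, i ≤ a → s'.mat n 4 a b = diffCard G a b) ∧
    (∀ a b : Fin n, s'.mat n 5 a b = s.mat n 5 a b))
    (by simp [hs.consts.size]) ⟨by omega, hs.setReg (by norm_num),
      fun a b ha => absurd a.2 (by omega), fun a b => rfl⟩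
    (fun i t s h => h.2.1.consts.one) (fun i hi t₁ s₁ hinv hreg => ?_) (fun t' s' hinv => ?_)
  · obtain ⟨ht, hs₁, hd, h5⟩ := hinv
    refine wp_seq (wp_copy ?_)
    refine wp_forDown (m := n) (fun j t' s' =>
      t' + j * (13 * n + 9) ≤ t₁ + 3 + n * (13 * n + 9) ∧ GraphEnv G T s' ∧ s'.reg 10 = i ∧
      (∀ a b : Fin n, (i + 1 ≤ (a : ℕ) ∨ (a : ℕ) = i ∧ j ≤ b) →
        s'.mat n 4 a b = diffCard G a b) ∧
      (∀ a b : Fin n, s'.mat n 5 a b = s.mat n 5 a b))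
      (by simp [hs₁.consts.size]) ⟨by omega, (hs₁.setReg (by norm_num)).setReg (by norm_num),
        by simp, ?_, h5⟩
      (fun i t s h => h.2.1.consts.one) (fun j hj t₂ s₂ hinv₂ hreg₂ => ?_)
      (fun t' s' hinv₂ => ?_)
    · rintro a b (ha | ⟨_, hb⟩)
      · exact hd a b ha
      · exact absurd b.2 (by omega)
    · obtain ⟨ht₂, hs₂, h10, hd₂, h5₂⟩ := hinv₂
      refine wp_storeDiff (x := ⟨i, hi⟩) (y := ⟨j, hj⟩) hW (hs₂.setReg (by norm_num))
        (by simp [h10]) (by simp) fun t₃ s₃ ht₃ hs₃ g10 g11 g4 g5 => ?_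
      refine ⟨⟨?_, hs₃, g10, fun a b hab => ?_, fun a b => ?_⟩, g11⟩
      · have : (j + 1) * (13 * n + 9) = j * (13 * n + 9) + (13 * n + 9) := by ring
        omega
      · rw [g4]
        split_ifs with hc
        · rw [hc.1, hc.2]
        · refine hd₂ a b ?_
          rcases hab with hab | ⟨ha, hb⟩
          · exact Or.inl hab
          · refine Or.inr ⟨ha, ?_⟩
            have : (b : ℕ) ≠ j := fun hbj => hc ⟨Fin.ext ha, Fin.ext hbj⟩
            omega
      · rw [g5]
        exact h5₂ a b
    · obtain ⟨ht₂, hs₂, h10, hd₂, h5₂⟩ := hinv₂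
      refine ⟨⟨?_, hs₂, fun a b ha => hd₂ a b ?_, h5₂⟩, h10⟩
      · have : (i + 1) * (n * (13 * n + 9) + 4) =
          i * (n * (13 * n + 9) + 4) + (n * (13 * n + 9) + 4) := by ring
        omega
      · rcases ha.lt_or_eq with ha | ha
        · exact Or.inl ha
        · exact Or.inr ⟨ha.symm, Nat.zero_le _⟩
  · obtain ⟨ht, hs₁, hd, h5⟩ := hinv
    exact h _ _ (by omega) hs₁ (fun a b => hd a b (Nat.zero_le _)) h5

/-- The memory holds the matrix of `T` and the numbers `|N(x) \ N(y)|`. -/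
structure TableEnv (G : SimpleGraph (Fin n)) (T : Fin n → Fin n → Prop) (s : RAMState) :
    Prop where
  graph : GraphEnv G T s
  diff : ∀ a b : Fin n, s.mat n 4 a b = diffCard G a b

theorem TableEnv.setReg {d v : ℕ} (h : TableEnv G T s) (hd : 8 ≤ d) :
    TableEnv G T (s.setReg d v) :=
  ⟨h.graph.setReg hd, h.diff⟩

theorem TableEnv.same {s' : RAMState} (h : TableEnv G T s) (hS : Same s s') : TableEnv G T s' :=
  ⟨h.graph.same hS, fun i j => (hS.mat _ _ _ _).trans (h.diff i j)⟩

theorem TableEnv.setMem {i j v : ℕ} (h : TableEnv G T s) (hi : i < n) (hj : j < n) :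
    TableEnv G T (s.setMem (5 * (n * n) + (i * n + j)) v) where
  graph := h.graph.setMem (by norm_num) hi hj
  diff a b := by
    rw [s.mat_setMem v hi hj a.2 b.2, if_neg (by omega)]
    exact h.diff a b

/-- Compute the entry of the table in the row given by register `12` and the column given by
register `13` from the row given by register `11`. -/
def storeEntry : RAMProg :=
  .seq (.copy 15 2) <| .seq (.copy 14 0) <|
  .seq (forDown 14 (.seq (loadMat 5 21 11 14) <| .seq (loadMat 4 22 13 14) <|
    .seq (.add 21 21 22) <| .seq (.sub 21 15 21) <| .seq (loadMat 1 22 14 13) <|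
    .seq (.mul 21 21 22) (.sub 15 15 21)))
  (storeMat 5 12 13 15)

theorem wp_storeEntry {x : Fin n} {k : ℕ} (hT : IsCoOrient G T) (hW : Roomy n W)
    (hs : TableEnv G T s) (hk : s.reg 11 = k) (hk' : s.reg 12 = k + 1) (hkn : k + 1 < n)
    (hx : s.reg 13 = x) (hrow : ∀ y : Fin n, EntrySpec G T (k + 1) y (s.mat n 5 k y))
    (h : ∀ t' s' v, t' ≤ t + 18 * n + 7 → TableEnv G T s' →
      (∀ r < 14, s'.reg r = s.reg r) → EntrySpec G T (k + 2) x v →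
      (∀ a < n, ∀ b : Fin n, s'.mat n 5 a b = if a = k + 1 ∧ b = x then v else s.mat n 5 a b) →
      Q t' s') :
    wp W storeEntry Q t s := by
  have hsq := hW.sq_le
  have hle := hW.le
  have hpos := hW.pos
  have hnn := Nat.le_mul_self n
  have h2 : s.reg 2 = n * n := by
    have := hs.graph.consts.region 1 (by norm_num)
    simpa [regionReg] using this
  refine wp_seq (wp_copy (wp_seq (wp_copy (wp_seq ?_))))
  refine wp_forDown (m := n) (fun i t' s' => t' + 18 * i ≤ t + 2 + 18 * n ∧ TableEnv G T s' ∧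
    (∀ r < 14, s'.reg r = s.reg r) ∧ s'.mem = s.mem ∧ s'.reg 15 ≤ n * n ∧
    (∀ y : Fin n, i ≤ y → T y x → s'.reg 15 ≤ s.mat n 5 k y + diffCard G x y) ∧
    (s'.reg 15 = n * n ∨ ∃ y, T y x ∧ s'.reg 15 = s.mat n 5 k y + diffCard G x y))
    (by simp [hs.graph.consts.size]) ⟨by omega, (hs.setReg (by norm_num)).setReg (by norm_num),
      fun r hr => by simp [show r ≠ 14 by omega, show r ≠ 15 by omega], rfl, by simp [h2],
      fun y hy => absurd y.2 (by omega), by simp [h2]⟩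
    (fun i t s h => h.2.1.graph.consts.one) (fun i hi t₁ s₁ hinv hreg => ?_)
    (fun t' s' hinv => ?_)
  · obtain ⟨ht, hs₁, hr, hm, hacc, hlow, hatt⟩ := hinv
    have hmat : ∀ b a c, s₁.mat n b a c = s.mat n b a c := fun b a c => by
      rw [RAMState.mat, RAMState.mat, RAMState.cell, RAMState.cell, hm]
    have hs₀ := hs₁.setReg (d := 14) (v := i) (by norm_num)
    have hc₀ := hs₀.graph.consts
    refine wp_seq ((Same.refl _).wp_loadMat (x := k) (y := i) hW
      hc₀ (by norm_num) (by norm_num) (by norm_num)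
      (by simp [hr, hk]) (by simp) (by omega) hi (by norm_num) fun s2 S2 v2 k2 => ?_)
    refine wp_seq (S2.wp_loadMat (x := x) (y := i) hW
      hc₀ (by norm_num) (by norm_num) (by norm_num)
      (by simp [hr, hx]) (by simp) x.2 hi (by norm_num) fun s3 S3 v3 k3 => ?_)
    rw [RAMState.mat_setReg, hmat] at v2
    rw [hs₀.diff x ⟨i, hi⟩] at v3
    have b2 : s.mat n 5 k i ≤ n * n := (hrow ⟨i, hi⟩).le
    have b3 : diffCard G x ⟨i, hi⟩ ≤ n := by
      rw [diffCard_eq_tailCount]; exact tailCount_le _ _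
    refine wp_seq (S3.wp_add ((k3 21 (by norm_num) (by norm_num)).trans v2) v3 (by norm_num)
      (by omega) fun s4 S4 v4 k4 => ?_)
    have e15 : (s₁.setReg 14 i).reg 15 = s₁.reg 15 := by simp
    refine wp_seq (S4.wp_sub ((S4.reg 15 (by norm_num)).trans e15) v4 (by norm_num)
      fun s5 S5 v5 k5 => ?_)
    refine wp_seq (S5.wp_loadMat (x := i) (y := x) hW
      hc₀ (by norm_num) (by norm_num) (by norm_num)
      (by simp) (by simp [hr, hx]) hi x.2 (by norm_num) fun s6 S6 v6 k6 => ?_)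
    rw [hs₀.graph.rel ⟨i, hi⟩ x] at v6
    have b6 : (if T ⟨i, hi⟩ x then 1 else 0) ≤ 1 := by split_ifs <;> omega
    refine wp_seq (S6.wp_mul ((k6 21 (by norm_num) (by norm_num)).trans v5) v6 (by norm_num)
      ((show _ ≤ (n * n) * 1 from Nat.mul_le_mul (by omega) b6).trans (by omega))
      fun s7 S7 v7 k7 => wp_sub ?_)
    have e15' : s7.reg 15 = s₁.reg 15 := (S7.reg 15 (by norm_num)).trans e15
    rw [e15', v7]
    set c := s.mat n 5 k i + diffCard G x ⟨i, hi⟩ with hc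
    set acc := s₁.reg 15 with hacc'
    -- With truncated subtraction `acc - (acc - c)` is the minimum of `acc` and `c`; the matrix
    -- entry switches the update off for vertices not below `x`. The accumulator starts at `n * n`.
    have hnew : acc - (acc - c) * (if T ⟨i, hi⟩ x then 1 else 0) =
        if T ⟨i, hi⟩ x then min acc c else acc := by
      split_ifs
      · omega
      · simp
    rw [hnew]
    refine ⟨⟨by omega, (hs₀.same S7).setReg (by norm_num), fun r hr' => ?_, ?_, ?_, ?_, ?_⟩, ?_⟩
    · rw [RAMState.reg_setReg, if_neg (by omega), S7.reg r (by omega), RAMState.reg_setReg,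
        if_neg (by omega), hr r hr']
    · rw [RAMState.mem_setReg, S7.mem, RAMState.mem_setReg, hm]
    · rw [RAMState.reg_setReg, if_pos rfl]
      split_ifs <;> omega
    · intro y hy hyx
      rw [RAMState.reg_setReg, if_pos rfl]
      by_cases hyi : (y : ℕ) = i
      · have hyi' : y = ⟨i, hi⟩ := Fin.ext hyi
        subst hyi'
        rw [if_pos hyx]
        exact min_le_right _ _
      · have := hlow y (by omega) hyx
        split_ifs <;> omega
    · rw [RAMState.reg_setReg, if_pos rfl]
      split_ifs with hTi
      · rcases le_total acc c with hle' | hle'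
        · rw [min_eq_left hle']
          exact hatt
        · rw [min_eq_right hle']
          exact Or.inr ⟨⟨i, hi⟩, hTi, rfl⟩
      · exact hatt
    · simp [S7.reg 14 (by norm_num)]
  · obtain ⟨ht, hs₁, hr, hm, hacc, hlow, hatt⟩ := hinv
    have r12 : s'.reg 12 = k + 1 := by rw [hr 12 (by norm_num), hk']
    have r13 : s'.reg 13 = x := by rw [hr 13 (by norm_num), hx]
    refine wp_storeMat hW hs₁.graph.consts (by norm_num) (by omega)
      (by rw [r13]; exact x.2) (by norm_num) (by norm_num) ?_
    rw [r12, r13]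
    refine h _ _ (s'.reg 15) (by omega) ((hs₁.setReg (by norm_num)).setMem hkn x.2)
      (fun r hr' => ?_) (EntrySpec.succ hT (by omega) hrow hacc
        (fun y => hlow y (Nat.zero_le _)) hatt) fun a ha b => ?_
    · rw [RAMState.reg_setMem, RAMState.reg_setReg, if_neg (by omega), hr r hr']
    · rw [RAMState.mat_setMem _ _ hkn x.2 ha b.2, RAMState.mat_setReg]
      simp [Fin.ext_iff, RAMState.mat, RAMState.cell, hm]

/-- Compute all rows of the table from the first one. -/
def storeTable : RAMProg :=
  .seq (.const 11 0) <| .seq (.sub 10 0 1) <|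
  forDown 10 (.seq (.add 12 11 1) <| .seq (.copy 13 0) <| .seq (forDown 13 storeEntry)
    (.copy 11 12))

theorem wp_storeTable (hT : IsCoOrient G T) (hW : Roomy n W) (hs : TableEnv G T s)
    (hrow : ∀ y : Fin n, s.mat n 5 0 y = vdeg G y)
    (h : ∀ t' s', t' ≤ t + n * (n * (18 * n + 9) + 6) + 3 → TableEnv G T s' →
      (∀ k < n, ∀ y : Fin n, EntrySpec G T (k + 1) y (s'.mat n 5 k y)) →
      (∀ y : Fin n, s'.mat n 5 0 y = vdeg G y) → Q t' s') :
    wp W storeTable Q t s := by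
  have hle := hW.le
  have hpos := hW.pos
  refine wp_seq (wp_const (Nat.zero_le _) (wp_seq (wp_sub ?_)))
  -- Row `k` belongs to cardinality `k + 1`. Row `0` consists of the degrees, which already occupy
  -- the first `n` cells of the region, so `n - 1` rows remain; register `11` holds the last
  -- finished one.
  refine wp_forDown (m := n - 1) (fun i t' s' =>
    t' + i * (n * (18 * n + 9) + 6) ≤ t + 2 + n * (n * (18 * n + 9) + 6) ∧ TableEnv G T s' ∧
    s'.reg 11 + i + 1 = n ∧
    (∀ k, k + i < n → ∀ y : Fin n, EntrySpec G T (k + 1) y (s'.mat n 5 k y)) ∧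
    (∀ y : Fin n, s'.mat n 5 0 y = vdeg G y))
    (by simp [hs.graph.consts.size, hs.graph.consts.one])
    ⟨?_, (hs.setReg (by norm_num)).setReg (by norm_num), by simp; omega, fun k hk y => ?_, hrow⟩
    (fun i t s h => h.2.1.graph.consts.one) (fun i hi t₁ s₁ hinv hreg => ?_)
    (fun t' s' hinv => ?_)
  · have := Nat.mul_le_mul_right (n * (18 * n + 9) + 6) (Nat.sub_le n 1)
    omega
  · have : k = 0 := by omega
    subst this
    rw [RAMState.mat_setReg, RAMState.mat_setReg, hrow]
    exact entrySpec_one G T y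
  · obtain ⟨ht, hs₁, h11, hsp, h0⟩ := hinv
    set k := s₁.reg 11 with hk
    have hs₀ := hs₁.setReg (d := 10) (v := i) (by norm_num)
    refine wp_seq (wp_add ?_ (wp_seq (wp_copy (wp_seq ?_))))
    · simp [hs₁.graph.consts.one]; omega
    simp only [RAMState.reg_setReg, Nat.reduceEqDiff, if_false, ← hk, hs₁.graph.consts.one,
      OfNat.one_ne_ofNat]
    refine wp_forDown (m := n) (fun j t' s' =>
      t' + j * (18 * n + 9) ≤ t₁ + 4 + n * (18 * n + 9) ∧ TableEnv G T s' ∧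
      s'.reg 10 = i ∧ s'.reg 11 = k ∧ s'.reg 12 = k + 1 ∧
      (∀ l ≤ k, ∀ y : Fin n, s'.mat n 5 l y = s₁.mat n 5 l y) ∧
      (∀ y : Fin n, j ≤ y → EntrySpec G T (k + 2) y (s'.mat n 5 (k + 1) y)))
      (by simp [hs₁.graph.consts.size])
      ⟨by omega, (hs₀.setReg (by norm_num)).setReg (by norm_num), by simp, by simp [hk],
        by simp, fun _ _ _ => rfl, fun y hy => absurd y.2 (by omega)⟩
      (fun i t s h => h.2.1.graph.consts.one) (fun j hj t₂ s₂ hinv₂ hreg₂ => ?_)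
      (fun t' s' hinv₂ => wp_copy ?_)
    · obtain ⟨ht₂, hs₂, g10, g11, g12, hold, hnew⟩ := hinv₂
      refine wp_storeEntry (x := ⟨j, hj⟩) (k := k) hT hW (hs₂.setReg (by norm_num))
        (by simp [g11]) (by simp [g12]) (by omega) (by simp) (fun y => ?_)
        fun t₃ s₃ v ht₃ hs₃ hr₃ hv hmat => ?_
      · rw [RAMState.mat_setReg, hold k le_rfl]
        exact hsp k (by omega) y
      refine ⟨⟨?_, hs₃, ?_, ?_, ?_, fun l hl y => ?_, fun y hy => ?_⟩, ?_⟩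
      · have : (j + 1) * (18 * n + 9) = j * (18 * n + 9) + (18 * n + 9) := by ring
        omega
      · simp [hr₃ 10 (by norm_num), g10]
      · simp [hr₃ 11 (by norm_num), g11]
      · simp [hr₃ 12 (by norm_num), g12]
      · rw [hmat l (by omega) y, if_neg (by omega), RAMState.mat_setReg, hold l hl]
      · rw [hmat (k + 1) (by omega) y]
        split_ifs with hc
        · rw [hc.2]
          exact hv
        · rw [RAMState.mat_setReg]
          refine hnew y ?_
          have : (y : ℕ) ≠ j := fun hyj => hc ⟨rfl, Fin.ext hyj⟩
          omega
      · simp [hr₃ 13 (by norm_num)]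
    · obtain ⟨ht₂, hs₂, g10, g11, g12, hold, hnew⟩ := hinv₂
      refine ⟨⟨?_, hs₂.setReg (by norm_num), ?_, fun l hl y => ?_, fun y => ?_⟩, ?_⟩
      · have : (i + 1) * (n * (18 * n + 9) + 6) =
          i * (n * (18 * n + 9) + 6) + (n * (18 * n + 9) + 6) := by ring
        omega
      · simp [g12]; omega
      · rw [RAMState.mat_setReg]
        by_cases hlk : l ≤ k
        · rw [hold l hlk]
          exact hsp l (by omega) y
        · have : l = k + 1 := by omega
          rw [this]
          exact hnew y (Nat.zero_le _)
      · rw [RAMState.mat_setReg, hold 0 (Nat.zero_le _)]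
        exact h0 y
      · simp [g10]
  · obtain ⟨ht, hs₁, h11, hsp, h0⟩ := hinv
    exact h _ _ (by omega) hs₁ (fun k hk => hsp k (by omega)) h0

end TableProgram

/-! ### Selecting the best ratio and assembling the program -/

section OutputProgram

open Classical

variable {W n : ℕ} {Q : ℕ → RAMState → Prop} {t : ℕ} {s : RAMState} {G : SimpleGraph (Fin n)}
  {T : Fin n → Fin n → Prop}

/-- Compare the candidate in the registers `17` and `18` with an entry of the table. -/
def bestStep : RAMProg :=
  .seq (loadMat 5 21 10 11) <| .seq (.mul 22 12 18) <| .seq (.mul 23 17 21) <|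
  .seq (.sub 22 22 23) <| .ite 22 (.seq (.copy 17 12) (.copy 18 21)) skipProg

def findBest : RAMProg :=
  .seq (.const 17 1) <| .seq (loadCell 5 18 7) <| .seq (.copy 10 0) <|
  forDown 10 (.seq (.add 12 10 1) <| .seq (.copy 11 0) (forDown 11 bestStep))

/-- Output the tensor capacity determined by the best candidate. -/
def outputRatio : RAMProg :=
  .seq (.sub 20 17 18) <| .ite 20 (.seq (.const 0 1) (.const 1 1))
    (.seq (.copy 0 17) (.add 1 17 18))

/-- Ratios are compared by cross multiplication. The last clause given to `Q` says that the
candidate only improves, so entries examined earlier remain beaten. -/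
theorem wp_bestStep {x : Fin n} {k : ℕ} (hW : Roomy n W) (hs : Consts n s) (h10 : s.reg 10 = k)
    (h11 : s.reg 11 = x) (h12 : s.reg 12 = k + 1) (hk : k < n)
    (hv : EntrySpec G T (k + 1) x (s.mat n 5 k x)) (hc : IsCandidate G (s.reg 17) (s.reg 18))
    (h : ∀ t' s', t' ≤ t + 10 → (∀ r < 17, s'.reg r = s.reg r) → s'.mem = s.mem →
      IsCandidate G (s'.reg 17) (s'.reg 18) →
      s'.reg 18 * (k + 1) ≤ s'.reg 17 * s.mat n 5 k x →
      (∀ a b, s.reg 18 * a ≤ s.reg 17 * b → s'.reg 18 * a ≤ s'.reg 17 * b) → Q t' s') :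
    wp W bestStep Q t s := by
  have hsum := hc.add_le
  have hsq := hW.sq_le
  have hp0 : 0 < s.reg 17 := by obtain ⟨_, _, _, h0, _⟩ := hc; exact h0
  have hb1 : (k + 1) * s.reg 18 ≤ W :=
    (Nat.mul_le_mul (show k + 1 ≤ n by omega) (show s.reg 18 ≤ n by omega)).trans (by omega)
  -- An entry may be as large as `n * n`, so this product reaches the order of `n ^ 3`; it is the
  -- reason for the cubic bound in `Roomy`.
  have hb2 : s.reg 17 * s.mat n 5 k x ≤ W := by
    have h1 := Nat.mul_le_mul (show s.reg 17 ≤ n by omega) hv.le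
    have h2 := hW.bound
    rw [mul_assoc] at h2
    omega
  refine wp_seq ((Same.refl _).wp_loadMat (x := k) (y := x) hW hs (by norm_num) (by norm_num)
    (by norm_num) h10 h11 hk x.2 (by norm_num) fun s2 S2 v2 k2 => ?_)
  refine wp_seq (S2.wp_mul ((S2.reg 12 (by norm_num)).trans h12) (S2.reg 18 (by norm_num))
    (by norm_num) hb1 fun s3 S3 v3 k3 => ?_)
  have u3 := (k3 21 (by norm_num)).trans v2
  refine wp_seq (S3.wp_mul (S3.reg 17 (by norm_num)) u3 (by norm_num) hb2
    fun s4 S4 v4 k4 => ?_)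
  refine wp_seq (S4.wp_sub ((k4 22 (by norm_num)).trans v3) v4 (by norm_num)
    fun s5 S5 v5 k5 => ?_)
  have u5 : s5.reg 21 = s.mat n 5 k x :=
    (k5 21 (by norm_num)).trans ((k4 21 (by norm_num)).trans u3)
  have w5 := (S5.reg 12 (by norm_num)).trans h12
  refine wp_ite (fun hne => ?_) fun h0 => ?_
  · have hlt : s.reg 17 * s.mat n 5 k x < (k + 1) * s.reg 18 := by omega
    refine wp_seq (wp_copy (wp_copy (h _ _ (by omega) (fun r hr => ?_) S5.mem ?_ ?_ ?_)))
    · simp [show r ≠ 17 by omega, show r ≠ 18 by omega, S5.reg r (by omega)]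
    · simpa [u5, w5] using hv.isCandidate (by omega) hk hc hlt
    · simp [u5, w5, mul_comm]
    · intro a b hab
      simp only [RAMState.reg_setReg, Nat.reduceEqDiff, if_true, if_false, u5, w5]
      refine Nat.le_of_mul_le_mul_left ?_ hp0
      calc s.reg 17 * (s.mat n 5 k x * a) = s.reg 17 * s.mat n 5 k x * a := by ring
        _ ≤ (k + 1) * s.reg 18 * a := Nat.mul_le_mul_right _ hlt.le
        _ = (k + 1) * (s.reg 18 * a) := by ring
        _ ≤ (k + 1) * (s.reg 17 * b) := Nat.mul_le_mul_left _ hab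
        _ = s.reg 17 * ((k + 1) * b) := by ring
  · have hle : s.reg 18 * (k + 1) ≤ s.reg 17 * s.mat n 5 k x := by
      rw [mul_comm]; omega
    have S6 := S5.setReg (d := 20) (v := 0) le_rfl
    refine wp_skip (h _ _ (by omega) (fun r hr => S6.reg r (by omega)) S6.mem ?_ ?_ ?_)
    all_goals rw [S6.reg 17 (by norm_num), S6.reg 18 (by norm_num)]
    · exact hc
    · exact hle
    · exact fun _ _ h => h

theorem wp_findBest (hW : Roomy n W) (hs : Consts n s)
    (htab : ∀ k < n, ∀ y : Fin n, EntrySpec G T (k + 1) y (s.mat n 5 k y))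
    (hrow : ∀ y : Fin n, s.mat n 5 0 y = vdeg G y)
    (h : ∀ t' s', t' ≤ t + n * (n * 12 + 5) + 5 → Consts n s' →
      IsCandidate G (s'.reg 17) (s'.reg 18) →
      (∀ k < n, ∀ y : Fin n, s'.reg 18 * (k + 1) ≤ s'.reg 17 * s.mat n 5 k y) → Q t' s') :
    wp W findBest Q t s := by
  have hpos := hW.pos
  have hle := hW.le
  have hnn := Nat.le_mul_self n
  have h7 : s.reg 7 = 0 := by
    have := hs.region 0 (by norm_num)
    simpa [regionReg] using this
  refine wp_seq (wp_const (by omega) (wp_seq (wp_loadCell hW (hs.setReg (by norm_num))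
    (by norm_num) (by simp [h7]; omega) (wp_seq (wp_copy ?_)))))
  -- The initial candidate is the singleton of vertex `0`. Register `7` holds `0` and serves here as
  -- the index of the cell.
  have hd : s.cell n 5 0 = vdeg G ⟨0, hpos⟩ := by
    rw [← hrow, RAMState.mat]; simp
  refine wp_forDown (m := n) (fun i t' s' =>
    t' + i * (n * 12 + 5) ≤ t + 4 + n * (n * 12 + 5) ∧ Consts n s' ∧ s'.mem = s.mem ∧
    IsCandidate G (s'.reg 17) (s'.reg 18) ∧
    (∀ k < n, i ≤ k → ∀ y : Fin n, s'.reg 18 * (k + 1) ≤ s'.reg 17 * s.mat n 5 k y))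
    (by simp [hs.size]) ⟨by omega, (((hs.setReg (by norm_num)).setReg (by norm_num)).setReg
      (by norm_num)).setReg (by norm_num), rfl, ?_, fun k hk hk' => absurd hk (by omega)⟩
    (fun i t s h => h.2.1.one) (fun i hi t₁ s₁ hinv hreg => ?_) (fun t' s' hinv => ?_)
  · simp only [RAMState.reg_setReg, Nat.reduceEqDiff, if_true, if_false, h7,
      RAMState.cell_setReg, hd]
    exact ⟨{⟨0, hpos⟩}, by simp [RelIndep], by simp, one_pos, rfl⟩
  · obtain ⟨ht, hs₁, hm, hc, hbest⟩ := hinv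
    have hs₀ := hs₁.setReg (d := 10) (v := i) (by norm_num)
    refine wp_seq (wp_add ?_ (wp_seq (wp_copy ?_)))
    · simp [hs₁.one]; omega
    refine wp_forDown (m := n) (fun j t' s' =>
      t' + j * 12 ≤ t₁ + 4 + n * 12 ∧ Consts n s' ∧ s'.mem = s.mem ∧
      s'.reg 10 = i ∧ s'.reg 12 = i + 1 ∧ IsCandidate G (s'.reg 17) (s'.reg 18) ∧
      (∀ k < n, ∀ y : Fin n, (i + 1 ≤ k ∨ k = i ∧ j ≤ y) →
        s'.reg 18 * (k + 1) ≤ s'.reg 17 * s.mat n 5 k y))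
      (by simp [hs₁.size]) ⟨by omega, (hs₀.setReg (by norm_num)).setReg (by norm_num), hm,
        by simp, by simp [hs₁.one], by simpa using hc, ?_⟩
      (fun i t s h => h.2.1.one) (fun j hj t₂ s₂ hinv₂ hreg₂ => ?_)
      (fun t' s' hinv₂ => ?_)
    · rintro k hk y (hik | ⟨_, hy⟩)
      · simpa using hbest k hk hik y
      · exact absurd y.2 (by omega)
    · obtain ⟨ht₂, hs₂, hm₂, g10, g12, hc₂, hb₂⟩ := hinv₂
      have hmat : ∀ a b, (s₂.setReg 11 j).mat n 5 a b = s.mat n 5 a b := fun a b => by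
        rw [RAMState.mat, RAMState.mat, RAMState.cell, RAMState.cell, RAMState.mem_setReg, hm₂]
      refine wp_bestStep (G := G) (T := T) (x := ⟨j, hj⟩) (k := i) hW
        (hs₂.setReg (by norm_num)) (by simp [g10]) (by simp) (by simp [g12]) hi
        (by rw [hmat]; exact htab i hi _) (by simpa using hc₂)
        fun t₃ s₃ ht₃ hr₃ hm₃ hc₃ hn₃ hmono => ?_
      rw [hmat] at hn₃
      refine ⟨⟨by omega, (hs₂.setReg (d := 11) (v := j) (by norm_num)).of_eq
        fun r hr => hr₃ r (by omega), hm₃.trans hm₂, ?_, ?_, hc₃, fun k hk y hky => ?_⟩, ?_⟩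
      · simp [hr₃ 10 (by norm_num), g10]
      · simp [hr₃ 12 (by norm_num), g12]
      · by_cases hyj : k = i ∧ (y : ℕ) = j
        · obtain ⟨rfl, hy⟩ := hyj
          have : y = ⟨j, hj⟩ := Fin.ext hy
          subst this
          exact hn₃
        · exact hmono _ _ (by simpa using hb₂ k hk y (by omega))
      · simp [hr₃ 11 (by norm_num)]
    · obtain ⟨ht₂, hs₂, hm₂, g10, g12, hc₂, hb₂⟩ := hinv₂
      refine ⟨⟨?_, hs₂, hm₂, hc₂, fun k hk hik y => hb₂ k hk y (by omega)⟩, g10⟩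
      have : (i + 1) * (n * 12 + 5) = i * (n * 12 + 5) + (n * 12 + 5) := by ring
      omega
  · obtain ⟨ht, hs₁, hm, hc, hbest⟩ := hinv
    exact h _ _ (by omega) hs₁ hc fun k hk => hbest k hk (Nat.zero_le _)

theorem wp_outputRatio (hW : Roomy n W) (hc : IsCandidate G (s.reg 17) (s.reg 18))
    (h : ∀ t' s', t' ≤ t + 4 → s'.reg 1 ≠ 0 → (s'.reg 0 : ℝ) / s'.reg 1 =
      (if s.reg 18 < s.reg 17 then 1 else (s.reg 17 : ℝ) / (s.reg 17 + s.reg 18)) → Q t' s') :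
    wp W outputRatio Q t s := by
  have hle := hW.le
  have hpos := hW.pos
  have hsum := hc.add_le
  have hp0 : 0 < s.reg 17 := by obtain ⟨_, _, _, h0, _⟩ := hc; exact h0
  refine wp_seq (wp_sub (wp_ite (fun hne => ?_) fun h0 => ?_))
  · have hlt : s.reg 18 < s.reg 17 := by simp at hne; omega
    refine wp_seq (wp_const (by omega) (wp_const (by omega) (h _ _ le_rfl ?_ ?_)))
    · simp
    · simp [hlt]
  · have hlt : ¬s.reg 18 < s.reg 17 := by simp at h0; omega
    refine wp_seq (wp_copy (wp_add (by simp; omega) (h _ _ le_rfl ?_ ?_)))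
    · simp; omega
    · simp [hlt]

/-- Compute the tensor capacity of an interval graph. -/
def capacityProg : RAMProg :=
  .seq initConsts <| .seq storeDegrees <| .seq orientAll <| .seq storeDiffs <|
  .seq storeTable <| .seq findBest outputRatio

theorem wp_capacityProg (hW : Roomy n W) (hG : IsIntervalGraph G)
    (h : ∀ t' s', t' ≤ t + 250 * n ^ 3 → s'.reg 1 ≠ 0 →
      IsTensorCapacity G ((s'.reg 0 : ℝ) / s'.reg 1) → Q t' s') :
    wp W capacityProg Q t (graphInput G) := by
  have hpos := hW.pos
  refine wp_seq (wp_initConsts hW fun s1 hs1 => wp_seq (wp_storeDegrees hW hs1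
    fun t2 s2 ht2 hs2 h8 => wp_seq (wp_orientAll hW hG hs2 h8 fun t3 s3 L ht3 hs3 hT => ?_)))
  have hg3 : GraphEnv G (pairRel L) s3 := ⟨hs3.consts, hs3.adj, fun i j => by
    rw [hs3.mem]
    exact if_congr Iff.rfl rfl rfl⟩
  refine wp_seq (wp_storeDiffs hW hg3 fun t4 s4 ht4 hs4 hd4 h54 => wp_seq (wp_storeTable hT hW
    ⟨hs4, hd4⟩ (fun y => ?_) fun t5 s5 ht5 hs5 htab hrow => wp_seq (wp_findBest hW
    hs5.graph.consts htab hrow fun t6 s6 ht6 hs6 hc hopt => wp_outputRatio hW hc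
    fun t7 s7 ht7 h1 he => h _ _ ?_ h1 ?_)))
  · have := h54 ⟨0, hpos⟩ y
    rw [this, RAMState.mat, zero_mul, zero_add, hs3.deg]
  -- The cubic terms add up to `42 + 72 + 13 + 18 = 145`. Since `1 ≤ n`, lower powers are at most `n
  -- ^ 3`, and all coefficients together sum to `244`.
  · have e1 : n ≤ n * n := Nat.le_mul_self n
    have e2 : n * n ≤ n * n * n := Nat.le_mul_of_pos_right _ hpos
    have e3 : n ^ 3 = n * n * n := by ring
    rw [e3]
    ring_nf at *
    omega
  · rw [he]
    exact hc.isTensorCapacity hT hpos htab hopt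

end OutputProgram
theorem mainTheorem12 :
    -- one program computes the tensor capacity of every interval graph, as a fraction `p / q`,
    -- from the adjacency matrix, in `O(n ^ 3)` steps on words of `O(log n)` bits
    (∃ (P : RAMProg) (C : ℕ), ∀ (n : ℕ) (G : SimpleGraph (Fin n)), 1 ≤ n → IsIntervalGraph G →
      ∃ (t : ℕ) (s : RAMState), t ≤ C * n ^ 3 ∧ RAMExec (C * n ^ C) P (graphInput G) t s ∧
        s.reg 1 ≠ 0 ∧ IsTensorCapacity G ((s.reg 0 : ℝ) / (s.reg 1 : ℝ))) ∧
    -- the recurrence for `i(x, k)`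
    (∀ (n : ℕ) (J : Fin n → Set ℝ), IsIntervalFamily J → ∀ x : Fin n,
      minNbhd J x 1 = (nbhd (intersectionGraph J) {x}).encard ∧
      ∀ k : ℕ, 2 ≤ k → minNbhd J x k =
        ⨅ y ∈ {y : Fin n | LiesLeft J y x}, (minNbhd J y (k - 1) +
          (nbhd (intersectionGraph J) {x} \ nbhd (intersectionGraph J) {y}).encard)) := by
  refine ⟨⟨capacityProg, 250, fun n G hn hG => ?_⟩, fun n J hJ x =>
    ⟨minNbhd_one J x, fun k hk => minNbhd_eq_iInf hJ x hk⟩⟩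
  -- Words up to `8 * n ^ 3` suffice; the large exponent only arises because one constant `C` serves
  -- as the factor in both bounds and as the exponent.
  have hW : Roomy n (250 * n ^ 250) := by
    refine ⟨hn, ?_⟩
    have h1 : n ^ 3 ≤ n ^ 250 := Nat.pow_le_pow_right hn (by norm_num)
    have h2 : n ^ 3 = n * n * n := by ring
    rw [← h2]
    omega
  obtain ⟨t, s, hex, ht, h1, hcap⟩ := wp_capacityProg (t := 0)
    (Q := fun t s => t ≤ 250 * n ^ 3 ∧ s.reg 1 ≠ 0 ∧
      IsTensorCapacity G ((s.reg 0 : ℝ) / (s.reg 1 : ℝ))) hW hG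
    fun t' s' ht h1 hcap => ⟨by omega, h1, hcap⟩
  exact ⟨t, s, by omega, hex, h1, hcap⟩
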